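/- **Böhm trees.** Fix a set $\mathcal C$ of constants. A *$\bot$-free Böhm tree* is a possibly infinite tree of the form $M=\lambda x_1\dots\lambda x_l.\,h\cdot(M_1;\dots;M_m)$ with $l,m<\infty$, where the head $h$ is a variable or a constant from $\mathcal C$ and $M_1,\dots,M_m$ are again such trees (coinductively). A *trace* of $M$ is the sequence consisting of $h$ followed, if $m>0$, by a trace of one of the $M_i$ (and of $h$ alone if $m=0$). $M$ is *productive* (valid) if constants occur infinitely often along each infinite trace of $M$. **Terms of the framework (CoLF$^\omega$).** Over a set of signature constants, canonical terms of observation depth $k+1$ are given by $M_{(k+1)}::=\lambda x.M_{(k+1)}\mid x\cdot(M_{(k+1)};\dots;M_{(k+1)})\mid c\cdot(M_{(k)};\dots;M_{(k)})$, and terms of depth $0$ are unobservable. An infinitary canonical term is a term that can be observed at every depth, i.e. a compatible sequence $(M_{(k)})_{k}$ of terms of depth $k$; traces are defined as above. Types are $a\cdot S$ and $\Pi x{:}B.\,A$ ($S$ a list of terms, of one observation less than the type). $\Gamma\vdash_\Sigma M\Leftarrow A$ means that, for every $k$, the observations at depth $k$ satisfy $\Gamma_{(k)}\vdash_{\Sigma_{(k)}}M_{(k)}\Leftarrow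 A_{(k)}$ by the usual bidirectional rules for LF canonical forms with hereditary substitution, where everything of depth $0$ checks and the arguments of a signature constant in a term of depth $k+1$ are checked at depth $k$. A constructor is coinductive if the kind of the family its type ends in ends in $\mathtt{cotype}$; its priority is that of this family, later declared families having higher priority. A term is *valid* if along each infinite trace there is a coinductive constructor that occurs infinitely often and such that no constructor of higher priority occurs infinitely often. **The signature $\Sigma_5$** declares, in this order, the families $\mathtt{ctm}:\mathtt{type}$, $\mathtt{spine}:\mathtt{type}$, $\mathtt{ntm}:\mathtt{cotype}$, $\mathtt{vars}:\mathtt{type}$, $\mathtt{consts}:\mathtt{type}$, $\mathtt{prodc}:\mathtt{ctm}\to\mathtt{type}$, $\mathtt{prodn}:\mathtt{ntm}\to\mathtt{type}$, $\mathtt{prodt}:\mathtt{spine}\to\mathtt{type}$, $\mathtt{prods}:\mathtt{spine}\to\mathtt{cotype}$, and the constants $c:\mathtt{consts}$ (for $c\in\mathcal C$), $\mathtt{lam}:(\mathtt{vars}\to\mathtt{ctm})\to\mathtt{ctm}$, $\mathtt{base}:\mathtt{ntm}\to\mathtt{ctm}$, $\mathtt{varntm}:\mathtt{vars}\to\mathtt{spine}\to\mathtt{ntm}$,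 $\mathtt{constntm}:\mathtt{consts}\to\mathtt{spine}\to\mathtt{ntm}$, $\mathtt{snil}:\mathtt{spine}$, $\mathtt{scons}:\mathtt{ctm}\to\mathtt{spine}\to\mathtt{spine}$ and $$\begin{aligned} \mathtt{p1}&:(\Pi x{:}\mathtt{vars}.\,\mathtt{prodc}\,(M\,x))\to\mathtt{prodc}\,(\mathtt{lam}\,M), & \mathtt{p2}&:\mathtt{prodn}\,R\to\mathtt{prodc}\,(\mathtt{base}\,R),\\ \mathtt{p3}&:\mathtt{prodt}\,S\to\mathtt{prodn}\,(\mathtt{varntm}\,V\,S), & \mathtt{p4}&:\mathtt{prods}\,S\to\mathtt{prodn}\,(\mathtt{constntm}\,C\,S),\\ \mathtt{p5}&:\mathtt{prodt}\,\mathtt{snil}, & \mathtt{p6}&:\mathtt{prodc}\,M\to\mathtt{prodt}\,S\to\mathtt{prodt}\,(\mathtt{scons}\,M\,S),\\ \mathtt{p7}&:\mathtt{prods}\,\mathtt{snil}, & \mathtt{p8}&:\mathtt{prodc}\,M\to\mathtt{prods}\,S\to\mathtt{prods}\,(\mathtt{scons}\,M\,S), \end{aligned}$$ where the capital letters $M,R,S,V,C$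 are arguments, universally quantified at the front of each type and omitted from the notation. The encoding of Böhm trees is given by $\ulcorner\lambda x.M\urcorner=\mathtt{lam}\,(\lambda x.\ulcorner M\urcorner)$, $\ulcorner x\cdot(M_1;\dots;M_m)\urcorner=\mathtt{base}\,(\mathtt{varntm}\,x\,s)$ and $\ulcorner c\cdot(M_1;\dots;M_m)\urcorner=\mathtt{base}\,(\mathtt{constntm}\,c\,s)$, with $s=\mathtt{scons}\,\ulcorner M_1\urcorner(\dots(\mathtt{scons}\,\ulcorner M_m\urcorner\,\mathtt{snil}))$. **Theorem (Adequacy of Encoding).** Let $M$ be a $\bot$-free Böhm tree with free variables among $x_1,\dots,x_n$ ($n\ge 0$), and let $\Gamma=x_1{:}\mathtt{vars},\dots,x_n{:}\mathtt{vars}$. Then $M$ is productive if and only if the type $\mathtt{prodc}\,\ulcorner M\urcorner$ is inhabited, i.e. there is a valid infinitary canonical term $D$ with $\Gamma\vdash_{\Sigma_5}D\Leftarrow\mathtt{prodc}\,\ulcorner M\urcorner$. Moreover, whether or not $M$ is productive, there is exactly one infinitary term $D$, valid or not, with $\Gamma\vdash_{\Sigma_5}D\Leftarrow\mathtt{prodc}\,\ulcorner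 M\urcorner$; in particular the inhabitant, when it exists, is unique. -/

import Mathlib

universe u

/-! ## Infinitary canonical terms of the framework

Variables are well-scoped de Bruijn indices: `n` is the number of variables in scope and
index `0` is the innermost one. -/

/-- Canonical terms of observation depth `k`, over the constants `K`. At depth `0` a term is not
observable. The arguments of a variable head (a continuing spine) are observed at the same depth,
those of a constant head (a suspended spine) have one observation less.
The neutral terms are those that are not an abstraction. -/
inductive Tm (K : Type u) : ℕ → ℕ → Type u
  | unobs {n : ℕ} : Tm K 0 n
  | lam {k n : ℕ} (b : Tm K (k + 1) (n + 1)) : Tm K (k + 1) n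
  | var {k n : ℕ} (x : Fin n) (m : ℕ) (T : Fin m → Tm K (k + 1) n) : Tm K (k + 1) n
  | con {k n : ℕ} (c : K) (m : ℕ) (S : Fin m → Tm K k n) : Tm K (k + 1) n

/-- A renaming extended under a binder. -/
def liftRen {n m : ℕ} (f : Fin n → Fin m) : Fin (n + 1) → Fin (m + 1) :=
  Fin.cases 0 fun i => (f i).succ

namespace Tm

variable {K : Type u}

/-- A term of depth `k` viewed at a lesser depth `j`. -/
def obs : {k n : ℕ} → Tm K k n → (j : ℕ) → j ≤ k → Tm K j n
  | _, _, _, 0, _ => unobs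
  | _, _, lam b, j + 1, h => lam (b.obs (j + 1) h)
  | _, _, var x m T, j + 1, h => var x m fun i => (T i).obs (j + 1) h
  | _, _, con c m S, j + 1, h => con c m fun i => (S i).obs j (Nat.le_of_succ_le_succ h)

/-- A term of depth `k + 1` viewed at depth `k`. -/
def trunc {k n : ℕ} (M : Tm K (k + 1) n) : Tm K k n := M.obs k (Nat.le_succ k)

/-- Renaming of the free variables. -/
def rename : {k n m : ℕ} → (Fin n → Fin m) → Tm K k n → Tm K k m
  | _, _, _, _, unobs => unobs
  | _, _, _, f, lam b => lam (b.rename (liftRen f))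
  | _, _, _, f, var x l T => var (f x) l fun i => (T i).rename f
  | _, _, _, f, con c l S => con c l fun i => (S i).rename f

/-- Weakening by one variable, the new one being index `0`. -/
def weaken {k n : ℕ} (M : Tm K k n) : Tm K k (n + 1) := M.rename Fin.succ

/-- Neutral terms: a head applied to a spine. -/
def IsNeutral : {k n : ℕ} → Tm K k n → Prop
  | _, _, var _ _ _ => True
  | _, _, con _ _ _ => True
  | _, _, _ => False

theorem obs_obs : {k n : ℕ} → (M : Tm K k n) → (j i : ℕ) → (h : j ≤ k) → (h' : i ≤ j) →
    (M.obs j h).obs i h' = M.obs i (h'.trans h)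
  | _, _, _, _, 0, _, _ => by simp [obs]
  | _, _, unobs, j, i + 1, h, h' => absurd (h'.trans h) (Nat.not_succ_le_zero i)
  | _, _, lam b, j + 1, i + 1, h, h' => by
      simp only [obs]; rw [obs_obs b]
  | _, _, var x m T, j + 1, i + 1, h, h' => by
      simp only [obs]; congr 1; funext a; rw [obs_obs (T a)]
  | _, _, con c m S, j + 1, i + 1, h, h' => by
      simp only [obs]; congr 1; funext a; rw [obs_obs (S a)]

end Tm

/-- Infinitary canonical terms: terms that can be observed at every depth. -/
@[ext]
structure OTm (K : Type u) (n : ℕ) where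
  obs : (k : ℕ) → Tm K k n
  compat : ∀ k, (obs (k + 1)).trunc = obs k

/-! ## Hereditary substitution -/

/-- Simple types. -/
inductive STy
  | base : STy
  | arr (σ τ : STy) : STy

mutual

/-- `HSubst τ N x M M'`: the hereditary substitution `[N/x]^τ M` is defined and is `M'`.
The variables of `M` other than `x` are `x.succAbove y`, with `y` a variable of `N` and `M'`. -/
inductive HSubst {K : Type u} : STy → {k n : ℕ} → Tm K k n → Fin (n + 1) →
    Tm K k (n + 1) → Tm K k n → Prop
  | unobs {τ : STy} {n : ℕ} {x : Fin (n + 1)} : HSubst τ .unobs x .unobs .unobs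
  | lam {τ : STy} {k n : ℕ} {N : Tm K (k + 1) n} {x : Fin (n + 1)}
      {M : Tm K (k + 1) (n + 2)} {M' : Tm K (k + 1) (n + 1)} :
      HSubst τ N.weaken x.succ M M' → HSubst τ N x (.lam M) (.lam M')
  | varSame {τ : STy} {k n m : ℕ} {N : Tm K (k + 1) n} {x : Fin (n + 1)}
      {T : Fin m → Tm K (k + 1) (n + 1)} {T' : Fin m → Tm K (k + 1) n} {N' : Tm K (k + 1) n} :
      (∀ i, HSubst τ N x (T i) (T' i)) → HApp τ T' N N' → HSubst τ N x (.var x m T) N'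
  | varOther {τ : STy} {k n m : ℕ} {N : Tm K (k + 1) n} {x : Fin (n + 1)} {y : Fin n}
      {T : Fin m → Tm K (k + 1) (n + 1)} {T' : Fin m → Tm K (k + 1) n} :
      (∀ i, HSubst τ N x (T i) (T' i)) → HSubst τ N x (.var (x.succAbove y) m T) (.var y m T')
  | con {τ : STy} {k n m : ℕ} {N : Tm K (k + 1) n} {x : Fin (n + 1)} {c : K}
      {S : Fin m → Tm K k (n + 1)} {S' : Fin m → Tm K k n} :
      (∀ i, HSubst τ N.trunc x (S i) (S' i)) → HSubst τ N x (.con c m S) (.con c m S')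

/-- `HApp τ T N R`: the application `T ▷^τ N` of the term `N` to the continuing spine `T`
is defined and is `R`. -/
inductive HApp {K : Type u} : STy → {k n m : ℕ} → (Fin m → Tm K k n) →
    Tm K k n → Tm K k n → Prop
  | unobs {τ : STy} {n m : ℕ} {T : Fin m → Tm K 0 n} : HApp τ T .unobs .unobs
  | nil {k n : ℕ} {T : Fin 0 → Tm K (k + 1) n} {R : Tm K (k + 1) n} :
      R.IsNeutral → HApp .base T R R
  | cons {σ τ : STy} {k n m : ℕ} {T : Fin (m + 1) → Tm K (k + 1) n}
      {M : Tm K (k + 1) (n + 1)} {M' M'' : Tm K (k + 1) n} :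
      HSubst σ (T 0) 0 M M' → HApp τ (fun i => T i.succ) M' M'' →
      HApp (.arr σ τ) T (.lam M) M''

end

/-! ## Types and contexts -/

/-- Canonical types of observation depth `k` over the type families `F`: atomic types `a · S` with
a suspended spine, and dependent products. -/
inductive Ty (F : Type) (K : Type u) : ℕ → ℕ → Type u
  | unobs {n : ℕ} : Ty F K 0 n
  | atom {k n : ℕ} (a : F) (m : ℕ) (S : Fin m → Tm K k n) : Ty F K (k + 1) n
  | pi {k n : ℕ} (B : Ty F K (k + 1) n) (A : Ty F K (k + 1) (n + 1)) : Ty F K (k + 1) n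

namespace Ty

variable {F : Type} {K : Type u}

/-- A type of depth `k` viewed at a lesser depth `j`. -/
def obs : {k n : ℕ} → Ty F K k n → (j : ℕ) → j ≤ k → Ty F K j n
  | _, _, _, 0, _ => unobs
  | _, _, atom a m S, j + 1, h => atom a m fun i => (S i).obs j (Nat.le_of_succ_le_succ h)
  | _, _, pi B A, j + 1, h => pi (B.obs (j + 1) h) (A.obs (j + 1) h)

/-- A type of depth `k + 1` viewed at depth `k`. -/
def trunc {k n : ℕ} (A : Ty F K (k + 1) n) : Ty F K k n := A.obs k (Nat.le_succ k)

/-- Renaming of the free variables. -/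
def rename : {k n m : ℕ} → (Fin n → Fin m) → Ty F K k n → Ty F K k m
  | _, _, _, _, unobs => unobs
  | _, _, _, f, atom a l S => atom a l fun i => (S i).rename f
  | _, _, _, f, pi B A => pi (B.rename f) (A.rename (liftRen f))

/-- Erasure to simple types (used for observable types only). -/
def erase : {k n : ℕ} → Ty F K k n → STy
  | _, _, pi B A => .arr B.erase A.erase
  | _, _, _ => .base

end Ty

/-- Hereditary substitution `[N/x]^τ A = A'` in canonical types. -/
inductive HSubstTy {F : Type} {K : Type u} (τ : STy) : {k n : ℕ} → Tm K k n → Fin (n + 1) →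
    Ty F K (k + 1) (n + 1) → Ty F K (k + 1) n → Prop
  | atom {k n m : ℕ} {N : Tm K k n} {x : Fin (n + 1)} {a : F}
      {S : Fin m → Tm K k (n + 1)} {S' : Fin m → Tm K k n} :
      (∀ i, HSubst τ N x (S i) (S' i)) → HSubstTy τ N x (.atom a m S) (.atom a m S')
  | pi {k n : ℕ} {N : Tm K k n} {x : Fin (n + 1)} {B : Ty F K (k + 1) (n + 1)}
      {A : Ty F K (k + 1) (n + 2)} {B' : Ty F K (k + 1) n} {A' : Ty F K (k + 1) (n + 1)} :
      HSubstTy τ N x B B' → HSubstTy τ N.weaken x.succ A A' → HSubstTy τ N x (.pi B A) (.pi B' A')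

/-- Contexts of depth `k`: the type of each of the `n` variables, as a type over all of them. -/
abbrev Ctx (F : Type) (K : Type u) (k n : ℕ) := Fin n → Ty F K k n

namespace Ctx

variable {F : Type} {K : Type u} {k n : ℕ}

/-- The context `Γ, x : A`. -/
def snoc (Γ : Ctx F K k n) (A : Ty F K k n) : Ctx F K k (n + 1) :=
  Fin.cases (A.rename Fin.succ) fun x => (Γ x).rename Fin.succ

/-- A context of depth `k + 1` viewed at depth `k`. -/
def trunc (Γ : Ctx F K (k + 1) n) : Ctx F K k n := fun x => (Γ x).trunc

end Ctx

/-! ## Finitary signatures and their expansion -/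

/-- Finitary canonical terms. -/
inductive FTm (K : Type u) : ℕ → Type u
  | lam {n : ℕ} (b : FTm K (n + 1)) : FTm K n
  | var {n : ℕ} (x : Fin n) (m : ℕ) (S : Fin m → FTm K n) : FTm K n
  | con {n : ℕ} (c : K) (m : ℕ) (S : Fin m → FTm K n) : FTm K n

/-- Finitary canonical types. -/
inductive FTy (F : Type) (K : Type u) : ℕ → Type u
  | atom {n : ℕ} (a : F) (m : ℕ) (S : Fin m → FTm K n) : FTy F K n
  | pi {n : ℕ} (B : FTy F K n) (A : FTy F K (n + 1)) : FTy F K n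

/-- Finitary kinds. -/
inductive FKind (F : Type) (K : Type u) : ℕ → Type u
  | type {n : ℕ} : FKind F K n
  | cotype {n : ℕ} : FKind F K n
  | pi {n : ℕ} (A : FTy F K n) (L : FKind F K (n + 1)) : FKind F K n

/-- Expansion of a finitary term to observation depth `k`. -/
def FTm.expand {K : Type u} : {n : ℕ} → FTm K n → (k : ℕ) → Tm K k n
  | _, _, 0 => .unobs
  | _, .lam b, k + 1 => .lam (b.expand (k + 1))
  | _, .var x m S, k + 1 => .var x m fun i => (S i).expand (k + 1)
  | _, .con c m S, k + 1 => .con c m fun i => (S i).expand k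

namespace FTy

variable {F : Type} {K : Type u}

/-- Expansion of a finitary type to observation depth `k`. -/
def expand : {n : ℕ} → FTy F K n → (k : ℕ) → Ty F K k n
  | _, _, 0 => .unobs
  | _, .atom a m S, k + 1 => .atom a m fun i => (S i).expand k
  | _, .pi B A, k + 1 => .pi (B.expand (k + 1)) (A.expand (k + 1))

/-- The family `a` of a type `Π x₁ : A₁ … Π xₙ : Aₙ. a · S`. -/
def target : {n : ℕ} → FTy F K n → F
  | _, .atom a _ _ => a
  | _, .pi _ A => A.target

end FTy

/-- A kind `Π x₁ : A₁ … Π xₙ : Aₙ. cotype`. -/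
def FKind.IsCo {F : Type} {K : Type u} : {n : ℕ} → FKind F K n → Prop
  | _, .type => False
  | _, .cotype => True
  | _, .pi _ L => L.IsCo

/-- A finitary signature (without recursive definitions): it declares each family `a` with a kind
and each constant `c` with a type. `priority a` is the place of the declaration of `a`
among the declarations of families; families declared later have higher priority. -/
structure Sig where
  Fam : Type
  Con : Type u
  kind : Fam → FKind Fam Con 0
  type : Con → FTy Fam Con 0
  priority : Fam → ℕ

namespace Sig

/-- The type of a constant at depth `k`, in a scope of `n` variables. -/
def typeAt (S : Sig.{u}) (c : S.Con) (k n : ℕ) : Ty S.Fam S.Con k n :=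
  ((S.type c).expand k).rename Fin.elim0

/-- A constructor is coinductive if its type is. -/
def IsCo (S : Sig.{u}) (c : S.Con) : Prop := (S.kind (S.type c).target).IsCo

/-- Constructors inherit the priority of their type. -/
def conPriority (S : Sig.{u}) (c : S.Con) : ℕ := S.priority (S.type c).target

end Sig

/-! ## Type checking -/

mutual

/-- `Γ ⊢ M ⇐ A`. Terms of depth `0` check trivially. In the rule for neutral terms the synthesized
type and the given one have to be equal up to the depth at hand. -/
inductive Check (S : Sig.{u}) : {k n : ℕ} → Ctx S.Fam S.Con k n → Tm S.Con k n →
    Ty S.Fam S.Con k n → Prop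
  | unobs {n : ℕ} {Γ : Ctx S.Fam S.Con 0 n} {A : Ty S.Fam S.Con 0 n} : Check S Γ .unobs A
  | neutral {k n : ℕ} {Γ : Ctx S.Fam S.Con (k + 1) n} {R : Tm S.Con (k + 1) n}
      {P' P : Ty S.Fam S.Con (k + 1) n} : Synth S Γ R P' → P' = P → Check S Γ R P
  | lam {k n : ℕ} {Γ : Ctx S.Fam S.Con (k + 1) n} {M : Tm S.Con (k + 1) (n + 1)}
      {B : Ty S.Fam S.Con (k + 1) n} {A : Ty S.Fam S.Con (k + 1) (n + 1)} :
      Check S (Γ.snoc B) M A → Check S Γ (.lam M) (.pi B A)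

/-- `Γ ⊢ R ⇒ P` for neutral terms `R` of positive depth. -/
inductive Synth (S : Sig.{u}) : {k n : ℕ} → Ctx S.Fam S.Con (k + 1) n → Tm S.Con (k + 1) n →
    Ty S.Fam S.Con (k + 1) n → Prop
  | var {k n m : ℕ} {Γ : Ctx S.Fam S.Con (k + 1) n} {x : Fin n}
      {T : Fin m → Tm S.Con (k + 1) n} {P : Ty S.Fam S.Con (k + 1) n} :
      ContSpine S Γ T (Γ x) P → Synth S Γ (.var x m T) P
  | con {k n m : ℕ} {Γ : Ctx S.Fam S.Con (k + 1) n} {c : S.Con}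
      {T : Fin m → Tm S.Con k n} {P : Ty S.Fam S.Con (k + 1) n} :
      SuspSpine S Γ T (S.typeAt c (k + 1) n) P → Synth S Γ (.con c m T) P

/-- `Γ ⊢ T ▷ A ⇒ P` for continuing spines `T`; the result `P` is atomic. -/
inductive ContSpine (S : Sig.{u}) : {k n m : ℕ} → Ctx S.Fam S.Con (k + 1) n →
    (Fin m → Tm S.Con (k + 1) n) → Ty S.Fam S.Con (k + 1) n → Ty S.Fam S.Con (k + 1) n → Prop
  | nil {k n l : ℕ} {Γ : Ctx S.Fam S.Con (k + 1) n} {T : Fin 0 → Tm S.Con (k + 1) n}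
      {a : S.Fam} {U : Fin l → Tm S.Con k n} : ContSpine S Γ T (.atom a l U) (.atom a l U)
  | cons {k n m : ℕ} {Γ : Ctx S.Fam S.Con (k + 1) n} {T : Fin (m + 1) → Tm S.Con (k + 1) n}
      {B : Ty S.Fam S.Con (k + 1) n} {A : Ty S.Fam S.Con (k + 1) (n + 1)}
      {A' P : Ty S.Fam S.Con (k + 1) n} :
      Check S Γ (T 0) B → HSubstTy B.erase (T 0).trunc 0 A A' →
      ContSpine S Γ (fun i => T i.succ) A' P → ContSpine S Γ T (.pi B A) P

/-- `Γ ⊢ T ▷ A ⇒ P` for suspended spines `T`, whose elements have one observation less than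
the spine, and are checked at that lesser depth; the result `P` is atomic. -/
inductive SuspSpine (S : Sig.{u}) : {k n m : ℕ} → Ctx S.Fam S.Con (k + 1) n →
    (Fin m → Tm S.Con k n) → Ty S.Fam S.Con (k + 1) n → Ty S.Fam S.Con (k + 1) n → Prop
  | nil {k n l : ℕ} {Γ : Ctx S.Fam S.Con (k + 1) n} {T : Fin 0 → Tm S.Con k n}
      {a : S.Fam} {U : Fin l → Tm S.Con k n} : SuspSpine S Γ T (.atom a l U) (.atom a l U)
  | cons {k n m : ℕ} {Γ : Ctx S.Fam S.Con (k + 1) n} {T : Fin (m + 1) → Tm S.Con k n}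
      {B : Ty S.Fam S.Con (k + 1) n} {A : Ty S.Fam S.Con (k + 1) (n + 1)}
      {A' P : Ty S.Fam S.Con (k + 1) n} :
      Check S Γ.trunc (T 0) B.trunc → HSubstTy B.erase (T 0) 0 A A' →
      SuspSpine S Γ (fun i => T i.succ) A' P → SuspSpine S Γ T (.pi B A) P

end

/-- `Γ ⊢ M ⇐ A` for infinitary terms: the observations check at every depth. -/
def OCheck (S : Sig.{u}) {n : ℕ} (Γ : (k : ℕ) → Ctx S.Fam S.Con k n) (M : OTm S.Con n)
    (A : (k : ℕ) → Ty S.Fam S.Con k n) : Prop :=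
  ∀ k, Check S (Γ k) (M.obs k) (A k)

/-- The infinitary atomic type `a · (M₁; …; Mₘ)`. -/
def OAtom {F : Type} {K : Type u} {n : ℕ} (a : F) (m : ℕ) (M : Fin m → OTm K n) :
    (k : ℕ) → Ty F K k n
  | 0 => .unobs
  | k + 1 => .atom a m fun i => (M i).obs k

/-! ## Traces and validity -/

/-- Heads: variables or constants. -/
inductive Head (K : Type u) : Type u
  | var (x : ℕ) : Head K
  | con (c : K) : Head K

/-- The head found by following the arguments numbered as in the list, if it has been observed. -/
def Tm.headAt {K : Type u} : {k n : ℕ} → Tm K k n → List ℕ → Option (Head K)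
  | _, _, .unobs, _ => none
  | _, _, .lam b, p => b.headAt p
  | _, _, .var x _ _, [] => some (.var x)
  | _, _, .con c _ _, [] => some (.con c)
  | _, _, .var _ m T, i :: p => if h : i < m then (T ⟨i, h⟩).headAt p else none
  | _, _, .con _ m T, i :: p => if h : i < m then (T ⟨i, h⟩).headAt p else none

/-- `t` is an infinite trace of `M`: the sequence of heads along an infinite path `π`, each being
the head of a direct child of the preceding one. -/
def OTm.IsTrace {K : Type u} {n : ℕ} (M : OTm K n) (t : ℕ → Head K) : Prop :=
  ∃ π : ℕ → ℕ, ∀ j, ∃ k, (M.obs k).headAt ((List.range j).map π) = some (t j)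

/-- `M` is (trace-)valid: along every infinite trace some coinductive constructor occurs
infinitely often, and no constructor of higher priority occurs infinitely often. -/
def OTm.Valid (S : Sig.{u}) {n : ℕ} (M : OTm S.Con n) : Prop :=
  ∀ t, M.IsTrace t → ∃ c, S.IsCo c ∧ {j | t j = .con c}.Infinite ∧
    ∀ d, {j | t j = .con d}.Infinite → S.conPriority d ≤ S.conPriority c

/-- Infinitary canonical terms of type `A` in context `Γ`. -/
def IsCanonical (S : Sig.{u}) {n : ℕ} (Γ : (k : ℕ) → Ctx S.Fam S.Con k n) (M : OTm S.Con n)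
    (A : (k : ℕ) → Ty S.Fam S.Con k n) : Prop :=
  OCheck S Γ M A ∧ M.Valid S

/-! ## Böhm trees -/

/-- Observations of depth `k` of `⊥`-free Böhm trees with constants from `C` and free variables
among `n` given ones: one observation reveals all the abstractions and the head
(a variable or a constant), while its arguments are observed later. -/
inductive BT (C : Type u) : ℕ → ℕ → Type u
  | unobs {n : ℕ} : BT C 0 n
  | lam {k n : ℕ} (b : BT C (k + 1) (n + 1)) : BT C (k + 1) n
  | var {k n : ℕ} (x : Fin n) (m : ℕ) (T : Fin m → BT C k n) : BT C (k + 1) n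
  | con {k n : ℕ} (c : C) (m : ℕ) (T : Fin m → BT C k n) : BT C (k + 1) n

namespace BT

variable {C : Type u}

/-- An observation of depth `k` viewed at a lesser depth `j`. -/
def obs : {k n : ℕ} → BT C k n → (j : ℕ) → j ≤ k → BT C j n
  | _, _, _, 0, _ => unobs
  | _, _, lam b, j + 1, h => lam (b.obs (j + 1) h)
  | _, _, var x m T, j + 1, h => var x m fun i => (T i).obs j (Nat.le_of_succ_le_succ h)
  | _, _, con c m T, j + 1, h => con c m fun i => (T i).obs j (Nat.le_of_succ_le_succ h)

/-- An observation of depth `k + 1` viewed at depth `k`. -/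
def trunc {k n : ℕ} (M : BT C (k + 1) n) : BT C k n := M.obs k (Nat.le_succ k)

/-- The head found by following the arguments numbered as in the list, if it has been observed. -/
def headAt : {k n : ℕ} → BT C k n → List ℕ → Option (Head C)
  | _, _, unobs, _ => none
  | _, _, lam b, p => b.headAt p
  | _, _, var x _ _, [] => some (.var x)
  | _, _, con c _ _, [] => some (.con c)
  | _, _, var _ m T, i :: p => if h : i < m then (T ⟨i, h⟩).headAt p else none
  | _, _, con _ m T, i :: p => if h : i < m then (T ⟨i, h⟩).headAt p else none

end BT

/-- `⊥`-free Böhm trees with constants from `C` and free variables among `n` given ones. -/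
@[ext]
structure BohmTree (C : Type u) (n : ℕ) where
  obs : (k : ℕ) → BT C k n
  compat : ∀ k, (obs (k + 1)).trunc = obs k

namespace BohmTree

variable {C : Type u} {n : ℕ}

/-- `t` is an infinite trace of `M`. -/
def IsTrace (M : BohmTree C n) (t : ℕ → Head C) : Prop :=
  ∃ π : ℕ → ℕ, ∀ j, ∃ k, (M.obs k).headAt ((List.range j).map π) = some (t j)

/-- Constants occur infinitely often along each infinite trace. -/
def Productive (M : BohmTree C n) : Prop :=
  ∀ t, M.IsTrace t → {j | ∃ c, t j = .con c}.Infinite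

end BohmTree

/-! ## The signature for Böhm trees with the productivity predicate -/

/-- The type families, in the order of their declaration. -/
inductive Fam5
  | ctm | spine | ntm | vars | consts | prodc | prodn | prodt | prods

/-- The constants of the signature; `obj c` is the declaration `c : consts` of an object-level
constant `c`. -/
inductive Con5 (C : Type u) : Type u
  | lam | base | varntm | constntm | snil | scons
  | obj (c : C)
  | p1 | p2 | p3 | p4 | p5 | p6 | p7 | p8

namespace Sig5

variable {C : Type u} {n : ℕ}

/-- A family without indices. -/
abbrev fam (a : Fam5) : FTy Fam5 (Con5 C) n := .atom a 0 ![]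

/-- A family with one index. -/
abbrev fam1 (a : Fam5) (M : FTm (Con5 C) n) : FTy Fam5 (Con5 C) n := .atom a 1 ![M]

/-- A variable without arguments. -/
abbrev v (x : Fin n) : FTm (Con5 C) n := .var x 0 ![]

/-- The kinds of the families. -/
def kind : Fam5 → FKind Fam5 (Con5 C) 0
  | .ctm => .type
  | .spine => .type
  | .ntm => .cotype
  | .vars => .type
  | .consts => .type
  | .prodc => .pi (fam .ctm) .type
  | .prodn => .pi (fam .ntm) .type
  | .prodt => .pi (fam .spine) .type
  | .prods => .pi (fam .spine) .cotype

/-- The types of the constants. The implicitly quantified arguments come first. -/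
def type : Con5 C → FTy Fam5 (Con5 C) 0
  -- `(vars → ctm) → ctm`
  | .lam => .pi (.pi (fam .vars) (fam .ctm)) (fam .ctm)
  -- `ntm → ctm`
  | .base => .pi (fam .ntm) (fam .ctm)
  -- `vars → spine → ntm`
  | .varntm => .pi (fam .vars) (.pi (fam .spine) (fam .ntm))
  -- `consts → spine → ntm`
  | .constntm => .pi (fam .consts) (.pi (fam .spine) (fam .ntm))
  -- `spine`
  | .snil => fam .spine
  -- `ctm → spine → spine`
  | .scons => .pi (fam .ctm) (.pi (fam .spine) (fam .spine))
  -- `consts`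
  | .obj _ => fam .consts
  -- `Π M : vars → ctm. (Π x : vars. prodc (M x)) → prodc (lam (λ x. M x))`
  | .p1 => .pi (.pi (fam .vars) (fam .ctm))
      (.pi (.pi (fam .vars) (fam1 .prodc (.var 1 1 ![v 0])))
        (fam1 .prodc (.con .lam 1 ![.lam (.var 2 1 ![v 0])])))
  -- `Π R : ntm. prodn R → prodc (base R)`
  | .p2 => .pi (fam .ntm) (.pi (fam1 .prodn (v 0)) (fam1 .prodc (.con .base 1 ![v 1])))
  -- `Π S : spine. Π V : vars. prodt S → prodn (varntm V S)`
  | .p3 => .pi (fam .spine) (.pi (fam .vars)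
      (.pi (fam1 .prodt (v 1)) (fam1 .prodn (.con .varntm 2 ![v 1, v 2]))))
  -- `Π S : spine. Π c : consts. prods S → prodn (constntm c S)`
  | .p4 => .pi (fam .spine) (.pi (fam .consts)
      (.pi (fam1 .prods (v 1)) (fam1 .prodn (.con .constntm 2 ![v 1, v 2]))))
  -- `prodt snil`
  | .p5 => fam1 .prodt (.con .snil 0 ![])
  -- `Π M : ctm. Π S : spine. prodc M → prodt S → prodt (scons M S)`
  | .p6 => .pi (fam .ctm) (.pi (fam .spine) (.pi (fam1 .prodc (v 1)) (.pi (fam1 .prodt (v 1))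
      (fam1 .prodt (.con .scons 2 ![v 3, v 2])))))
  -- `prods snil`
  | .p7 => fam1 .prods (.con .snil 0 ![])
  -- `Π M : ctm. Π S : spine. prodc M → prods S → prods (scons M S)`
  | .p8 => .pi (fam .ctm) (.pi (fam .spine) (.pi (fam1 .prodc (v 1)) (.pi (fam1 .prods (v 1))
      (fam1 .prods (.con .scons 2 ![v 3, v 2])))))

/-- The priorities of the families: their order of declaration. -/
def priority : Fam5 → ℕ
  | .ctm => 0
  | .spine => 1
  | .ntm => 2
  | .vars => 3
  | .consts => 4
  | .prodc => 5
  | .prodn => 6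
  | .prodt => 7
  | .prods => 8

end Sig5

/-- The signature `Σ₅`, with an object-level constant for each element of `C`. -/
abbrev sig5 (C : Type u) : Sig.{u} where
  Fam := Fam5
  Con := Con5 C
  kind := Sig5.kind
  type := Sig5.type
  priority := Sig5.priority

/-- The context `x₁ : vars, …, xₙ : vars`. -/
def varsCtx (C : Type u) (n k : ℕ) : Ctx (sig5 C).Fam (sig5 C).Con k n :=
  fun _ => (Sig5.fam .vars).expand k

/-! ## The encoding of Böhm trees -/

namespace Enc

variable {C : Type u} {k n : ℕ}

/-- The constant `c` applied to arguments that are known to depth `k`, at depth `k`. -/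
def app (c : Con5 C) {m : ℕ} (S : Fin m → Tm (Con5 C) k n) : Tm (Con5 C) k n :=
  (Tm.con c m S).trunc

/-- The abstraction `λ x. M`, at depth `k`. -/
def abs (M : Tm (Con5 C) k (n + 1)) : Tm (Con5 C) k n :=
  match k, M with
  | 0, _ => .unobs
  | _ + 1, M => .lam M

/-- The variable `x`, at depth `k`. -/
def var (x : Fin n) : Tm (Con5 C) k n :=
  match k with
  | 0 => .unobs
  | _ + 1 => .var x 0 ![]

/-- The spine `scons M₁ (… (scons Mₘ snil))`, at depth `k`. -/
def spine : (m : ℕ) → (Fin m → Tm (Con5 C) k n) → Tm (Con5 C) k n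
  | 0, _ => app .snil ![]
  | m + 1, T => app .scons ![T 0, spine m fun i => T i.succ]

end Enc

/-- The encoding, on observations of depth `k`: `λ x. M` is sent to `lam (λ x. ⌜M⌝)`,
`x · (M₁; …; Mₘ)` to `base (varntm x S)` and `c · (M₁; …; Mₘ)` to `base (constntm c S)`, where
`S` is `scons ⌜M₁⌝ (… (scons ⌜Mₘ⌝ snil))`. -/
def BT.enc {C : Type u} : {k n : ℕ} → BT C k n → Tm (Con5 C) k n
  | _, _, .unobs => .unobs
  | _, _, .lam b => Enc.app .lam ![Enc.abs b.enc]
  | _, _, .var x m T =>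
      .con .base 1 ![Enc.app .varntm ![Enc.var x, Enc.spine m fun i => (T i).enc]]
  | _, _, .con c m T =>
      .con .base 1 ![Enc.app .constntm ![Enc.app (.obj c) ![], Enc.spine m fun i => (T i).enc]]

namespace Enc

variable {C : Type u} {n : ℕ}

theorem obs_app {k m : ℕ} (c : Con5 C) (S : Fin m → Tm (Con5 C) k n) (j : ℕ) (h : j ≤ k) :
    (app c S).obs j h = app c fun i => (S i).obs j h := by
  simp only [app, Tm.trunc, Tm.obs_obs]
  cases j with
  | zero => simp [Tm.obs]
  | succ j => simp only [Tm.obs, Tm.obs_obs]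

theorem obs_abs {k : ℕ} (M : Tm (Con5 C) k (n + 1)) (j : ℕ) (h : j ≤ k) :
    (abs M).obs j h = abs (M.obs j h) := by
  cases j with
  | zero => simp [Tm.obs, abs]
  | succ j =>
    cases k with
    | zero => omega
    | succ k => simp [Tm.obs, abs]

theorem obs_var {k : ℕ} (x : Fin n) (j : ℕ) (h : j ≤ k) :
    (var x : Tm (Con5 C) k n).obs j h = var x := by
  cases j with
  | zero => simp [Tm.obs, var]
  | succ j =>
    cases k with
    | zero => omega
    | succ k =>
      simp only [Tm.obs, var]
      congr 1
      funext i
      exact i.elim0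

theorem obs_spine {k : ℕ} (m : ℕ) (T : Fin m → Tm (Con5 C) k n) (j : ℕ) (h : j ≤ k) :
    (spine m T).obs j h = spine m fun i => (T i).obs j h := by
  induction m with
  | zero =>
    simp only [spine, obs_app]
    congr 1
    funext i
    exact i.elim0
  | succ m ih =>
    simp only [spine, obs_app]
    congr 1
    funext i
    refine Fin.cases ?_ (fun i => ?_) i
    · rfl
    · refine Fin.cases ?_ (fun i => i.elim0) i
      exact ih _

end Enc

theorem BT.obs_enc {C : Type u} : {k n : ℕ} → (M : BT C k n) → (j : ℕ) → (h : j ≤ k) →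
    M.enc.obs j h = (M.obs j h).enc
  | _, _, _, 0, _ => by simp [BT.obs, Tm.obs, BT.enc]
  | _, _, .lam b, j + 1, h => by
      simp only [BT.obs, BT.enc, Enc.obs_app]
      congr 1
      funext i
      refine Fin.cases ?_ (fun i => i.elim0) i
      simp only [Matrix.cons_val_zero, Enc.obs_abs]
      rw [BT.obs_enc b]
  | _, _, .var x m T, j + 1, h => by
      simp only [BT.obs, BT.enc, Tm.obs]
      congr 1
      funext i
      refine Fin.cases ?_ (fun i => i.elim0) i
      simp only [Matrix.cons_val_zero, Enc.obs_app]
      congr 1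
      funext i
      refine Fin.cases ?_ (fun i => Fin.cases ?_ (fun i => i.elim0) i) i
      · exact Enc.obs_var x j _
      · refine (Enc.obs_spine m _ j _).trans ?_
        simp only [Matrix.cons_val_succ, Matrix.cons_val_zero]
        congr 1
        funext a
        exact BT.obs_enc (T a) j _
  | _, _, .con c m T, j + 1, h => by
      simp only [BT.obs, BT.enc, Tm.obs]
      congr 1
      funext i
      refine Fin.cases ?_ (fun i => i.elim0) i
      simp only [Matrix.cons_val_zero, Enc.obs_app]
      congr 1
      funext i
      refine Fin.cases ?_ (fun i => Fin.cases ?_ (fun i => i.elim0) i) i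
      · refine (Enc.obs_app _ _ j _).trans ?_
        simp only [Matrix.cons_val_zero]
        congr 1
        funext i
        exact i.elim0
      · refine (Enc.obs_spine m _ j _).trans ?_
        simp only [Matrix.cons_val_succ, Matrix.cons_val_zero]
        congr 1
        funext a
        exact BT.obs_enc (T a) j _

/-- The encoding `⌜M⌝` of a Böhm tree. -/
def BohmTree.enc {C : Type u} {n : ℕ} (M : BohmTree C n) : OTm (Con5 C) n where
  obs k := (M.obs k).enc
  compat k := by
    rw [Tm.trunc, BT.obs_enc, ← M.compat k]
    rfl

/-- The type `prodc ⌜M⌝`. -/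
def BohmTree.prodc {C : Type u} {n : ℕ} (M : BohmTree C n) :
    (k : ℕ) → Ty (sig5 C).Fam (sig5 C).Con k n :=
  OAtom Fam5.prodc 1 fun _ => M.enc

-- Constants suspend their arguments, so everything is guarded: whether `c · S` checks at depth `k`,
-- and which observation it has there, depends only on its arguments at depths below `k`. The type
-- `prodc ⌜M⌝` moreover determines its inhabitant. Its index has head `lam` or `base`, which forces
-- `p1` or `p2`; further inside, `varntm` or `constntm` forces `p3` or `p4`, and `snil` or `scons`
-- forces the matching nil or cons rule of `prodt` or `prods`. The quantified arguments can be read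
-- off the index. Strong induction on the depth therefore shows that the explicit derivation
-- `BohmTree.proof` checks (`checkAt_proof`) and that every other derivation agrees with it
-- (`proof_unique_obs`); together these give `oCheck_prodc_iff`.
--
-- The one delicate rule is `p1`, which quantifies over a function and so substitutes `λ x. b` for
-- an applied variable. The body `b` checks against `ctm` among variables of the atomic type `vars`,
-- so it applies no variable (`Checks.flat`), and the hereditary reduction is a mere renaming
-- (`OSubst.beta`, `subst_p1`).
--
-- It remains to see that `M.proof` is valid exactly if `M` is productive. Quantified arguments are
-- genuine arguments, so a trace of the derivation may leave it for an encoding. It then meets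
-- `varntm` or `constntm` infinitely often, because spines and abstraction prefixes are finite;
-- these belong to the cotype `ntm`, whose priority is the highest among the constants met there
-- (`EncTrace.good`). A trace that stays in the derivation follows a branch of `M`. Below a variable
-- head it uses only `p1`, `p2`, `p3` and `p6`, none of them coinductive; entering an argument of a
-- constant head costs at least one `p8`, which is coinductive and of the highest priority of all.
-- Hence `p8` recurs exactly if constants recur along the branch. For `valid_of_productive`, a tail
-- without `p8` that never enters an encoding (`Clean`) is turned into a constant-free trace of a
-- subtree; for `productive_of_valid`, a constant-free trace is lifted to a trace of the derivation
-- (`VarProof`). Both constructions use `exists_trace`.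

/-! ## Infinitary terms: constructors, destructors, renaming -/

namespace Tm

variable {K : Type u}

theorem eq_unobs {n : ℕ} (M : Tm K 0 n) : M = unobs := by cases M; rfl

instance {n : ℕ} : Subsingleton (Tm K 0 n) := ⟨fun M N => by rw [M.eq_unobs, N.eq_unobs]⟩

theorem trunc_lam {k n : ℕ} (b : Tm K (k + 2) (n + 1)) : (lam b).trunc = lam b.trunc := by
  simp [trunc, obs]

theorem trunc_var {k n m : ℕ} (x : Fin n) (T : Fin m → Tm K (k + 2) n) :
    (var x m T).trunc = var x m fun i => (T i).trunc := by
  simp [trunc, obs]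

theorem trunc_con {k n m : ℕ} (c : K) (S : Fin m → Tm K (k + 1) n) :
    (con c m S).trunc = con c m fun i => (S i).trunc := by
  simp [trunc, obs]

end Tm

theorem liftRen_id (n : ℕ) : liftRen (id : Fin n → Fin n) = id := by
  funext i
  cases i using Fin.cases <;> simp [liftRen]

theorem liftRen_comp {n m l : ℕ} (g : Fin m → Fin l) (f : Fin n → Fin m) :
    liftRen (g ∘ f) = liftRen g ∘ liftRen f := by
  funext i
  cases i using Fin.cases <;> simp [liftRen]

namespace Tm

variable {K : Type u}

theorem rename_id {k n : ℕ} (M : Tm K k n) : M.rename id = M := by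
  induction M with
  | unobs => simp [rename]
  | lam b ih => simp [rename, liftRen_id, ih]
  | var x m T ih => simp [rename, ih]
  | con c m S ih => simp [rename, ih]

theorem rename_rename {k n m l : ℕ} (M : Tm K k n) (f : Fin n → Fin m) (g : Fin m → Fin l) :
    (M.rename f).rename g = M.rename (g ∘ f) := by
  induction M generalizing m l with
  | unobs => simp [rename]
  | lam b ih => simp [rename, liftRen_comp, ih]
  | var x m T ih => simp [rename, ih]
  | con c m S ih => simp [rename, ih]

theorem obs_rename {k n m : ℕ} (M : Tm K k n) (f : Fin n → Fin m) (j : ℕ) (h : j ≤ k) :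
    (M.rename f).obs j h = (M.obs j h).rename f := by
  induction M generalizing m j with
  | unobs =>
    obtain rfl : j = 0 := by omega
    simp [rename, obs]
  | lam b ih => cases j <;> simp [rename, obs, ih]
  | var x m T ih => cases j <;> simp [rename, obs, ih]
  | con c m S ih => cases j <;> simp [rename, obs, ih]

theorem trunc_rename {k n m : ℕ} (M : Tm K (k + 1) n) (f : Fin n → Fin m) :
    (M.rename f).trunc = M.trunc.rename f := obs_rename M f k _

end Tm

namespace OTm

variable {K : Type u} {n : ℕ}

/-- The infinitary term `c · (S₁; …; Sₘ)`. -/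
def con (c : K) (m : ℕ) (S : Fin m → OTm K n) : OTm K n where
  obs
    | 0 => .unobs
    | k + 1 => .con c m fun i => (S i).obs k
  compat k := by
    cases k with
    | zero => exact Subsingleton.elim _ _
    | succ k => simp [Tm.trunc_con, compat]

/-- The infinitary term `x · (T₁; …; Tₘ)`. -/
def var (x : Fin n) (m : ℕ) (T : Fin m → OTm K n) : OTm K n where
  obs
    | 0 => .unobs
    | k + 1 => .var x m fun i => (T i).obs (k + 1)
  compat k := by
    cases k with
    | zero => exact Subsingleton.elim _ _
    | succ k => simp [Tm.trunc_var, compat]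

/-- The infinitary term `λ x. b`. -/
def lam (b : OTm K (n + 1)) : OTm K n where
  obs
    | 0 => .unobs
    | k + 1 => .lam (b.obs (k + 1))
  compat k := by
    cases k with
    | zero => exact Subsingleton.elim _ _
    | succ k => simp [Tm.trunc_lam, compat]

/-- Renaming of the free variables. -/
def rename {m : ℕ} (f : Fin n → Fin m) (M : OTm K n) : OTm K m where
  obs k := (M.obs k).rename f
  compat k := by rw [Tm.trunc_rename, M.compat]

/-- Weakening by one variable, the new one being index `0`. -/
abbrev weaken (M : OTm K n) : OTm K (n + 1) := M.rename Fin.succ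

@[simp] theorem con_obs_succ (c : K) (m : ℕ) (S : Fin m → OTm K n) (k : ℕ) :
    (con c m S).obs (k + 1) = .con c m fun i => (S i).obs k := rfl

@[simp] theorem var_obs_succ (x : Fin n) (m : ℕ) (T : Fin m → OTm K n) (k : ℕ) :
    (var x m T).obs (k + 1) = .var x m fun i => (T i).obs (k + 1) := rfl

@[simp] theorem lam_obs_succ (b : OTm K (n + 1)) (k : ℕ) :
    (lam b).obs (k + 1) = .lam (b.obs (k + 1)) := rfl

theorem obs_zero (M : OTm K n) : M.obs 0 = .unobs := (M.obs 0).eq_unobs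

theorem ext_succ {M N : OTm K n} (h : ∀ k, M.obs (k + 1) = N.obs (k + 1)) : M = N := by
  ext k
  cases k with
  | zero => exact Subsingleton.elim _ _
  | succ k => exact h k

theorem con_injective {c d : K} {m : ℕ} {S T : Fin m → OTm K n} (h : con c m S = con d m T) :
    c = d ∧ S = T := by
  have h' : ∀ k, c = d ∧ (fun i => (S i).obs k) = fun i => (T i).obs k := fun k => by
    have := congrArg (fun M => M.obs (k + 1)) h
    simpa using this
  refine ⟨(h' 0).1, funext fun i => ?_⟩
  ext k
  exact congrFun (h' k).2 i

theorem lam_injective {b b' : OTm K (n + 1)} (h : lam b = lam b') : b = b' := by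
  refine ext_succ fun k => ?_
  have := congrArg (fun M => M.obs (k + 1)) h
  simpa using this

theorem rename_var {m l : ℕ} (f : Fin n → Fin l) (x : Fin n) (T : Fin m → OTm K n) :
    (var x m T).rename f = var (f x) m fun i => (T i).rename f :=
  ext_succ fun k => by simp [rename, Tm.rename]

theorem rename_lam {l : ℕ} (f : Fin n → Fin l) (b : OTm K (n + 1)) :
    (lam b).rename f = lam (b.rename (liftRen f)) :=
  ext_succ fun k => by simp [rename, Tm.rename]

theorem rename_rename {m l : ℕ} (f : Fin n → Fin m) (g : Fin m → Fin l) (M : OTm K n) :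
    (M.rename f).rename g = M.rename (g ∘ f) := by
  ext k
  exact Tm.rename_rename _ f g

theorem rename_id (M : OTm K n) : M.rename id = M := by
  ext k
  exact Tm.rename_id _

/-- Truncation from a positive depth to a positive depth keeps the outermost shape, so by
compatibility the shape seen at depth `1` persists, and the components found at each depth are again
compatible. -/
theorem eq_lam_of_obs_one (M : OTm K n) (b : Tm K 1 (n + 1)) (h : M.obs 1 = .lam b) :
    ∃ b, M = lam b := by
  have H : ∀ k, ∃ b, M.obs (k + 1) = .lam b := by
    intro k
    induction k with
    | zero => exact ⟨b, h⟩
    | succ k ih =>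
      obtain ⟨b, hb⟩ := ih
      have := M.compat (k + 1)
      rw [hb] at this
      cases e : M.obs (k + 1 + 1) with
      | lam b => exact ⟨b, rfl⟩
      | var x m T => rw [e, Tm.trunc_var] at this; cases this
      | con c m S => rw [e, Tm.trunc_con] at this; cases this
  choose B hB using H
  -- The body is observed at the same depth as the abstraction, so `B k` has depth `k + 1`, and
  -- depth `0` is filled in separately.
  refine ⟨⟨fun k => match k with | 0 => .unobs | k + 1 => B k, fun k => ?_⟩, ext_succ hB⟩
  cases k with
  | zero => exact Subsingleton.elim _ _
  | succ k =>
    have := M.compat (k + 1)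
    rw [hB, hB, Tm.trunc_lam] at this
    exact Tm.lam.inj this

theorem eq_var_of_obs_one (M : OTm K n) (x : Fin n) (m : ℕ) (T : Fin m → Tm K 1 n)
    (h : M.obs 1 = .var x m T) : ∃ T, M = var x m T := by
  have H : ∀ k, ∃ T, M.obs (k + 1) = .var x m T := by
    intro k
    induction k with
    | zero => exact ⟨T, h⟩
    | succ k ih =>
      obtain ⟨T, hT⟩ := ih
      have := M.compat (k + 1)
      rw [hT] at this
      cases e : M.obs (k + 1 + 1) with
      | lam b => rw [e, Tm.trunc_lam] at this; cases this
      | var x' m' T' =>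
        rw [e, Tm.trunc_var] at this
        injection this with _ _ h₃ h₄
        subst h₄ h₃
        exact ⟨T', rfl⟩
      | con c m S => rw [e, Tm.trunc_con] at this; cases this
  choose B hB using H
  refine ⟨fun i => ⟨fun k => match k with | 0 => .unobs | k + 1 => B k i, fun k => ?_⟩,
    ext_succ hB⟩
  cases k with
  | zero => exact Subsingleton.elim _ _
  | succ k =>
    have := M.compat (k + 1)
    rw [hB, hB, Tm.trunc_var] at this
    injection this with _ _ _ _ h₄
    exact congrFun h₄ i

theorem eq_con_of_obs_one (M : OTm K n) (c : K) (m : ℕ) (S : Fin m → Tm K 0 n)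
    (h : M.obs 1 = .con c m S) : ∃ S, M = con c m S := by
  have H : ∀ k, ∃ S, M.obs (k + 1) = .con c m S := by
    intro k
    induction k with
    | zero => exact ⟨S, h⟩
    | succ k ih =>
      obtain ⟨T, hT⟩ := ih
      have := M.compat (k + 1)
      rw [hT] at this
      cases e : M.obs (k + 1 + 1) with
      | lam b => rw [e, Tm.trunc_lam] at this; cases this
      | con x' m' T' =>
        rw [e, Tm.trunc_con] at this
        injection this with _ _ h₃ h₄
        subst h₄ h₃
        exact ⟨T', rfl⟩
      | var x m S => rw [e, Tm.trunc_var] at this; cases this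
  choose B hB using H
  -- Suspended arguments have one observation less, so `B k` already has depth `k` and no shift is
  -- needed.
  refine ⟨fun i => ⟨fun k => B k i, fun k => ?_⟩, ext_succ hB⟩
  have := M.compat (k + 1)
  rw [hB, hB, Tm.trunc_con] at this
  injection this with _ _ _ _ h₄
  exact congrFun h₄ i

theorem exists_eq (M : OTm K n) :
    (∃ b, M = lam b) ∨ (∃ x m T, M = var x m T) ∨ ∃ c m S, M = con c m S := by
  cases e : M.obs 1 with
  | lam b => exact .inl (M.eq_lam_of_obs_one b e)
  | var x m T =>
    exact .inr (.inl ⟨x, m, M.eq_var_of_obs_one x m T e⟩)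
  | con c m S =>
    exact .inr (.inr ⟨c, m, M.eq_con_of_obs_one c m S e⟩)

end OTm

/-! ## Böhm trees: constructors and destructors -/

namespace BT

variable {C : Type u}

theorem eq_unobs {n : ℕ} (M : BT C 0 n) : M = unobs := by cases M; rfl

instance {n : ℕ} : Subsingleton (BT C 0 n) := ⟨fun M N => by rw [M.eq_unobs, N.eq_unobs]⟩

theorem trunc_lam {k n : ℕ} (b : BT C (k + 2) (n + 1)) : (lam b).trunc = lam b.trunc := by
  simp [trunc, obs]

theorem trunc_var {k n m : ℕ} (x : Fin n) (T : Fin m → BT C (k + 1) n) :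
    (var x m T).trunc = var x m fun i => (T i).trunc := by
  simp [trunc, obs]

theorem trunc_con {k n m : ℕ} (c : C) (S : Fin m → BT C (k + 1) n) :
    (con c m S).trunc = con c m fun i => (S i).trunc := by
  simp [trunc, obs]

/-- The number of leading abstractions. -/
def numLam : {k n : ℕ} → BT C k n → ℕ
  | _, _, lam b => b.numLam + 1
  | _, _, _ => 0

end BT

namespace BohmTree

variable {C : Type u} {n : ℕ}

/-- The Böhm tree `λ x. b`. -/
def lam (b : BohmTree C (n + 1)) : BohmTree C n where
  obs
    | 0 => .unobs
    | k + 1 => .lam (b.obs (k + 1))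
  compat k := by
    cases k with
    | zero => exact Subsingleton.elim _ _
    | succ k => simp [BT.trunc_lam, compat]

/-- The Böhm tree `x · (T₁; …; Tₘ)`. -/
def var (x : Fin n) (m : ℕ) (T : Fin m → BohmTree C n) : BohmTree C n where
  obs
    | 0 => .unobs
    | k + 1 => .var x m fun i => (T i).obs k
  compat k := by
    cases k with
    | zero => exact Subsingleton.elim _ _
    | succ k => simp [BT.trunc_var, compat]

/-- The Böhm tree `c · (T₁; …; Tₘ)`. -/
def con (c : C) (m : ℕ) (T : Fin m → BohmTree C n) : BohmTree C n where
  obs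
    | 0 => .unobs
    | k + 1 => .con c m fun i => (T i).obs k
  compat k := by
    cases k with
    | zero => exact Subsingleton.elim _ _
    | succ k => simp [BT.trunc_con, compat]

@[simp] theorem lam_obs_succ (b : BohmTree C (n + 1)) (k : ℕ) :
    (lam b).obs (k + 1) = .lam (b.obs (k + 1)) := rfl

@[simp] theorem var_obs_succ (x : Fin n) (m : ℕ) (T : Fin m → BohmTree C n) (k : ℕ) :
    (var x m T).obs (k + 1) = .var x m fun i => (T i).obs k := rfl

@[simp] theorem con_obs_succ (c : C) (m : ℕ) (T : Fin m → BohmTree C n) (k : ℕ) :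
    (con c m T).obs (k + 1) = .con c m fun i => (T i).obs k := rfl

theorem ext_succ {M N : BohmTree C n} (h : ∀ k, M.obs (k + 1) = N.obs (k + 1)) : M = N := by
  ext k
  cases k with
  | zero => exact Subsingleton.elim _ _
  | succ k => exact h k

theorem eq_lam_of_obs_one (M : BohmTree C n) (b : BT C 1 (n + 1)) (h : M.obs 1 = .lam b) :
    ∃ b, M = lam b := by
  have H : ∀ k, ∃ b, M.obs (k + 1) = .lam b := by
    intro k
    induction k with
    | zero => exact ⟨b, h⟩
    | succ k ih =>
      obtain ⟨b, hb⟩ := ih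
      have := M.compat (k + 1)
      rw [hb] at this
      cases e : M.obs (k + 1 + 1) with
      | lam b => exact ⟨b, rfl⟩
      | var x m T => rw [e, BT.trunc_var] at this; cases this
      | con c m S => rw [e, BT.trunc_con] at this; cases this
  choose B hB using H
  refine ⟨⟨fun k => match k with | 0 => .unobs | k + 1 => B k, fun k => ?_⟩, ext_succ hB⟩
  cases k with
  | zero => exact Subsingleton.elim _ _
  | succ k =>
    have := M.compat (k + 1)
    rw [hB, hB, BT.trunc_lam] at this
    exact BT.lam.inj this

theorem eq_var_of_obs_one (M : BohmTree C n) (x : Fin n) (m : ℕ) (T : Fin m → BT C 0 n)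
    (h : M.obs 1 = .var x m T) : ∃ T, M = var x m T := by
  have H : ∀ k, ∃ T, M.obs (k + 1) = .var x m T := by
    intro k
    induction k with
    | zero => exact ⟨T, h⟩
    | succ k ih =>
      obtain ⟨T, hT⟩ := ih
      have := M.compat (k + 1)
      rw [hT] at this
      cases e : M.obs (k + 1 + 1) with
      | lam b => rw [e, BT.trunc_lam] at this; cases this
      | var x' m' T' =>
        rw [e, BT.trunc_var] at this
        injection this with _ _ h₃ h₄
        subst h₄ h₃
        exact ⟨T', rfl⟩
      | con c m S => rw [e, BT.trunc_con] at this; cases this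
  choose B hB using H
  refine ⟨fun i => ⟨fun k => B k i, fun k => ?_⟩, ext_succ hB⟩
  have := M.compat (k + 1)
  rw [hB, hB, BT.trunc_var] at this
  injection this with _ _ _ _ h₄
  exact congrFun h₄ i

theorem eq_con_of_obs_one (M : BohmTree C n) (c : C) (m : ℕ) (T : Fin m → BT C 0 n)
    (h : M.obs 1 = .con c m T) : ∃ T, M = con c m T := by
  have H : ∀ k, ∃ T, M.obs (k + 1) = .con c m T := by
    intro k
    induction k with
    | zero => exact ⟨T, h⟩
    | succ k ih =>
      obtain ⟨T, hT⟩ := ih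
      have := M.compat (k + 1)
      rw [hT] at this
      cases e : M.obs (k + 1 + 1) with
      | lam b => rw [e, BT.trunc_lam] at this; cases this
      | con x' m' T' =>
        rw [e, BT.trunc_con] at this
        injection this with _ _ h₃ h₄
        subst h₄ h₃
        exact ⟨T', rfl⟩
      | var x m S => rw [e, BT.trunc_var] at this; cases this
  choose B hB using H
  refine ⟨fun i => ⟨fun k => B k i, fun k => ?_⟩, ext_succ hB⟩
  have := M.compat (k + 1)
  rw [hB, hB, BT.trunc_con] at this
  injection this with _ _ _ _ h₄
  exact congrFun h₄ i

theorem exists_eq (M : BohmTree C n) :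
    (∃ b, M = lam b) ∨ (∃ x m T, M = var x m T) ∨ ∃ c m T, M = con c m T := by
  cases e : M.obs 1 with
  | lam b => exact .inl (M.eq_lam_of_obs_one b e)
  | var x m T =>
    exact .inr (.inl ⟨x, m, M.eq_var_of_obs_one x m T e⟩)
  | con c m T =>
    exact .inr (.inr ⟨c, m, M.eq_con_of_obs_one c m T e⟩)

/-- Induction on the number of leading abstractions of a Böhm tree. -/
theorem induction_lam {motive : ∀ {n : ℕ}, BohmTree C n → Prop}
    (lam : ∀ {n : ℕ} (b : BohmTree C (n + 1)), motive b → motive (lam b))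
    (var : ∀ {n : ℕ} (x : Fin n) m (T : Fin m → BohmTree C n), motive (var x m T))
    (con : ∀ {n : ℕ} (c : C) m (T : Fin m → BohmTree C n), motive (con c m T))
    (M : BohmTree C n) : motive M := by
  -- A single observation reveals the whole abstraction prefix, so its length is finite and can be
  -- read at depth `1`.
  induction e : (M.obs 1).numLam generalizing n with
  | zero =>
    rcases M.exists_eq with ⟨b, rfl⟩ | ⟨x, m, T, rfl⟩ | ⟨c, m, T, rfl⟩
    · simp [BT.numLam] at e
    · exact var x m T
    · exact con c m T
  | succ l ih =>
    rcases M.exists_eq with ⟨b, rfl⟩ | ⟨x, m, T, rfl⟩ | ⟨c, m, T, rfl⟩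
    · exact lam b (ih b (by simpa [BT.numLam] using e))
    · exact var x m T
    · exact con c m T

end BohmTree

/-! ## Traces -/

/-- A coinduction principle for traces, on the relations between positions and heads. -/
theorem exists_trace {K : Type u} {P : (List ℕ → Head K → Prop) → Prop} {Q : Head K → Prop}
    (step : ∀ A, P A → ∃ h i A', A [] h ∧ (∀ p g, A' p g → A (i :: p) g) ∧ Q h ∧ P A')
    (A : List ℕ → Head K → Prop) (hA : P A) :
    ∃ t : ℕ → Head K, (∃ π : ℕ → ℕ, ∀ j, A ((List.range j).map π) (t j)) ∧ ∀ j, Q (t j) := by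
  have : Nonempty (Head K) := ⟨(step A hA).choose⟩
  -- The states are relations between positions and heads rather than trees: scopes grow under
  -- binders, so the type of the tree would change along the iteration.
  choose! h i next h₁ h₂ h₃ h₄ using step
  have hP : ∀ j, P (next^[j] A) := fun j => by
    induction j with
    | zero => exact hA
    | succ j ih => rw [Function.iterate_succ_apply']; exact h₄ _ ih
  refine ⟨fun j => h (next^[j] A), ⟨fun j => i (next^[j] A), fun j => ?_⟩, fun j => h₃ _ (hP j)⟩
  clear hP
  induction j generalizing A with
  | zero => exact h₁ A hA
  | succ j ih =>
    rw [List.range_succ_eq_map, List.map_cons, List.map_map]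
    exact h₂ A hA _ _ (ih (next A) (h₄ A hA))

namespace OTm

variable {K : Type u} {n : ℕ}

/-- The heads of `M` by position. -/
def HeadAt (M : OTm K n) (p : List ℕ) (h : Head K) : Prop := ∃ k, (M.obs k).headAt p = some h

theorem headAt_lam (b : OTm K (n + 1)) (p : List ℕ) (h : Head K) :
    (lam b).HeadAt p h ↔ b.HeadAt p h := by
  constructor
  · rintro ⟨_ | k, hk⟩
    · rw [obs_zero, Tm.headAt] at hk; cases hk
    · exact ⟨k + 1, by simpa [Tm.headAt] using hk⟩
  · rintro ⟨_ | k, hk⟩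
    · rw [obs_zero, Tm.headAt] at hk; cases hk
    · exact ⟨k + 1, by simpa [Tm.headAt] using hk⟩

theorem headAt_con_nil (c : K) (m : ℕ) (S : Fin m → OTm K n) (h : Head K) :
    (con c m S).HeadAt [] h ↔ h = .con c := by
  constructor
  · rintro ⟨_ | k, hk⟩
    · rw [obs_zero, Tm.headAt] at hk; cases hk
    · simpa [Tm.headAt, eq_comm] using hk
  · rintro rfl
    exact ⟨1, by simp [Tm.headAt]⟩

theorem headAt_con_cons (c : K) (m : ℕ) (S : Fin m → OTm K n) (i : ℕ) (p : List ℕ) (h : Head K) :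
    (con c m S).HeadAt (i :: p) h ↔ ∃ hi : i < m, (S ⟨i, hi⟩).HeadAt p h := by
  constructor
  · rintro ⟨_ | k, hk⟩
    · rw [obs_zero, Tm.headAt] at hk; cases hk
    · by_cases hi : i < m
      · exact ⟨hi, k, by simpa [Tm.headAt, hi] using hk⟩
      · simp [Tm.headAt, hi] at hk
  · rintro ⟨hi, k, hk⟩
    exact ⟨k + 1, by simpa [Tm.headAt, hi] using hk⟩

theorem isTrace_lam (b : OTm K (n + 1)) (t : ℕ → Head K) : (lam b).IsTrace t ↔ b.IsTrace t :=
  exists_congr fun _ => forall_congr' fun _ => headAt_lam b _ _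

theorem isTrace_con (c : K) (m : ℕ) (S : Fin m → OTm K n) (t : ℕ → Head K) :
    (con c m S).IsTrace t ↔ t 0 = .con c ∧ ∃ i, (S i).IsTrace fun j => t (j + 1) := by
  constructor
  · rintro ⟨π, h⟩
    have h' : ∀ j, ∃ hi : π 0 < m,
        (S ⟨π 0, hi⟩).HeadAt ((List.range j).map fun j => π (j + 1)) (t (j + 1)) := fun j => by
      have := h (j + 1)
      rw [List.range_succ_eq_map, List.map_cons, List.map_map] at this
      exact (headAt_con_cons _ _ _ _ _ _).1 this
    exact ⟨(headAt_con_nil _ _ _ _).1 (h 0), ⟨π 0, (h' 0).1⟩, fun j => π (j + 1),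
      fun j => (h' j).2⟩
  · rintro ⟨h₀, i, π, h⟩
    refine ⟨fun j => Nat.casesOn j i π, fun j => ?_⟩
    cases j with
    | zero => exact (headAt_con_nil _ _ _ _).2 h₀
    | succ j =>
      rw [List.range_succ_eq_map, List.map_cons, List.map_map]
      exact (headAt_con_cons _ _ _ _ _ _).2 ⟨i.2, h j⟩

theorem not_isTrace_var (x : Fin n) (T : Fin 0 → OTm K n) (t : ℕ → Head K) :
    ¬(var x 0 T).IsTrace t := by
  rintro ⟨π, h⟩
  obtain ⟨_ | k, hk⟩ := h 1
  · rw [obs_zero, Tm.headAt] at hk; cases hk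
  · simp [List.range_succ, Tm.headAt] at hk

end OTm

namespace BohmTree

variable {C : Type u} {n : ℕ}

/-- The heads of `M` by position. -/
def HeadAt (M : BohmTree C n) (p : List ℕ) (h : Head C) : Prop :=
  ∃ k, (M.obs k).headAt p = some h

theorem obs_zero (M : BohmTree C n) : M.obs 0 = .unobs := (M.obs 0).eq_unobs

theorem headAt_lam (b : BohmTree C (n + 1)) (p : List ℕ) (h : Head C) :
    (lam b).HeadAt p h ↔ b.HeadAt p h := by
  constructor
  · rintro ⟨_ | k, hk⟩
    · rw [obs_zero, BT.headAt] at hk; cases hk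
    · exact ⟨k + 1, by simpa [BT.headAt] using hk⟩
  · rintro ⟨_ | k, hk⟩
    · rw [obs_zero, BT.headAt] at hk; cases hk
    · exact ⟨k + 1, by simpa [BT.headAt] using hk⟩

theorem headAt_con_nil (c : C) (m : ℕ) (T : Fin m → BohmTree C n) (h : Head C) :
    (con c m T).HeadAt [] h ↔ h = .con c := by
  constructor
  · rintro ⟨_ | k, hk⟩
    · rw [obs_zero, BT.headAt] at hk; cases hk
    · simpa [BT.headAt, eq_comm] using hk
  · rintro rfl
    exact ⟨1, by simp [BT.headAt]⟩

theorem headAt_con_cons (c : C) (m : ℕ) (T : Fin m → BohmTree C n) (i : ℕ) (p : List ℕ)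
    (h : Head C) : (con c m T).HeadAt (i :: p) h ↔ ∃ hi : i < m, (T ⟨i, hi⟩).HeadAt p h := by
  constructor
  · rintro ⟨_ | k, hk⟩
    · rw [obs_zero, BT.headAt] at hk; cases hk
    · by_cases hi : i < m
      · exact ⟨hi, k, by simpa [BT.headAt, hi] using hk⟩
      · simp [BT.headAt, hi] at hk
  · rintro ⟨hi, k, hk⟩
    exact ⟨k + 1, by simpa [BT.headAt, hi] using hk⟩

theorem headAt_var_nil (x : Fin n) (m : ℕ) (T : Fin m → BohmTree C n) (h : Head C) :
    (var x m T).HeadAt [] h ↔ h = .var x := by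
  constructor
  · rintro ⟨_ | k, hk⟩
    · rw [obs_zero, BT.headAt] at hk; cases hk
    · simpa [BT.headAt, eq_comm] using hk
  · rintro rfl
    exact ⟨1, by simp [BT.headAt]⟩

theorem headAt_var_cons (x : Fin n) (m : ℕ) (T : Fin m → BohmTree C n) (i : ℕ) (p : List ℕ)
    (h : Head C) : (var x m T).HeadAt (i :: p) h ↔ ∃ hi : i < m, (T ⟨i, hi⟩).HeadAt p h := by
  constructor
  · rintro ⟨_ | k, hk⟩
    · rw [obs_zero, BT.headAt] at hk; cases hk
    · by_cases hi : i < m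
      · exact ⟨hi, k, by simpa [BT.headAt, hi] using hk⟩
      · simp [BT.headAt, hi] at hk
  · rintro ⟨hi, k, hk⟩
    exact ⟨k + 1, by simpa [BT.headAt, hi] using hk⟩

theorem isTrace_lam (b : BohmTree C (n + 1)) (t : ℕ → Head C) :
    (lam b).IsTrace t ↔ b.IsTrace t :=
  exists_congr fun _ => forall_congr' fun _ => headAt_lam b _ _

/-- Variable and constant nodes of a Böhm tree differ only in the head at the root; abstracting it
yields both trace rules. -/
theorem isTrace_of_headAt {m : ℕ} {M : BohmTree C n} {h₀ : Head C} {T : Fin m → BohmTree C n}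
    (hnil : ∀ h, M.HeadAt [] h ↔ h = h₀)
    (hcons : ∀ i p h, M.HeadAt (i :: p) h ↔ ∃ hi : i < m, (T ⟨i, hi⟩).HeadAt p h)
    (t : ℕ → Head C) :
    M.IsTrace t ↔ t 0 = h₀ ∧ ∃ i, (T i).IsTrace fun j => t (j + 1) := by
  constructor
  · rintro ⟨π, h⟩
    have h' : ∀ j, ∃ hi : π 0 < m,
        (T ⟨π 0, hi⟩).HeadAt ((List.range j).map fun j => π (j + 1)) (t (j + 1)) := fun j => by
      have := h (j + 1)
      rw [List.range_succ_eq_map, List.map_cons, List.map_map] at this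
      exact (hcons _ _ _).1 this
    exact ⟨(hnil _).1 (h 0), ⟨π 0, (h' 0).1⟩, fun j => π (j + 1), fun j => (h' j).2⟩
  · rintro ⟨h₀, i, π, h⟩
    refine ⟨fun j => Nat.casesOn j i π, fun j => ?_⟩
    cases j with
    | zero => exact (hnil _).2 h₀
    | succ j =>
      rw [List.range_succ_eq_map, List.map_cons, List.map_map]
      exact (hcons _ _ _).2 ⟨i.2, h j⟩

theorem isTrace_con (c : C) (m : ℕ) (T : Fin m → BohmTree C n) (t : ℕ → Head C) :
    (con c m T).IsTrace t ↔ t 0 = .con c ∧ ∃ i, (T i).IsTrace fun j => t (j + 1) :=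
  isTrace_of_headAt (headAt_con_nil c m T) (headAt_con_cons c m T) t

theorem isTrace_var (x : Fin n) (m : ℕ) (T : Fin m → BohmTree C n) (t : ℕ → Head C) :
    (var x m T).IsTrace t ↔ t 0 = .var x ∧ ∃ i, (T i).IsTrace fun j => t (j + 1) :=
  isTrace_of_headAt (headAt_var_nil x m T) (headAt_var_cons x m T) t

end BohmTree

/-! ## Hereditary substitution: inversion and determinism -/

section HSubst

variable {K : Type u}

theorem HSubst.lam_inv {τ : STy} {k n : ℕ} {N : Tm K (k + 1) n} {x : Fin (n + 1)}
    {M : Tm K (k + 1) (n + 2)} {R : Tm K (k + 1) n} (h : HSubst τ N x (.lam M) R) :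
    ∃ M', R = .lam M' ∧ HSubst τ N.weaken x.succ M M' := by
  cases h with
  | lam h => exact ⟨_, rfl, h⟩

theorem HSubst.con_inv {τ : STy} {k n m : ℕ} {N : Tm K (k + 1) n} {x : Fin (n + 1)} {c : K}
    {S : Fin m → Tm K k (n + 1)} {R : Tm K (k + 1) n} (h : HSubst τ N x (.con c m S) R) :
    ∃ S', R = .con c m S' ∧ ∀ i, HSubst τ N.trunc x (S i) (S' i) := by
  cases h with
  | con h => exact ⟨_, rfl, h⟩

theorem HSubst.var_inv {τ : STy} {k n m : ℕ} {N : Tm K (k + 1) n} {x z : Fin (n + 1)}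
    {T : Fin m → Tm K (k + 1) (n + 1)} {R : Tm K (k + 1) n} (h : HSubst τ N x (.var z m T) R) :
    ∃ T' : Fin m → Tm K (k + 1) n, (∀ i, HSubst τ N x (T i) (T' i)) ∧
      (z = x ∧ HApp τ T' N R ∨ ∃ y, z = x.succAbove y ∧ R = .var y m T') := by
  cases h with
  | varSame h h' => exact ⟨_, h, .inl ⟨rfl, h'⟩⟩
  | varOther h => exact ⟨_, h, .inr ⟨_, rfl, rfl⟩⟩

theorem HApp.nil_inv {k n m : ℕ} {T : Fin m → Tm K (k + 1) n} {M R : Tm K (k + 1) n}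
    (h : HApp .base T M R) : R = M := by
  cases h with
  | nil _ => rfl

theorem HApp.cons_inv {σ τ : STy} {k n m : ℕ} {T : Fin (m + 1) → Tm K (k + 1) n}
    {M : Tm K (k + 1) (n + 1)} {R : Tm K (k + 1) n} (h : HApp (.arr σ τ) T (.lam M) R) :
    ∃ M', HSubst σ (T 0) 0 M M' ∧ HApp τ (fun i => T i.succ) M' R := by
  cases h with
  | cons h h' => exact ⟨_, h, h'⟩

/-- The rules are syntax-directed. The two rules for variable heads exclude each other since
`x.succAbove y` is never `x`. Substitution and application call each other, hence the joint recursor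
with two motives. -/
theorem HSubst.unique {τ : STy} {k n : ℕ} {N : Tm K k n} {x : Fin (n + 1)} {M : Tm K k (n + 1)}
    {R R' : Tm K k n} (h : HSubst τ N x M R) (h' : HSubst τ N x M R') : R = R' := by
  suffices ∀ R', HSubst τ N x M R' → R = R' from this R' h'
  clear h'
  refine HSubst.rec
    (motive_1 := fun τ {k n} N x M R _ => ∀ R', HSubst τ N x M R' → R = R')
    (motive_2 := fun τ {k n m} T N R _ => ∀ R', HApp τ T N R' → R = R')
    ?_ ?_ ?_ ?_ ?_ ?_ ?_ ?_ h
  · intros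
    exact Subsingleton.elim _ _
  · intro _ _ _ _ _ _ _ _ ih R' h'
    obtain ⟨M', rfl, h₁⟩ := h'.lam_inv
    rw [ih _ h₁]
  · intro _ _ _ _ _ _ _ _ _ _ _ ih ih' R' h'
    obtain ⟨T', hT, ⟨-, h'⟩ | ⟨y, hy, -⟩⟩ := h'.var_inv
    · obtain rfl := funext fun i => ih i _ (hT i)
      exact ih' _ h'
    · exact absurd hy.symm (Fin.succAbove_ne _ _)
  · intro _ _ _ _ _ _ _ _ _ _ ih R' h'
    obtain ⟨T', hT, ⟨h', -⟩ | ⟨y, hy, rfl⟩⟩ := h'.var_inv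
    · exact absurd h' (Fin.succAbove_ne _ _)
    · obtain rfl := funext fun i => ih i _ (hT i)
      rw [Fin.succAbove_right_injective hy]
  · intro _ _ _ _ _ _ _ _ _ _ ih R' h'
    obtain ⟨S', rfl, h₁⟩ := h'.con_inv
    obtain rfl := funext fun i => ih i _ (h₁ i)
    rfl
  · intros
    exact Subsingleton.elim _ _
  · intro _ _ _ _ _ R' h'
    exact h'.nil_inv.symm
  · intro _ _ _ _ _ _ _ _ _ _ _ ih ih' R' h'
    obtain ⟨M', h₁, h₂⟩ := h'.cons_inv
    obtain rfl := ih _ h₁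
    exact ih' _ h₂

/-- The substituted variable does not occur. -/
theorem HSubst.rename {τ : STy} {k l n : ℕ} (M : Tm K k l) {N : Tm K k n} {x : Fin (n + 1)}
    {f : Fin l → Fin (n + 1)} {g : Fin l → Fin n} (h : ∀ i, f i = x.succAbove (g i)) :
    HSubst τ N x (M.rename f) (M.rename g) := by
  induction M generalizing n with
  | unobs =>
    rw [N.eq_unobs]
    simp only [Tm.rename]
    exact .unobs
  | lam b ih =>
    simp only [Tm.rename]
    refine .lam (ih fun i => ?_)
    cases i using Fin.cases <;> simp [liftRen, h]
  | var y m T ih =>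
    simp only [Tm.rename, h]
    exact .varOther fun i => ih i h
  | con c m S ih =>
    simp only [Tm.rename]
    exact .con fun i => ih i h

end HSubst

-- Substitution in terms without applied variables

/-- Terms in which no variable is applied. -/
def Tm.Flat {K : Type u} : {k n : ℕ} → Tm K k n → Prop
  | _, _, .unobs => True
  | _, _, .lam b => b.Flat
  | _, _, .var _ m _ => m = 0
  | _, _, .con _ _ S => ∀ i, (S i).Flat

theorem Tm.Flat.rename {K : Type u} {k n m : ℕ} {M : Tm K k n} (h : M.Flat) (f : Fin n → Fin m) :
    (M.rename f).Flat := by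
  induction M generalizing m with
  | unobs => simp [Tm.rename, Tm.Flat]
  | lam b ih => simpa [Tm.rename, Tm.Flat] using ih h _
  | var x m T ih => simpa [Tm.rename, Tm.Flat] using h
  | con c m S ih => simpa [Tm.rename, Tm.Flat] using fun i => ih i (h i) f

namespace OTm

variable {K : Type u} {n : ℕ}

/-- The variable `x` without arguments. -/
abbrev v (x : Fin n) : OTm K n := var x 0 ![]

theorem rename_v {m : ℕ} (f : Fin n → Fin m) (x : Fin n) : (v x : OTm K n).rename f = v (f x) := by
  rw [v, rename_var]
  congr 1
  exact Subsingleton.elim _ _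

/-- No variable is applied. -/
def Flat (M : OTm K n) : Prop := ∀ k, (M.obs k).Flat

/-- The term is not an abstraction. -/
def IsNeutral (M : OTm K n) : Prop := ∀ k, (M.obs (k + 1)).IsNeutral

theorem isNeutral_var (x : Fin n) (m : ℕ) (T : Fin m → OTm K n) : (var x m T).IsNeutral :=
  fun _ => by simp [Tm.IsNeutral]

theorem isNeutral_con (c : K) (m : ℕ) (S : Fin m → OTm K n) : (con c m S).IsNeutral :=
  fun _ => by simp [Tm.IsNeutral]

end OTm

/-- Substitution of a variable at base type is renaming. -/
theorem HSubst.of_flat {K : Type u} : {k n : ℕ} → (M : Tm K k (n + 1)) → M.Flat →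
    (x : Fin (n + 1)) → (y : Fin n) → (f : Fin (n + 1) → Fin n) → f x = y →
    (∀ z, f (x.succAbove z) = z) → HSubst .base ((OTm.v y : OTm K n).obs k) x M (M.rename f)
  | _, _, .unobs, _, _, _, _, _, _ => by
    rw [OTm.obs_zero]
    simp only [Tm.rename]
    exact .unobs
  | _, _, .lam b, h, x, y, f, hx, hf => by
    simp only [Tm.rename]
    refine .lam ?_
    have := HSubst.of_flat b h x.succ y.succ (liftRen f) (by simp [liftRen, hx])
      (fun z => by cases z using Fin.cases <;> simp [liftRen, hf])
    rwa [← OTm.rename_v] at this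
  | _, _, .var z m T, h, x, y, f, hx, hf => by
    -- Flatness leaves an empty spine, the only one that can be applied at base type in positive
    -- depth.
    obtain rfl : m = 0 := h
    simp only [Tm.rename]
    by_cases e : z = x
    · subst e
      refine .varSame (T' := ![]) (fun i => i.elim0) ?_
      subst hx
      convert HApp.nil (T := ![]) (R := (OTm.v (f z) : OTm K _).obs _) ?_ using 1
      · simp only [OTm.var_obs_succ]
        congr 1
        exact Subsingleton.elim _ _
      · simp [Tm.IsNeutral]
    · obtain ⟨w, rfl⟩ := Fin.exists_succAbove_eq e
      rw [hf]
      exact .varOther fun i => i.elim0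
  | _, _, .con c m S, h, x, y, f, hx, hf => by
    simp only [Tm.rename]
    refine .con fun i => ?_
    have := HSubst.of_flat (S i) (h i) x y f hx hf
    rwa [OTm.compat]

/-! ## Hereditary substitution in infinitary terms -/

/-- `[N/x]^τ X = Y` for infinitary terms. -/
def OSubst {K : Type u} (τ : STy) {n : ℕ} (N : OTm K n) (x : Fin (n + 1)) (X : OTm K (n + 1))
    (Y : OTm K n) : Prop :=
  ∀ k, HSubst τ (N.obs k) x (X.obs k) (Y.obs k)

namespace OSubst

variable {K : Type u} {τ : STy} {n : ℕ} {N : OTm K n} {x : Fin (n + 1)}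

theorem of_succ {X : OTm K (n + 1)} {Y : OTm K n}
    (h : ∀ k, HSubst τ (N.obs (k + 1)) x (X.obs (k + 1)) (Y.obs (k + 1))) : OSubst τ N x X Y
  | 0 => by simpa only [OTm.obs_zero] using .unobs
  | k + 1 => h k

theorem con {m : ℕ} {c : K} {S : Fin m → OTm K (n + 1)} {S' : Fin m → OTm K n}
    (h : ∀ i, OSubst τ N x (S i) (S' i)) : OSubst τ N x (.con c m S) (.con c m S') :=
  of_succ fun k => .con fun i => by rw [OTm.compat]; exact h i k

theorem lam {b : OTm K (n + 2)} {b' : OTm K (n + 1)}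
    (h : OSubst τ N.weaken x.succ b b') : OSubst τ N x (.lam b) (.lam b') :=
  of_succ fun k => .lam (h (k + 1))

/-- At base type the spine of the replaced variable is empty, so application returns the substituted
term and only asks that it be neutral. -/
theorem same (hN : N.IsNeutral) : OSubst .base N x (.v x) N :=
  of_succ fun k => .varSame (T' := ![]) (fun i => i.elim0) (.nil (hN k))

theorem other (y : Fin n) : OSubst τ N x (.v (x.succAbove y)) (.v y) :=
  of_succ fun _ => .varOther fun i => i.elim0

theorem rename {l : ℕ} (M : OTm K l) {f : Fin l → Fin (n + 1)} {g : Fin l → Fin n}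
    (h : ∀ i, f i = x.succAbove (g i)) : OSubst τ N x (M.rename f) (M.rename g) :=
  fun k => .rename (M.obs k) h

/-- The substitution of an abstraction for a variable applied to another variable. -/
theorem beta {b : OTm K (n + 1)} (hb : b.Flat) (hb' : b.IsNeutral) (y : Fin n)
    {R : OTm K n} (hR : R = b.rename (Fin.cases y id)) :
    OSubst (.arr .base .base) (.lam b) x (.var x 1 ![.v (x.succAbove y)]) R := by
  subst hR
  refine of_succ fun k => ?_
  refine .varSame (T' := ![(OTm.v y : OTm K n).obs (k + 1)]) ?_ ?_
  · intro i
    obtain rfl := Subsingleton.elim i 0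
    exact other y (k + 1)
  -- The argument is itself a variable, substituted at base type, so the β-reduct is the renaming
  -- given by `HSubst.of_flat`.
  · refine .cons (M' := ((b.rename (Fin.cases y id)).obs (k + 1))) ?_ (.nil ?_)
    · exact HSubst.of_flat (b.obs (k + 1)) (hb _) 0 y _ rfl (fun z => by simp)
    · have := hb' k
      revert this
      simp only [OTm.rename]
      cases b.obs (k + 1) <;> simp [Tm.rename, Tm.IsNeutral]

end OSubst

/-! ## Infinitary types -/

/-- Infinitary canonical types. -/
inductive OTy (F : Type) (K : Type u) : ℕ → Type u
  | atom {n : ℕ} (a : F) (m : ℕ) (S : Fin m → OTm K n) : OTy F K n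
  | pi {n : ℕ} (B : OTy F K n) (A : OTy F K (n + 1)) : OTy F K n

namespace OTy

variable {F : Type} {K : Type u}

/-- The observation of depth `k`. -/
def obs : {n : ℕ} → OTy F K n → (k : ℕ) → Ty F K k n
  | _, _, 0 => .unobs
  | _, atom a m S, k + 1 => .atom a m fun i => (S i).obs k
  | _, pi B A, k + 1 => .pi (B.obs (k + 1)) (A.obs (k + 1))

/-- Erasure to simple types. -/
def erase : {n : ℕ} → OTy F K n → STy
  | _, atom _ _ _ => .base
  | _, pi B A => .arr B.erase A.erase

/-- Positive depth matters: at depth `0` a product is unobserved and would erase to the base type.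
-/
theorem erase_obs {n : ℕ} (A : OTy F K n) (k : ℕ) : (A.obs (k + 1)).erase = A.erase := by
  induction A with
  | atom a m S => rfl
  | pi B A ihB ihA => simp [obs, Ty.erase, erase, ihB, ihA]

theorem trunc_obs {n : ℕ} (A : OTy F K n) (k : ℕ) : (A.obs (k + 1)).trunc = A.obs k := by
  cases k with
  | zero => simp [obs, Ty.trunc, Ty.obs]
  | succ k =>
    induction A with
    | atom a m S =>
      simp only [obs, Ty.trunc, Ty.obs]
      congr 1
      funext i
      exact (S i).compat k
    | pi B A ihB ihA =>
      simp only [Ty.trunc] at ihB ihA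
      simp [obs, Ty.trunc, Ty.obs, ihB, ihA]

end OTy

/-- `[N/x]^τ A = A'` for infinitary types. -/
inductive OSubstTy {F : Type} {K : Type u} (τ : STy) : {n : ℕ} → OTm K n → Fin (n + 1) →
    OTy F K (n + 1) → OTy F K n → Prop
  | atom {n m : ℕ} {N : OTm K n} {x : Fin (n + 1)} {a : F}
      {S : Fin m → OTm K (n + 1)} {S' : Fin m → OTm K n} :
      (∀ i, OSubst τ N x (S i) (S' i)) → OSubstTy τ N x (.atom a m S) (.atom a m S')
  | pi {n : ℕ} {N : OTm K n} {x : Fin (n + 1)} {B : OTy F K (n + 1)}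
      {A : OTy F K (n + 2)} {B' : OTy F K n} {A' : OTy F K (n + 1)} :
      OSubstTy τ N x B B' → OSubstTy τ N.weaken x.succ A A' → OSubstTy τ N x (.pi B A) (.pi B' A')

section

variable {F : Type} {K : Type u}

/-- The spines of atomic types are suspended, so a term observed at depth `k` is enough for
substitution in a type of depth `k + 1`. -/
theorem OSubstTy.obs {τ : STy} {n : ℕ} {N : OTm K n} {x : Fin (n + 1)} {A : OTy F K (n + 1)}
    {A' : OTy F K n} (h : OSubstTy τ N x A A') (k : ℕ) :
    HSubstTy τ (N.obs k) x (A.obs (k + 1)) (A'.obs (k + 1)) := by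
  induction h with
  | atom h => exact .atom fun i => h i k
  | pi _ _ ih ih' => exact .pi ih ih'

theorem HSubstTy.unique {τ : STy} {k n : ℕ} {N : Tm K k n} {x : Fin (n + 1)}
    {A : Ty F K (k + 1) (n + 1)} {A' A'' : Ty F K (k + 1) n} (h : HSubstTy τ N x A A')
    (h' : HSubstTy τ N x A A'') : A' = A'' := by
  induction h with
  | atom h =>
    cases h' with
    | atom h' =>
      obtain rfl := funext fun i => (h i).unique (h' i)
      rfl
  | pi _ _ ih ih' =>
    cases h' with
    | pi h₁ h₂ => rw [ih h₁, ih' h₂]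

end

/-! ## Type checking of infinitary terms -/

/-- The family of an atomic type at the end of a type, if it is observed. -/
def Ty.target {F : Type} {K : Type u} : {k n : ℕ} → Ty F K k n → Option F
  | _, _, .unobs => none
  | _, _, .atom a _ _ => some a
  | _, _, .pi _ A => A.target

theorem HSubstTy.target_eq {F : Type} {K : Type u} {τ : STy} {k n : ℕ} {N : Tm K k n}
    {x : Fin (n + 1)} {A : Ty F K (k + 1) (n + 1)} {A' : Ty F K (k + 1) n}
    (h : HSubstTy τ N x A A') : A'.target = A.target := by
  induction h with
  | atom h => simp [Ty.target]
  | pi _ _ ih ih' => simpa [Ty.target] using ih'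

theorem Ty.target_rename {F : Type} {K : Type u} {k n m : ℕ} (A : Ty F K k n)
    (f : Fin n → Fin m) : (A.rename f).target = A.target := by
  induction A generalizing m with
  | unobs => simp [Ty.rename, Ty.target]
  | atom a l S => simp [Ty.rename, Ty.target]
  | pi B A _ ih => simpa [Ty.rename, Ty.target] using ih _

theorem FTy.target_expand {F : Type} {K : Type u} {n : ℕ} (A : FTy F K n) (k : ℕ) :
    (A.expand (k + 1)).target = some A.target := by
  induction A with
  | atom a m S => simp [FTy.expand, FTy.target, Ty.target]
  | pi B A _ ih => simpa [FTy.expand, FTy.target, Ty.target] using ih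

section

variable {S : Sig.{u}}

theorem SuspSpine.target_eq {k n m : ℕ} {Γ : Ctx S.Fam S.Con (k + 1) n} {T : Fin m → Tm S.Con k n}
    {A P : Ty S.Fam S.Con (k + 1) n} (h : SuspSpine S Γ T A P) : P.target = A.target := by
  induction m generalizing A with
  | zero =>
    cases h with
    | nil => rfl
  | succ m ih =>
    cases h with
    | cons _ h h' => rw [ih h', h.target_eq, Ty.target]

theorem Check.con_inv {k n m : ℕ} {Γ : Ctx S.Fam S.Con (k + 1) n} {c : S.Con}
    {T : Fin m → Tm S.Con k n} {P : Ty S.Fam S.Con (k + 1) n} (h : Check S Γ (.con c m T) P) :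
    SuspSpine S Γ T (S.typeAt c (k + 1) n) P := by
  cases h with
  | neutral h e =>
    subst e
    cases h with
    | con h => exact h

theorem Check.var_inv {k n m : ℕ} {Γ : Ctx S.Fam S.Con (k + 1) n} {x : Fin n}
    {T : Fin m → Tm S.Con (k + 1) n} {P : Ty S.Fam S.Con (k + 1) n} (h : Check S Γ (.var x m T) P) :
    ContSpine S Γ T (Γ x) P := by
  cases h with
  | neutral h e =>
    subst e
    cases h with
    | var h => exact h

theorem Check.con {k n m : ℕ} {Γ : Ctx S.Fam S.Con (k + 1) n} {c : S.Con}
    {T : Fin m → Tm S.Con k n} {P : Ty S.Fam S.Con (k + 1) n}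
    (h : SuspSpine S Γ T (S.typeAt c (k + 1) n) P) : Check S Γ (.con c m T) P :=
  .neutral (.con h) rfl

/-- Neither substitution nor passing along a spine changes the family at the end of a type. This is
what limits the possible head constants in the inversion lemmas. -/
theorem Check.target_con {k n m : ℕ} {Γ : Ctx S.Fam S.Con (k + 1) n} {c : S.Con}
    {T : Fin m → Tm S.Con k n} {P : Ty S.Fam S.Con (k + 1) n} (h : Check S Γ (.con c m T) P) :
    P.target = some (S.type c).target := by
  rw [h.con_inv.target_eq, Sig.typeAt, Ty.target_rename, FTy.target_expand]

/-- The rule that closes a spine returns an atomic type, so heads are fully applied. This keeps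
neutral terms out of product types, as η-long forms require. -/
theorem ContSpine.not_pi {k n m : ℕ} {Γ : Ctx S.Fam S.Con (k + 1) n}
    {T : Fin m → Tm S.Con (k + 1) n} {A B : Ty S.Fam S.Con (k + 1) n}
    {D : Ty S.Fam S.Con (k + 1) (n + 1)} (h : ContSpine S Γ T A (.pi B D)) : False := by
  induction m generalizing A with
  | zero => cases h
  | succ m ih =>
    cases h with
    | cons _ _ h => exact ih h

theorem SuspSpine.not_pi {k n m : ℕ} {Γ : Ctx S.Fam S.Con (k + 1) n}
    {T : Fin m → Tm S.Con k n} {A B : Ty S.Fam S.Con (k + 1) n}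
    {D : Ty S.Fam S.Con (k + 1) (n + 1)} (h : SuspSpine S Γ T A (.pi B D)) : False := by
  induction m generalizing A with
  | zero => cases h
  | succ m ih =>
    cases h with
    | cons _ _ h => exact ih h

variable {n : ℕ} {Γ : (k : ℕ) → Ctx S.Fam S.Con k n}

/-- A term checked against a product is an abstraction. -/
theorem OCheck.pi_inv {M : OTm S.Con n} {B : OTy S.Fam S.Con n} {A : OTy S.Fam S.Con (n + 1)}
    (h : OCheck S Γ M (OTy.pi B A).obs) : ∃ b : OTm S.Con (n + 1), M = .lam b ∧
      OCheck S (fun k => (Γ k).snoc (B.obs k)) b A.obs := by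
  rcases M.exists_eq with ⟨b, rfl⟩ | ⟨x, m, T, rfl⟩ | ⟨c, m, T, rfl⟩
  · refine ⟨b, rfl, fun k => ?_⟩
    cases k with
    | zero =>
      rw [OTm.obs_zero]
      exact .unobs
    | succ k =>
      have := h (k + 1)
      simp only [OTy.obs, OTm.lam_obs_succ] at this
      cases this with
      | lam h => exact h
      | neutral h => cases h
  · exact (Check.var_inv (h 1)).not_pi.elim
  · exact (Check.con_inv (h 1)).not_pi.elim

theorem OCheck.not_lam {b : OTm S.Con (n + 1)} {a : S.Fam} {m : ℕ} {U : Fin m → OTm S.Con n}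
    (h : OCheck S Γ (.lam b) (OTy.atom a m U).obs) : False := by
  have := h 1
  simp only [OTy.obs, OTm.lam_obs_succ] at this
  cases this with
  | neutral h => cases h

theorem OCheck.isNeutral {M : OTm S.Con n} {a : S.Fam} {m : ℕ} {U : Fin m → OTm S.Con n}
    (h : OCheck S Γ M (OTy.atom a m U).obs) : M.IsNeutral := by
  rcases M.exists_eq with ⟨b, rfl⟩ | ⟨x, m, T, rfl⟩ | ⟨c, m, T, rfl⟩
  · exact h.not_lam.elim
  · exact OTm.isNeutral_var _ _ _
  · exact OTm.isNeutral_con _ _ _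

/-- Suspended spines of infinitary terms. -/
def OSpine (Γ : (k : ℕ) → Ctx S.Fam S.Con k n) {m : ℕ} (T : Fin m → OTm S.Con n)
    (A P : OTy S.Fam S.Con n) : Prop :=
  ∀ k, SuspSpine S (Γ (k + 1)) (fun i => (T i).obs k) (A.obs (k + 1)) (P.obs (k + 1))

/-- The equation between sigma pairs lets one `cases` fix the length and the entries. The rest of
the spine is given for any supplied result `A'` of the substitution: by determinism it is the one
used in the rule, so totality of hereditary substitution is not needed. -/
theorem OSpine.pi_inv (hΓ : ∀ k, (Γ (k + 1)).trunc = Γ k) {m : ℕ} {T : Fin m → OTm S.Con n}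
    {B P : OTy S.Fam S.Con n} {A : OTy S.Fam S.Con (n + 1)} (h : OSpine Γ T (.pi B A) P) :
    ∃ (l : ℕ) (N : OTm S.Con n) (T' : Fin l → OTm S.Con n),
      (⟨m, T⟩ : Σ m, Fin m → OTm S.Con n) = ⟨l + 1, Matrix.vecCons N T'⟩ ∧ OCheck S Γ N B.obs ∧
      ∀ A', OSubstTy B.erase N 0 A A' → OSpine Γ T' A' P := by
  cases m with
  | zero =>
    have := h 0
    simp only [OTy.obs] at this
    cases this
  | succ l =>
    refine ⟨l, T 0, fun i => T i.succ, ?_, fun k => ?_, fun A' hA k => ?_⟩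
    · congr 1
      exact (Matrix.cons_head_tail T).symm
    · have := h k
      simp only [OTy.obs] at this
      cases this with
      | cons h _ _ => rwa [hΓ, OTy.trunc_obs] at h
    · have := h k
      simp only [OTy.obs] at this
      cases this with
      | cons _ h h' =>
        rw [OTy.erase_obs] at h
        rwa [h.unique (hA.obs k)] at h'

theorem OSpine.atom_inv {m l l' : ℕ} {T : Fin m → OTm S.Con n} {a a' : S.Fam}
    {U : Fin l → OTm S.Con n} {U' : Fin l' → OTm S.Con n}
    (h : OSpine Γ T (.atom a l U) (.atom a' l' U')) :
    m = 0 ∧ (⟨l, U⟩ : Σ m, Fin m → OTm S.Con n) = ⟨l', U'⟩ := by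
  cases m with
  | succ m =>
    have := h 0
    simp only [OTy.obs] at this
    cases this
  | zero =>
    have H : ∀ k, l = l' ∧ (fun i => (U i).obs k) ≍ fun i => (U' i).obs k := by
      intro k
      have := h k
      -- The rule for the empty spine repeats its type index; hiding the expected type behind a
      -- variable lets the case analysis unify the two.
      generalize hP : (OTy.atom a' l' U').obs (k + 1) = P at this
      simp only [OTy.obs] at this hP
      cases this with
      | nil =>
        injection hP with _ _ _ h₁ h₂
        exact ⟨h₁.symm, h₂.symm⟩
    obtain rfl := (H 0).1
    refine ⟨rfl, ?_⟩
    congr 1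
    funext i
    ext k
    exact congrFun (eq_of_heq (H k).2) i

theorem SuspSpine.pi_intro (hΓ : ∀ k, (Γ (k + 1)).trunc = Γ k) {k m : ℕ} {N : OTm S.Con n}
    {T : Fin m → OTm S.Con n} {B A' P : OTy S.Fam S.Con n} {A : OTy S.Fam S.Con (n + 1)}
    (hN : Check S (Γ k) (N.obs k) (B.obs k)) (hA : OSubstTy B.erase N 0 A A')
    (h : SuspSpine S (Γ (k + 1)) (fun i => (T i).obs k) (A'.obs (k + 1)) (P.obs (k + 1))) :
    SuspSpine S (Γ (k + 1)) (fun i => (Matrix.vecCons N T i).obs k) ((OTy.pi B A).obs (k + 1))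
      (P.obs (k + 1)) := by
  refine .cons (A' := A'.obs (k + 1)) ?_ ?_ h
  · rw [hΓ, OTy.trunc_obs]
    exact hN
  · rw [OTy.erase_obs]
    exact hA.obs k

theorem SuspSpine.atom_intro {k m : ℕ} {T : Fin 0 → OTm S.Con n} {a : S.Fam}
    {U : Fin m → OTm S.Con n} :
    SuspSpine S (Γ (k + 1)) (fun i => (T i).obs k) ((OTy.atom a m U).obs (k + 1))
      ((OTy.atom a m U).obs (k + 1)) :=
  .nil

theorem Check.lam_obs {k : ℕ} {b : OTm S.Con (n + 1)} {B : OTy S.Fam S.Con n}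
    {A : OTy S.Fam S.Con (n + 1)} (h : Check S ((Γ k).snoc (B.obs k)) (b.obs k) (A.obs k)) :
    Check S (Γ k) ((OTm.lam b).obs k) ((OTy.pi B A).obs k) := by
  cases k with
  | zero =>
    rw [OTm.obs_zero]
    exact .unobs
  | succ k => exact .lam h

end

/-! ## Finitary types as infinitary types -/

theorem FTm.obs_expand {K : Type u} {n : ℕ} (M : FTm K n) (k j : ℕ) (h : j ≤ k) :
    (M.expand k).obs j h = M.expand j := by
  induction M generalizing k j with
  | lam b ih =>
    obtain _ | j := j
    · simp [Tm.obs, FTm.expand]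
    · obtain _ | k := k
      · omega
      · simp [Tm.obs, FTm.expand, ih]
  | var x m S ih =>
    obtain _ | j := j
    · simp [Tm.obs, FTm.expand]
    · obtain _ | k := k
      · omega
      · simp [Tm.obs, FTm.expand, ih]
  | con c m S ih =>
    obtain _ | j := j
    · simp [Tm.obs, FTm.expand]
    · obtain _ | k := k
      · omega
      · simp [Tm.obs, FTm.expand, ih]

/-- A finitary term as an infinitary one, with its variables renamed. -/
def FTm.inst {K : Type u} {n m : ℕ} (f : Fin n → Fin m) (M : FTm K n) : OTm K m :=
  OTm.rename f ⟨M.expand, fun _ => M.obs_expand _ _ _⟩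

/-- A finitary type as an infinitary one, with its variables renamed. -/
def FTy.inst {F : Type} {K : Type u} : {n m : ℕ} → (Fin n → Fin m) → FTy F K n → OTy F K m
  | _, _, f, .atom a l S => .atom a l fun i => (S i).inst f
  | _, _, f, .pi B A => .pi (B.inst f) (A.inst (liftRen f))

section

variable {F : Type} {K : Type u} {n m l : ℕ} (f : Fin n → Fin m)

theorem FTm.inst_lam (b : FTm K (n + 1)) : (FTm.lam b).inst f = .lam (b.inst (liftRen f)) :=
  OTm.ext_succ fun k => by simp [FTm.inst, OTm.rename, FTm.expand, Tm.rename]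

theorem FTm.inst_var (x : Fin n) (S : Fin l → FTm K n) :
    (FTm.var x l S).inst f = .var (f x) l fun i => (S i).inst f :=
  OTm.ext_succ fun k => by simp [FTm.inst, OTm.rename, FTm.expand, Tm.rename]

theorem FTm.inst_con (c : K) (S : Fin l → FTm K n) :
    (FTm.con c l S).inst f = .con c l fun i => (S i).inst f :=
  OTm.ext_succ fun k => by simp [FTm.inst, OTm.rename, FTm.expand, Tm.rename]

theorem FTm.inst_vecCons (M : FTm K n) (S : Fin l → FTm K n) :
    (fun i => (Matrix.vecCons M S i).inst f) =
      Matrix.vecCons (M.inst f) fun i => (S i).inst f := by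
  funext i
  cases i using Fin.cases <;> rfl

theorem FTm.inst_vecEmpty (S : Fin 0 → FTm K n) :
    (fun i => (S i).inst f) = ![] := Subsingleton.elim _ _

/-- The link between the finitary signature, expanded depth by depth, and infinitary types, on which
the types of the constants are then computed. -/
theorem FTy.obs_inst (A : FTy F K n) (k : ℕ) : (A.inst f).obs k = (A.expand k).rename f := by
  induction A generalizing m with
  | atom a l S =>
    cases k with
    | zero => simp [FTy.inst, OTy.obs, FTy.expand, Ty.rename]
    | succ k => simp [FTy.inst, OTy.obs, FTy.expand, Ty.rename, FTm.inst, OTm.rename]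
  | pi B A ihB ihA =>
    cases k with
    | zero => simp [FTy.inst, OTy.obs, FTy.expand, Ty.rename]
    | succ k => simp [FTy.inst, OTy.obs, FTy.expand, Ty.rename, ihB, ihA]

end

/-! ## Typing rules of the signature -/

namespace Sig5

variable {C : Type u} {n : ℕ}

/-- A family without indices, as an infinitary type. -/
abbrev ofam (a : Fam5) : OTy Fam5 (Con5 C) n := .atom a 0 ![]

/-- A family with one index, as an infinitary type. -/
abbrev ofam1 (a : Fam5) (M : OTm (Con5 C) n) : OTy Fam5 (Con5 C) n := .atom a 1 ![M]

/-- The type of a constant, as an infinitary type. -/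
def otype (c : Con5 C) (n : ℕ) : OTy Fam5 (Con5 C) n := (Sig5.type c).inst Fin.elim0

theorem typeAt_eq (c : Con5 C) (k n : ℕ) : (sig5 C).typeAt c k n = (otype c n).obs k :=
  (FTy.obs_inst _ _ _).symm

theorem otype_lam : otype (.lam : Con5 C) n = .pi (.pi (ofam .vars) (ofam .ctm)) (ofam .ctm) := by
  simp only [otype, type, FTy.inst, FTm.inst_vecEmpty]

theorem otype_base : otype (.base : Con5 C) n = .pi (ofam .ntm) (ofam .ctm) := by
  simp only [otype, type, FTy.inst, FTm.inst_vecEmpty]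

theorem otype_varntm : otype (.varntm : Con5 C) n =
    .pi (ofam .vars) (.pi (ofam .spine) (ofam .ntm)) := by
  simp only [otype, type, FTy.inst, FTm.inst_vecEmpty]

theorem otype_constntm : otype (.constntm : Con5 C) n =
    .pi (ofam .consts) (.pi (ofam .spine) (ofam .ntm)) := by
  simp only [otype, type, FTy.inst, FTm.inst_vecEmpty]

theorem otype_snil : otype (.snil : Con5 C) n = ofam .spine := by
  simp only [otype, type, FTy.inst, FTm.inst_vecEmpty]

theorem otype_scons : otype (.scons : Con5 C) n =
    .pi (ofam .ctm) (.pi (ofam .spine) (ofam .spine)) := by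
  simp only [otype, type, FTy.inst, FTm.inst_vecEmpty]

theorem otype_obj (c : C) : otype (.obj c : Con5 C) n = ofam .consts := by
  simp only [otype, type, FTy.inst, FTm.inst_vecEmpty]

/-- Indices are written as iterated successors of `0`, the form in which substitution under binders
meets them. -/
theorem otype_p1 : otype (.p1 : Con5 C) n = .pi (.pi (ofam .vars) (ofam .ctm))
    (.pi (.pi (ofam .vars) (ofam1 .prodc (.var (Fin.succ 0) 1 ![.v 0])))
      (ofam1 .prodc (.con .lam 1 ![.lam (.var (Fin.succ (Fin.succ 0)) 1 ![.v 0])]))) := by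
  simp only [otype, type, FTy.inst, FTm.inst_vecEmpty, FTm.inst_vecCons, FTm.inst_var,
    FTm.inst_con, FTm.inst_lam]
  rfl

theorem otype_p2 : otype (.p2 : Con5 C) n = .pi (ofam .ntm) (.pi (ofam1 .prodn (.v 0))
    (ofam1 .prodc (.con .base 1 ![.v (Fin.succ 0)]))) := by
  simp only [otype, type, FTy.inst, FTm.inst_vecEmpty, FTm.inst_vecCons, FTm.inst_var,
    FTm.inst_con]
  rfl

theorem otype_p3 : otype (.p3 : Con5 C) n = .pi (ofam .spine) (.pi (ofam .vars)
    (.pi (ofam1 .prodt (.v (Fin.succ 0)))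
      (ofam1 .prodn (.con .varntm 2 ![.v (Fin.succ 0), .v (Fin.succ (Fin.succ 0))])))) := by
  simp only [otype, type, FTy.inst, FTm.inst_vecEmpty, FTm.inst_vecCons, FTm.inst_var,
    FTm.inst_con]
  rfl

theorem otype_p4 : otype (.p4 : Con5 C) n = .pi (ofam .spine) (.pi (ofam .consts)
    (.pi (ofam1 .prods (.v (Fin.succ 0)))
      (ofam1 .prodn (.con .constntm 2 ![.v (Fin.succ 0), .v (Fin.succ (Fin.succ 0))])))) := by
  simp only [otype, type, FTy.inst, FTm.inst_vecEmpty, FTm.inst_vecCons, FTm.inst_var,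
    FTm.inst_con]
  rfl

theorem otype_p5 : otype (.p5 : Con5 C) n = ofam1 .prodt (.con .snil 0 ![]) := by
  simp only [otype, type, FTy.inst, FTm.inst_vecEmpty, FTm.inst_vecCons, FTm.inst_con]

theorem otype_p6 : otype (.p6 : Con5 C) n = .pi (ofam .ctm) (.pi (ofam .spine)
    (.pi (ofam1 .prodc (.v (Fin.succ 0))) (.pi (ofam1 .prodt (.v (Fin.succ 0)))
      (ofam1 .prodt (.con .scons 2
        ![.v (Fin.succ (Fin.succ (Fin.succ 0))), .v (Fin.succ (Fin.succ 0))]))))) := by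
  simp only [otype, type, FTy.inst, FTm.inst_vecEmpty, FTm.inst_vecCons, FTm.inst_var,
    FTm.inst_con]
  rfl

theorem otype_p7 : otype (.p7 : Con5 C) n = ofam1 .prods (.con .snil 0 ![]) := by
  simp only [otype, type, FTy.inst, FTm.inst_vecEmpty, FTm.inst_vecCons, FTm.inst_con]

theorem otype_p8 : otype (.p8 : Con5 C) n = .pi (ofam .ctm) (.pi (ofam .spine)
    (.pi (ofam1 .prodc (.v (Fin.succ 0))) (.pi (ofam1 .prods (.v (Fin.succ 0)))
      (ofam1 .prods (.con .scons 2
        ![.v (Fin.succ (Fin.succ (Fin.succ 0))), .v (Fin.succ (Fin.succ 0))]))))) := by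
  simp only [otype, type, FTy.inst, FTm.inst_vecEmpty, FTm.inst_vecCons, FTm.inst_var,
    FTm.inst_con]
  rfl

end Sig5

-- Substitution into constructors of small arity and into weakenings

section

variable {K : Type u} {n : ℕ}

theorem OTm.IsNeutral.rename {M : OTm K n} (h : M.IsNeutral) {m : ℕ} (f : Fin n → Fin m) :
    (M.rename f).IsNeutral := by
  intro k
  have := h k
  revert this
  simp only [OTm.rename]
  cases M.obs (k + 1) <;> simp [Tm.rename, Tm.IsNeutral]

theorem OTm.Flat.rename {M : OTm K n} (h : M.Flat) {m : ℕ} (f : Fin n → Fin m) :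
    (M.rename f).Flat :=
  fun k => (h k).rename f

namespace OSubst

variable {τ : STy} {N : OTm K n} {x : Fin (n + 1)}

theorem con_one {c : K} {X : OTm K (n + 1)} {Y : OTm K n} (h : OSubst τ N x X Y) :
    OSubst τ N x (.con c 1 ![X]) (.con c 1 ![Y]) :=
  con fun i => by
    obtain rfl := Subsingleton.elim i 0
    exact h

theorem con_two {c : K} {X X' : OTm K (n + 1)} {Y Y' : OTm K n} (h : OSubst τ N x X Y)
    (h' : OSubst τ N x X' Y') : OSubst τ N x (.con c 2 ![X, X']) (.con c 2 ![Y, Y']) :=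
  con fun i => by
    refine Fin.cases ?_ (fun i => ?_) i
    · exact h
    · obtain rfl := Subsingleton.elim i 0
      exact h'

theorem var_of_eq {z : Fin (n + 1)} {y : Fin n} (h : z = x.succAbove y) :
    OSubst τ N x (.v z) (.v y) := by
  subst h
  exact other y

theorem weaken (X : OTm K n) : OSubst τ N 0 X.weaken X := by
  have := OSubst.rename (τ := τ) (N := N) (x := 0) X (f := Fin.succ) (g := id) (fun i => rfl)
  rwa [OTm.rename_id] at this

theorem weaken_two {N : OTm K (n + 1)} (X : OTm K n) :
    OSubst τ N (Fin.succ 0) X.weaken.weaken X.weaken := by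
  rw [OTm.weaken, OTm.rename_rename]
  exact OSubst.rename X fun i => by simp

theorem weaken_three {N : OTm K (n + 2)} (X : OTm K n) :
    OSubst τ N (Fin.succ (Fin.succ 0)) X.weaken.weaken.weaken X.weaken.weaken := by
  simp only [OTm.weaken, OTm.rename_rename]
  exact OSubst.rename X fun i => by
    simp only [Function.comp, Fin.succ_succAbove_succ, Fin.zero_succAbove]

end OSubst

theorem OSubstTy.atom_zero {F : Type} {τ : STy} {N : OTm K n} {x : Fin (n + 1)} {a : F} :
    OSubstTy τ N x (.atom a 0 ![]) (.atom a 0 ![]) :=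
  .atom fun i => i.elim0

theorem OSubstTy.atom_one {F : Type} {τ : STy} {N : OTm K n} {x : Fin (n + 1)} {a : F}
    {X : OTm K (n + 1)} {Y : OTm K n} (h : OSubst τ N x X Y) :
    OSubstTy τ N x (.atom a 1 ![X]) (.atom a 1 ![Y]) :=
  .atom fun i => by
    obtain rfl := Subsingleton.elim i 0
    exact h

end

namespace Sig5

variable {C : Type u} {n : ℕ}

/-! ### Instances of the types of the constants -/

/-- Both occurrences of the function variable are applied to a bound variable, so `OSubst.beta`
reduces them. The renaming that inserts the bound variable cancels the weakening of `λ x. b`: the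
premise is about `b` itself, and the conclusion keeps only the weakening over the premise. -/
theorem subst_p1 {b : OTm (Con5 C) (n + 1)} (hb : b.Flat) (hb' : b.IsNeutral) :
    OSubstTy (.arr .base .base) (.lam b) 0
      (.pi (.pi (ofam .vars) (ofam1 .prodc (.var (Fin.succ 0) 1 ![.v 0])))
        (ofam1 .prodc (.con .lam 1 ![.lam (.var (Fin.succ (Fin.succ 0)) 1 ![.v 0])])))
      (.pi (.pi (ofam .vars) (ofam1 .prodc b))
        (ofam1 .prodc (.con .lam 1 ![(OTm.lam b).weaken]))) := by
  refine .pi (.pi .atom_zero (.atom_one ?_)) (.atom_one (.con_one ?_))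
  · rw [OTm.weaken, OTm.rename_lam]
    refine OSubst.beta (hb.rename _) (hb'.rename _) 0 ?_
    rw [OTm.rename_rename]
    refine (OTm.rename_id b).symm.trans (congrArg (fun f => b.rename f) ?_)
    funext i
    cases i using Fin.cases <;> simp [liftRen]
  · rw [OTm.weaken, OTm.rename_lam]
    refine .lam ?_
    rw [OTm.weaken, OTm.rename_lam]
    refine OSubst.beta ((hb.rename _).rename _) ((hb'.rename _).rename _) 0 ?_
    rw [OTm.rename_rename, OTm.rename_rename]
    refine congrArg (fun f => b.rename f) ?_
    funext i
    cases i using Fin.cases <;> simp [liftRen]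

theorem subst_p2 {R : OTm (Con5 C) n} (hR : R.IsNeutral) :
    OSubstTy .base R 0 (.pi (ofam1 .prodn (.v 0)) (ofam1 .prodc (.con .base 1 ![.v (Fin.succ 0)])))
      (.pi (ofam1 .prodn R) (ofam1 .prodc (.con .base 1 ![R.weaken]))) :=
  .pi (.atom_one (.same hR)) (.atom_one (.con_one (.same (hR.rename _))))

variable {a q p : Fam5} {c : Con5 C}

/-- The index does not mention the derivation that is substituted, so the substitution only strips a
weakening, whatever its simple type. -/
theorem subst_index {τ : STy} {N R : OTm (Con5 C) n} :
    OSubstTy τ N 0 (ofam1 a (.con c 1 ![R.weaken])) (ofam1 a (.con c 1 ![R])) :=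
  .atom_one (.con_one (.weaken _))

theorem subst_index_two {τ : STy} {N R R' : OTm (Con5 C) n} :
    OSubstTy τ N 0 (ofam1 a (.con c 2 ![R.weaken, R'.weaken])) (ofam1 a (.con c 2 ![R, R'])) :=
  .atom_one (.con_two (.weaken _) (.weaken _))

theorem subst_spine {S : OTm (Con5 C) n} (hS : S.IsNeutral) :
    OSubstTy .base S 0 (.pi (ofam q) (.pi (ofam1 p (.v (Fin.succ 0)))
        (ofam1 a (.con c 2 ![.v (Fin.succ 0), .v (Fin.succ (Fin.succ 0))]))))
      (.pi (ofam q) (.pi (ofam1 p S.weaken)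
        (ofam1 a (.con c 2 ![.v (Fin.succ 0), S.weaken.weaken])))) :=
  .pi .atom_zero (.pi (.atom_one (.same (hS.rename _)))
    (.atom_one (.con_two (.var_of_eq rfl) (.same ((hS.rename _).rename _)))))

theorem subst_head {V S : OTm (Con5 C) n} (hV : V.IsNeutral) :
    OSubstTy .base V 0 (.pi (ofam1 p S.weaken)
        (ofam1 a (.con c 2 ![.v (Fin.succ 0), S.weaken.weaken])))
      (.pi (ofam1 p S) (ofam1 a (.con c 2 ![V.weaken, S.weaken]))) :=
  .pi (.atom_one (.weaken _)) (.atom_one (.con_two (.same (hV.rename _)) (.weaken_two _)))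

theorem subst_scons_head {M : OTm (Con5 C) n} (hM : M.IsNeutral) :
    OSubstTy .base M 0 (.pi (ofam .spine)
        (.pi (ofam1 .prodc (.v (Fin.succ 0))) (.pi (ofam1 p (.v (Fin.succ 0)))
          (ofam1 p (.con c 2
            ![.v (Fin.succ (Fin.succ (Fin.succ 0))), .v (Fin.succ (Fin.succ 0))])))))
      (.pi (ofam .spine) (.pi (ofam1 .prodc M.weaken) (.pi (ofam1 p (.v (Fin.succ 0)))
          (ofam1 p (.con c 2 ![M.weaken.weaken.weaken, .v (Fin.succ (Fin.succ 0))]))))) :=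
  .pi .atom_zero (.pi (.atom_one (.same (hM.rename _))) (.pi (.atom_one (.var_of_eq rfl))
    (.atom_one (.con_two (.same (((hM.rename _).rename _).rename _)) (.var_of_eq rfl)))))

theorem subst_scons_tail {M S : OTm (Con5 C) n} (hS : S.IsNeutral) :
    OSubstTy .base S 0 (.pi (ofam1 .prodc M.weaken) (.pi (ofam1 p (.v (Fin.succ 0)))
          (ofam1 p (.con c 2 ![M.weaken.weaken.weaken, .v (Fin.succ (Fin.succ 0))]))))
      (.pi (ofam1 .prodc M) (.pi (ofam1 p S.weaken)
          (ofam1 p (.con c 2 ![M.weaken.weaken, S.weaken.weaken])))) :=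
  .pi (.atom_one (.weaken _)) (.pi (.atom_one (.same (hS.rename _)))
    (.atom_one (.con_two (.weaken_three _) (.same ((hS.rename _).rename _)))))

theorem subst_scons_proof {τ : STy} {N M S : OTm (Con5 C) n} :
    OSubstTy τ N 0 (.pi (ofam1 p S.weaken)
          (ofam1 p (.con c 2 ![M.weaken.weaken, S.weaken.weaken])))
      (.pi (ofam1 p S) (ofam1 p (.con c 2 ![M.weaken, S.weaken]))) :=
  .pi (.atom_one (.weaken _)) (.atom_one (.con_two (.weaken_two _) (.weaken_two _)))

/-! ### Checking in contexts of variables -/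

theorem varsCtx_eq (k : ℕ) (x : Fin n) : varsCtx C n k x = (ofam .vars).obs k := by
  cases k with
  | zero => simp [varsCtx, FTy.expand, OTy.obs]
  | succ k =>
    simp only [varsCtx, FTy.expand, OTy.obs]
    congr 1
    exact Subsingleton.elim _ _

theorem varsCtx_trunc (k : ℕ) : (varsCtx C n (k + 1)).trunc = varsCtx C n k := by
  funext x
  rw [Ctx.trunc, varsCtx_eq, varsCtx_eq]
  exact OTy.trunc_obs _ _

/-- Since `vars` has no indices, weakening does not affect it, and contexts of variables stay of the
same form under binders. -/
theorem varsCtx_snoc (k : ℕ) :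
    Ctx.snoc (varsCtx C n k) ((ofam .vars).obs k) = varsCtx C (n + 1) k := by
  have h : ((ofam .vars).obs k : Ty Fam5 (Con5 C) k n).rename Fin.succ = (ofam .vars).obs k := by
    cases k with
    | zero => simp [OTy.obs, Ty.rename]
    | succ k =>
      simp only [OTy.obs, Ty.rename]
      congr 1
      exact Subsingleton.elim _ _
  funext x
  rw [varsCtx_eq]
  cases x using Fin.cases with
  | zero => simpa [Ctx.snoc] using h
  | succ x => simpa [Ctx.snoc, varsCtx_eq] using h

/-- `M` checks against `A` at depth `k`, in a context of variables. -/
abbrev CheckAt (k : ℕ) (M : OTm (Con5 C) n) (A : OTy Fam5 (Con5 C) n) : Prop :=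
  Check (sig5 C) (varsCtx C n k) (M.obs k) (A.obs k)

/-- `M` checks against `A` at every depth, in a context of variables. -/
abbrev Checks (M : OTm (Con5 C) n) (A : OTy Fam5 (Con5 C) n) : Prop :=
  OCheck (sig5 C) (varsCtx C n) M A.obs

theorem checkAt_zero (M : OTm (Con5 C) n) (A : OTy Fam5 (Con5 C) n) : CheckAt 0 M A := by
  rw [CheckAt, OTm.obs_zero]
  exact .unobs

/-- The source of guardedness: arguments matter only at depths below `k`. The form with all `j < k`
absorbs the trivial depth `0` and fits strong induction. -/
theorem checkAt_con {k m : ℕ} {T : Fin m → OTm (Con5 C) n} {A P : OTy Fam5 (Con5 C) n}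
    (hA : otype c n = A)
    (h : ∀ j, j < k → SuspSpine (sig5 C) (varsCtx C n (j + 1)) (fun i => (T i).obs j)
      (A.obs (j + 1)) (P.obs (j + 1))) : CheckAt k (.con c m T) P := by
  cases k with
  | zero => exact checkAt_zero _ _
  | succ k =>
    refine Check.con ?_
    rw [typeAt_eq, hA]
    exact h k k.lt_succ_self

theorem Checks.spine {m : ℕ} {T : Fin m → OTm (Con5 C) n} {A P : OTy Fam5 (Con5 C) n}
    (hA : otype c n = A) (h : Checks (.con c m T) P) : OSpine (varsCtx C n) T A P := by
  intro k
  have := Check.con_inv (h (k + 1))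
  rwa [typeAt_eq, hA] at this

theorem checkAt_lam_vars {k : ℕ} {b : OTm (Con5 C) (n + 1)} {A : OTy Fam5 (Con5 C) (n + 1)}
    (h : CheckAt k b A) : CheckAt k (.lam b) (.pi (ofam .vars) A) := by
  refine Check.lam_obs (S := sig5 C) (Γ := varsCtx C n) ?_
  rw [varsCtx_snoc]
  exact h

theorem Checks.pi_vars_inv {M : OTm (Con5 C) n} {A : OTy Fam5 (Con5 C) (n + 1)}
    (h : Checks M (.pi (ofam .vars) A)) : ∃ b, M = .lam b ∧ Checks b A := by
  obtain ⟨b, rfl, hb⟩ := OCheck.pi_inv h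
  refine ⟨b, rfl, fun k => ?_⟩
  have : Check (sig5 C) (Ctx.snoc (varsCtx C n k) ((ofam .vars).obs k)) (b.obs k) (A.obs k) := hb k
  rwa [varsCtx_snoc] at this

theorem checks_v (x : Fin n) : Checks (.v x : OTm (Con5 C) n) (ofam .vars)
  | 0 => checkAt_zero _ _
  | k + 1 => by
    refine .neutral (.var ?_) rfl
    rw [varsCtx_eq]
    exact .nil

theorem Checks.var_inv {x : Fin n} {m l : ℕ} {T : Fin m → OTm (Con5 C) n}
    {U : Fin l → OTm (Con5 C) n} (h : Checks (.var x m T) (.atom a l U)) : m = 0 ∧ a = .vars := by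
  have := Check.var_inv (h 1)
  rw [varsCtx_eq] at this
  cases m with
  | zero =>
    generalize hP : (OTy.atom a l U).obs (0 + 1) = P at this
    cases this with
    | nil =>
      injection hP with _ _ h
      exact ⟨rfl, h⟩
  | succ m => cases this

/-- Canonical forms at an atomic type: variables have the atomic type `vars` and so take no
arguments, and any other term is headed by a constant of the given family. -/
theorem Checks.cases {M : OTm (Con5 C) n} {l : ℕ} {U : Fin l → OTm (Con5 C) n}
    (h : Checks M (.atom a l U)) :
    (∃ x T, M = .var x 0 T ∧ a = .vars) ∨ ∃ c m T, M = .con c m T ∧ a = (Sig5.type c).target := by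
  rcases M.exists_eq with ⟨b, rfl⟩ | ⟨x, m, T, rfl⟩ | ⟨c, m, T, rfl⟩
  · exact (OCheck.not_lam h).elim
  · obtain ⟨rfl, h'⟩ := h.var_inv
    exact .inl ⟨x, T, rfl, h'⟩
  · refine .inr ⟨c, m, T, rfl, ?_⟩
    have := Check.target_con (h 1)
    simpa [OTy.obs, Ty.target] using this

/-! ### Rules for the terms that encode Böhm trees -/

theorem checkAt_lam {k : ℕ} {M : OTm (Con5 C) n}
    (h : ∀ j < k, CheckAt j M (.pi (ofam .vars) (ofam .ctm))) :
    CheckAt k (.con .lam 1 ![M]) (ofam .ctm) :=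
  checkAt_con otype_lam fun j hj =>
    .pi_intro varsCtx_trunc (h j hj) .atom_zero .atom_intro

theorem checkAt_base {k : ℕ} {R : OTm (Con5 C) n} (h : ∀ j < k, CheckAt j R (ofam .ntm)) :
    CheckAt k (.con .base 1 ![R]) (ofam .ctm) :=
  checkAt_con otype_base fun j hj =>
    .pi_intro varsCtx_trunc (h j hj) .atom_zero .atom_intro

theorem checkAt_varntm {k : ℕ} {V S : OTm (Con5 C) n} (h : ∀ j < k, CheckAt j V (ofam .vars))
    (h' : ∀ j < k, CheckAt j S (ofam .spine)) : CheckAt k (.con .varntm 2 ![V, S]) (ofam .ntm) :=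
  checkAt_con otype_varntm fun j hj =>
    .pi_intro varsCtx_trunc (h j hj) (.pi .atom_zero .atom_zero) <|
      .pi_intro varsCtx_trunc (h' j hj) .atom_zero .atom_intro

theorem checkAt_constntm {k : ℕ} {V S : OTm (Con5 C) n} (h : ∀ j < k, CheckAt j V (ofam .consts))
    (h' : ∀ j < k, CheckAt j S (ofam .spine)) : CheckAt k (.con .constntm 2 ![V, S]) (ofam .ntm) :=
  checkAt_con otype_constntm fun j hj =>
    .pi_intro varsCtx_trunc (h j hj) (.pi .atom_zero .atom_zero) <|
      .pi_intro varsCtx_trunc (h' j hj) .atom_zero .atom_intro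

theorem checkAt_snil (k : ℕ) : CheckAt k (.con .snil 0 ![] : OTm (Con5 C) n) (ofam .spine) :=
  checkAt_con otype_snil fun _ _ => .atom_intro

theorem checkAt_scons {k : ℕ} {M S : OTm (Con5 C) n} (h : ∀ j < k, CheckAt j M (ofam .ctm))
    (h' : ∀ j < k, CheckAt j S (ofam .spine)) : CheckAt k (.con .scons 2 ![M, S]) (ofam .spine) :=
  checkAt_con otype_scons fun j hj =>
    .pi_intro varsCtx_trunc (h j hj) (.pi .atom_zero .atom_zero) <|
      .pi_intro varsCtx_trunc (h' j hj) .atom_zero .atom_intro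

theorem checks_obj (d : C) : Checks (.con (.obj d) 0 ![] : OTm (Con5 C) n) (ofam .consts) :=
  fun _ => checkAt_con (otype_obj d) fun _ _ => .atom_intro

theorem spine_one_flat {m : ℕ} {T : Fin m → OTm (Con5 C) n} {B : OTy Fam5 (Con5 C) n} {k : ℕ}
    (hB : ∀ N : OTm (Con5 C) n, Checks N B → (N.obs k).Flat)
    (h : OSpine (S := sig5 C) (varsCtx C n) T (.pi B (ofam a)) (.atom p 0 ![])) :
    ∀ i, ((T i).obs k).Flat := by
  obtain ⟨l, N, T', e, hN, h'⟩ := h.pi_inv varsCtx_trunc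
  obtain ⟨rfl, -⟩ := (h' _ .atom_zero).atom_inv
  cases e
  exact Fin.cases (hB N hN) fun i => i.elim0

theorem spine_two_flat {m : ℕ} {T : Fin m → OTm (Con5 C) n} {B B' : Fam5} {k : ℕ}
    (hB : ∀ N : OTm (Con5 C) n, Checks N (ofam B) → (N.obs k).Flat)
    (hB' : ∀ N : OTm (Con5 C) n, Checks N (ofam B') → (N.obs k).Flat)
    (h : OSpine (S := sig5 C) (varsCtx C n) T (.pi (ofam B) (.pi (ofam B') (ofam a)))
      (.atom p 0 ![])) :
    ∀ i, ((T i).obs k).Flat := by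
  obtain ⟨l, N, T', e, hN, h'⟩ := h.pi_inv varsCtx_trunc
  cases e
  exact Fin.cases (hB N hN) (spine_one_flat hB' (h' _ (.pi .atom_zero .atom_zero)))

/-- The families of the syntax of Böhm trees. -/
def IsSyntax : Fam5 → Prop
  | .ctm | .spine | .ntm | .vars | .consts => True
  | _ => False

/-- A variable has type `vars` and cannot be applied. Constants of the syntax families take
arguments of syntax families only, apart from the function under `lam`, whose body is again a `ctm`;
each constant lowers the depth. -/
theorem Checks.flat_obs (k : ℕ) {n : ℕ} {M : OTm (Con5 C) n} {a : Fam5} (ha : IsSyntax a)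
    (h : Checks M (ofam a)) : (M.obs k).Flat := by
  induction k generalizing n M a with
  | zero =>
    rw [OTm.obs_zero]
    trivial
  | succ k ih =>
    obtain ⟨x, T, rfl, -⟩ | ⟨c, m, T, rfl, e⟩ := h.cases
    · rfl
    · change ∀ i, ((T i).obs k).Flat
      cases c with
      | lam =>
        refine spine_one_flat (fun N hN => ?_) (h.spine otype_lam)
        obtain ⟨b, rfl, hb⟩ := hN.pi_vars_inv
        have := ih (a := .ctm) trivial hb
        -- At depth `0` the abstraction is unobserved; above, it is flat exactly if its body is.
        cases k with
        | zero => trivial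
        | succ k => exact this
      | base => exact spine_one_flat (fun N hN => ih (a := .ntm) trivial hN) (h.spine otype_base)
      | varntm =>
        exact spine_two_flat (fun N hN => ih (a := .vars) trivial hN)
          (fun N hN => ih (a := .spine) trivial hN) (h.spine otype_varntm)
      | constntm =>
        exact spine_two_flat (fun N hN => ih (a := .consts) trivial hN)
          (fun N hN => ih (a := .spine) trivial hN) (h.spine otype_constntm)
      | scons =>
        exact spine_two_flat (fun N hN => ih (a := .ctm) trivial hN)
          (fun N hN => ih (a := .spine) trivial hN) (h.spine otype_scons)
      | snil =>
        obtain ⟨rfl, -⟩ := (h.spine otype_snil).atom_inv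
        exact fun i => i.elim0
      | obj d =>
        obtain ⟨rfl, -⟩ := (h.spine (otype_obj d)).atom_inv
        exact fun i => i.elim0
      | _ =>
        subst e
        exact False.elim ha

theorem Checks.flat {M : OTm (Con5 C) n} (h : Checks M (ofam .ctm)) : M.Flat :=
  fun k => h.flat_obs k (a := .ctm) trivial

/-! ### Rules for the productivity predicates -/

variable {k : ℕ}

theorem checkAt_p1 {b d : OTm (Con5 C) (n + 1)} (hb : Checks b (ofam .ctm))
    (hd : ∀ j < k, CheckAt j d (ofam1 .prodc b)) :
    CheckAt k (.con .p1 2 ![.lam b, .lam d]) (ofam1 .prodc (.con .lam 1 ![.lam b])) :=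
  checkAt_con otype_p1 fun j hj =>
    .pi_intro varsCtx_trunc (checkAt_lam_vars (hb j)) (subst_p1 hb.flat (OCheck.isNeutral hb)) <|
      .pi_intro varsCtx_trunc (checkAt_lam_vars (hd j hj)) subst_index .atom_intro

theorem checkAt_p2 {R d : OTm (Con5 C) n} (hR : Checks R (ofam .ntm))
    (hd : ∀ j < k, CheckAt j d (ofam1 .prodn R)) :
    CheckAt k (.con .p2 2 ![R, d]) (ofam1 .prodc (.con .base 1 ![R])) :=
  checkAt_con otype_p2 fun j hj =>
    .pi_intro varsCtx_trunc (hR j) (subst_p2 (OCheck.isNeutral hR)) <|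
      .pi_intro varsCtx_trunc (hd j hj) subst_index .atom_intro

theorem checkAt_p3 {S V d : OTm (Con5 C) n} (hS : Checks S (ofam .spine))
    (hV : Checks V (ofam .vars)) (hd : ∀ j < k, CheckAt j d (ofam1 .prodt S)) :
    CheckAt k (.con .p3 3 ![S, V, d]) (ofam1 .prodn (.con .varntm 2 ![V, S])) :=
  checkAt_con otype_p3 fun j hj =>
    .pi_intro varsCtx_trunc (hS j) (subst_spine (OCheck.isNeutral hS)) <|
      .pi_intro varsCtx_trunc (hV j) (subst_head (OCheck.isNeutral hV)) <|
        .pi_intro varsCtx_trunc (hd j hj) subst_index_two .atom_intro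

theorem checkAt_p4 {S V d : OTm (Con5 C) n} (hS : Checks S (ofam .spine))
    (hV : Checks V (ofam .consts)) (hd : ∀ j < k, CheckAt j d (ofam1 .prods S)) :
    CheckAt k (.con .p4 3 ![S, V, d]) (ofam1 .prodn (.con .constntm 2 ![V, S])) :=
  checkAt_con otype_p4 fun j hj =>
    .pi_intro varsCtx_trunc (hS j) (subst_spine (OCheck.isNeutral hS)) <|
      .pi_intro varsCtx_trunc (hV j) (subst_head (OCheck.isNeutral hV)) <|
        .pi_intro varsCtx_trunc (hd j hj) subst_index_two .atom_intro

/-- The type of `p6` and `p8`. -/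
abbrev consTy (p : Fam5) : OTy Fam5 (Con5 C) n :=
  .pi (ofam .ctm) (.pi (ofam .spine)
    (.pi (ofam1 .prodc (.v (Fin.succ 0))) (.pi (ofam1 p (.v (Fin.succ 0)))
      (ofam1 p (.con .scons 2
        ![.v (Fin.succ (Fin.succ (Fin.succ 0))), .v (Fin.succ (Fin.succ 0))])))))

theorem checkAt_cons (hc : otype c n = consTy p) {M S d e : OTm (Con5 C) n}
    (hM : Checks M (ofam .ctm)) (hS : Checks S (ofam .spine))
    (hd : ∀ j < k, CheckAt j d (ofam1 .prodc M)) (he : ∀ j < k, CheckAt j e (ofam1 p S)) :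
    CheckAt k (.con c 4 ![M, S, d, e]) (ofam1 p (.con .scons 2 ![M, S])) :=
  checkAt_con hc fun j hj =>
    .pi_intro varsCtx_trunc (hM j) (subst_scons_head (OCheck.isNeutral hM)) <|
      .pi_intro varsCtx_trunc (hS j) (subst_scons_tail (OCheck.isNeutral hS)) <|
        .pi_intro varsCtx_trunc (hd j hj) subst_scons_proof <|
          .pi_intro varsCtx_trunc (he j hj) subst_index_two .atom_intro

theorem checkAt_nil (hc : otype c n = ofam1 p (.con .snil 0 ![])) :
    CheckAt k (.con c 0 ![]) (ofam1 p (.con .snil 0 ![] : OTm (Con5 C) n)) :=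
  checkAt_con hc fun _ _ => .atom_intro

/-! ### Inversion for the productivity predicates -/

theorem index_eq {m : ℕ} {T : Fin m → OTm (Con5 C) n} {X Y : OTm (Con5 C) n}
    (h : OSpine (S := sig5 C) (varsCtx C n) T (ofam1 a X) (ofam1 p Y)) : m = 0 ∧ Y = X := by
  obtain ⟨rfl, e⟩ := h.atom_inv
  refine ⟨rfl, ?_⟩
  injection e with _ e
  exact (congrFun e 0).symm

/-- The family leaves two possible constants. Inverting the spine makes the synthesized index equal
to the given one, which therefore displays the quantified arguments. -/
theorem Checks.prodc_inv {D X : OTm (Con5 C) n} (h : Checks D (ofam1 .prodc X)) :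
    (∃ b d, D = .con .p1 2 ![.lam b, .lam d] ∧ X = .con .lam 1 ![.lam b] ∧
      Checks d (ofam1 .prodc b)) ∨
    ∃ R d, D = .con .p2 2 ![R, d] ∧ X = .con .base 1 ![R] ∧ Checks d (ofam1 .prodn R) := by
  obtain ⟨x, T, -, h⟩ | ⟨c, m, T, rfl, e⟩ := h.cases
  · cases h
  · cases c <;> try cases e
    · left
      obtain ⟨_, N, T₁, e₁, hN, h₁⟩ := (h.spine otype_p1).pi_inv varsCtx_trunc
      obtain ⟨b, rfl, hb⟩ := Checks.pi_vars_inv hN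
      obtain ⟨_, d, T₂, e₂, hd, h₂⟩ :=
        (h₁ _ (subst_p1 hb.flat (OCheck.isNeutral hb))).pi_inv varsCtx_trunc
      obtain ⟨d, rfl, hd'⟩ := Checks.pi_vars_inv hd
      obtain ⟨rfl, rfl⟩ := index_eq (h₂ _ subst_index)
      -- Each equation fixes the tail occurring in the preceding one, so the innermost goes first.
      cases e₂
      cases e₁
      obtain rfl := Subsingleton.elim T₂ ![]
      exact ⟨b, d, rfl, rfl, hd'⟩
    · right
      obtain ⟨_, R, T₁, e₁, hR, h₁⟩ := (h.spine otype_p2).pi_inv varsCtx_trunc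
      obtain ⟨_, d, T₂, e₂, hd, h₂⟩ :=
        (h₁ _ (subst_p2 (OCheck.isNeutral hR))).pi_inv varsCtx_trunc
      obtain ⟨rfl, rfl⟩ := index_eq (h₂ _ subst_index)
      cases e₂
      cases e₁
      obtain rfl := Subsingleton.elim T₂ ![]
      exact ⟨R, d, rfl, rfl, hd⟩

theorem prodn_spine_inv {m : ℕ} {T : Fin m → OTm (Con5 C) n} {X : OTm (Con5 C) n}
    (h : OSpine (S := sig5 C) (varsCtx C n) T (.pi (ofam .spine) (.pi (ofam q)
      (.pi (ofam1 p (.v (Fin.succ 0)))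
        (ofam1 .prodn (.con c 2 ![.v (Fin.succ 0), .v (Fin.succ (Fin.succ 0))])))))
      (ofam1 .prodn X)) :
    ∃ S V d, (⟨m, T⟩ : Σ m, Fin m → OTm (Con5 C) n) = ⟨3, ![S, V, d]⟩ ∧ X = .con c 2 ![V, S] ∧
      Checks d (ofam1 p S) := by
  obtain ⟨_, S, T₁, e₁, hS, h₁⟩ := h.pi_inv varsCtx_trunc
  obtain ⟨_, V, T₂, e₂, hV, h₂⟩ :=
    (h₁ _ (subst_spine (OCheck.isNeutral hS))).pi_inv varsCtx_trunc
  obtain ⟨_, d, T₃, e₃, hd, h₃⟩ :=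
    (h₂ _ (subst_head (OCheck.isNeutral hV))).pi_inv varsCtx_trunc
  obtain ⟨rfl, rfl⟩ := index_eq (h₃ _ subst_index_two)
  cases e₃
  cases e₂
  cases e₁
  obtain rfl := Subsingleton.elim T₃ ![]
  exact ⟨S, V, d, rfl, rfl, hd⟩

theorem Checks.prodn_inv {D X : OTm (Con5 C) n} (h : Checks D (ofam1 .prodn X)) :
    (∃ S V d, D = .con .p3 3 ![S, V, d] ∧ X = .con .varntm 2 ![V, S] ∧
      Checks d (ofam1 .prodt S)) ∨
    ∃ S V d, D = .con .p4 3 ![S, V, d] ∧ X = .con .constntm 2 ![V, S] ∧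
      Checks d (ofam1 .prods S) := by
  obtain ⟨x, T, -, h⟩ | ⟨c, m, T, rfl, e⟩ := h.cases
  · cases h
  · cases c <;> try cases e
    · left
      obtain ⟨S, V, d, e, rfl, hd⟩ := prodn_spine_inv (h.spine otype_p3)
      cases e
      exact ⟨S, V, d, rfl, rfl, hd⟩
    · right
      obtain ⟨S, V, d, e, rfl, hd⟩ := prodn_spine_inv (h.spine otype_p4)
      cases e
      exact ⟨S, V, d, rfl, rfl, hd⟩

theorem cons_spine_inv {m : ℕ} {T : Fin m → OTm (Con5 C) n} {X : OTm (Con5 C) n}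
    (h : OSpine (S := sig5 C) (varsCtx C n) T (consTy p) (ofam1 p X)) :
    ∃ M S d e, (⟨m, T⟩ : Σ m, Fin m → OTm (Con5 C) n) = ⟨4, ![M, S, d, e]⟩ ∧
      X = .con .scons 2 ![M, S] ∧ Checks d (ofam1 .prodc M) ∧ Checks e (ofam1 p S) := by
  obtain ⟨_, M, T₁, e₁, hM, h₁⟩ := h.pi_inv varsCtx_trunc
  obtain ⟨_, S, T₂, e₂, hS, h₂⟩ :=
    (h₁ _ (subst_scons_head (OCheck.isNeutral hM))).pi_inv varsCtx_trunc
  obtain ⟨_, d, T₃, e₃, hd, h₃⟩ :=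
    (h₂ _ (subst_scons_tail (OCheck.isNeutral hS))).pi_inv varsCtx_trunc
  obtain ⟨_, e, T₄, e₄, he, h₄⟩ := (h₃ _ subst_scons_proof).pi_inv varsCtx_trunc
  obtain ⟨rfl, rfl⟩ := index_eq (h₄ _ subst_index_two)
  cases e₄
  cases e₃
  cases e₂
  cases e₁
  obtain rfl := Subsingleton.elim T₄ ![]
  exact ⟨M, S, d, e, rfl, rfl, hd, he⟩

/-- The constants `p5` and `p7`. -/
def nilCon : Bool → Con5 C
  | false => .p5
  | true => .p7

/-- The constants `p6` and `p8`. -/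
def consCon : Bool → Con5 C
  | false => .p6
  | true => .p8

/-- The families `prodt` and `prods`. -/
def spineFam : Bool → Fam5
  | false => .prodt
  | true => .prods

/-- The predicates for spines below a variable and below a constant have rules of the same form, so
one argument indexed by a Boolean treats both; `true` is the coinductive case. -/
theorem otype_nilCon (β : Bool) :
    otype (nilCon β : Con5 C) n = ofam1 (spineFam β) (.con .snil 0 ![]) := by
  cases β
  · exact otype_p5
  · exact otype_p7

theorem otype_consCon (β : Bool) : otype (consCon β : Con5 C) n = consTy (spineFam β) := by
  cases β
  · exact otype_p6
  · exact otype_p8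

theorem Checks.spineFam_inv (β : Bool) {D X : OTm (Con5 C) n}
    (h : Checks D (ofam1 (spineFam β) X)) :
    (D = .con (nilCon β) 0 ![] ∧ X = .con .snil 0 ![]) ∨
    ∃ M S d e, D = .con (consCon β) 4 ![M, S, d, e] ∧ X = .con .scons 2 ![M, S] ∧
      Checks d (ofam1 .prodc M) ∧ Checks e (ofam1 (spineFam β) S) := by
  -- Only the choice of the head constant depends on the value of `β`; after it the two cases are
  -- uniform.
  have key : (∃ (m : ℕ) (T : Fin m → OTm (Con5 C) n), D = .con (nilCon β) m T) ∨
      ∃ (m : ℕ) (T : Fin m → OTm (Con5 C) n), D = .con (consCon β) m T := by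
    obtain ⟨x, T, -, h⟩ | ⟨c, m, T, rfl, e⟩ := h.cases
    · cases β <;> cases h
    · cases β <;> cases c <;> (try cases e)
      · exact .inl ⟨m, T, rfl⟩
      · exact .inr ⟨m, T, rfl⟩
      · exact .inl ⟨m, T, rfl⟩
      · exact .inr ⟨m, T, rfl⟩
  obtain ⟨m, T, rfl⟩ | ⟨m, T, rfl⟩ := key
  · left
    obtain ⟨rfl, rfl⟩ := index_eq (h.spine (otype_nilCon β))
    obtain rfl := Subsingleton.elim T ![]
    exact ⟨rfl, rfl⟩
  · right
    obtain ⟨M, S, d, e, e', rfl, hd, he⟩ := cons_spine_inv (h.spine (otype_consCon β))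
    cases e'
    exact ⟨M, S, d, e, rfl, rfl, hd, he⟩

end Sig5

/-! ## The derivation of productivity -/

namespace Enc

variable {C : Type u} {k n : ℕ}

/-- The proof of `prodt s` or `prods s` for the spine `s` of the terms `E`, from the proofs `D`. -/
def spineProof (β : Bool) : (m : ℕ) → (E D : Fin m → Tm (Con5 C) k n) → Tm (Con5 C) k n
  | 0, _, _ => app (Sig5.nilCon β) ![]
  | m + 1, E, D => app (Sig5.consCon β)
      ![E 0, spine m fun i => E i.succ, D 0, spineProof β m (fun i => E i.succ) fun i => D i.succ]

theorem app_congr {m : ℕ} (c : Con5 C) {S T : Fin m → Tm (Con5 C) k n} (h : ∀ i, S i = T i) :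
    app c S = app c T := by rw [funext h]

theorem obs_obj (c : C) (j : ℕ) (h : j ≤ k) :
    (app (.obj c) ![] : Tm (Con5 C) k n).obs j h = app (.obj c) ![] :=
  (obs_app _ _ _ _).trans (app_congr _ fun i => i.elim0)

theorem obs_spineProof (β : Bool) (m : ℕ) (E D : Fin m → Tm (Con5 C) k n) (j : ℕ) (h : j ≤ k) :
    (spineProof β m E D).obs j h =
      spineProof β m (fun i => (E i).obs j h) fun i => (D i).obs j h := by
  induction m with
  | zero =>
    simp only [spineProof, obs_app]
    exact app_congr _ fun i => i.elim0
  | succ m ih =>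
    simp only [spineProof, obs_app]
    refine app_congr _ (Fin.cases rfl (Fin.cases ?_ (Fin.cases rfl (Fin.cases ?_ fun i => i.elim0))))
    · exact obs_spine m _ j h
    · exact ih _ _

end Enc

/-- The derivation of productivity of `M`, on observations of depth `k`. -/
def BT.proof {C : Type u} : {k n : ℕ} → BT C k n → Tm (Con5 C) k n
  | _, _, .unobs => .unobs
  | _, _, .lam b => Enc.app .p1 ![Enc.abs b.enc, Enc.abs b.proof]
  | _, _, .var x m T =>
      .con .p2 2 ![Enc.app .varntm ![Enc.var x, Enc.spine m fun i => (T i).enc],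
        Enc.app .p3 ![Enc.spine m fun i => (T i).enc, Enc.var x,
          Enc.spineProof false m (fun i => (T i).enc) fun i => (T i).proof]]
  | _, _, .con c m T =>
      .con .p2 2 ![Enc.app .constntm ![Enc.app (.obj c) ![], Enc.spine m fun i => (T i).enc],
        Enc.app .p4 ![Enc.spine m fun i => (T i).enc, Enc.app (.obj c) ![],
          Enc.spineProof true m (fun i => (T i).enc) fun i => (T i).proof]]

theorem BT.obs_proof {C : Type u} {k n : ℕ} (M : BT C k n) (j : ℕ) (h : j ≤ k) :
    M.proof.obs j h = (M.obs j h).proof := by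
  induction M generalizing j with
  | unobs =>
    obtain rfl : j = 0 := by omega
    simp [BT.obs, Tm.obs, BT.proof]
  | lam b ih =>
    obtain _ | j := j
    · simp [BT.obs, Tm.obs, BT.proof]
    · simp only [BT.obs, BT.proof, Enc.obs_app]
      refine Enc.app_congr _ (Fin.cases ?_ (Fin.cases ?_ fun i => i.elim0))
      · exact (Enc.obs_abs _ _ _).trans (congrArg Enc.abs (BT.obs_enc _ _ _))
      · exact (Enc.obs_abs _ _ _).trans (congrArg Enc.abs (ih _ _))
  | var x m T ih =>
    obtain _ | j := j
    · simp [BT.obs, Tm.obs, BT.proof]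
    · simp only [BT.obs, BT.proof, Tm.obs]
      congr 1
      refine funext (Fin.cases ?_ (Fin.cases ?_ fun i => i.elim0))
      · refine (Enc.obs_app _ _ _ _).trans (Enc.app_congr _ (Fin.cases ?_ (Fin.cases ?_
          fun i => i.elim0)))
        · exact Enc.obs_var x j _
        · exact (Enc.obs_spine m _ j _).trans (by simp only [BT.obs_enc]; rfl)
      · refine (Enc.obs_app _ _ _ _).trans (Enc.app_congr _ (Fin.cases ?_ (Fin.cases ?_
          (Fin.cases ?_ fun i => i.elim0))))
        · exact (Enc.obs_spine m _ j _).trans (by simp only [BT.obs_enc]; rfl)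
        · exact Enc.obs_var x j _
        · exact (Enc.obs_spineProof _ m _ _ j _).trans (by simp only [BT.obs_enc, ih]; rfl)
  | con c m T ih =>
    obtain _ | j := j
    · simp [BT.obs, Tm.obs, BT.proof]
    · simp only [BT.obs, BT.proof, Tm.obs]
      congr 1
      refine funext (Fin.cases ?_ (Fin.cases ?_ fun i => i.elim0))
      · refine (Enc.obs_app _ _ _ _).trans (Enc.app_congr _ (Fin.cases ?_ (Fin.cases ?_
          fun i => i.elim0)))
        · exact Enc.obs_obj c j _
        · exact (Enc.obs_spine m _ j _).trans (by simp only [BT.obs_enc]; rfl)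
      · refine (Enc.obs_app _ _ _ _).trans (Enc.app_congr _ (Fin.cases ?_ (Fin.cases ?_
          (Fin.cases ?_ fun i => i.elim0))))
        · exact (Enc.obs_spine m _ j _).trans (by simp only [BT.obs_enc]; rfl)
        · exact Enc.obs_obj c j _
        · exact (Enc.obs_spineProof _ m _ _ j _).trans (by simp only [BT.obs_enc, ih]; rfl)

/-- The derivation of productivity of `M`. -/
def BohmTree.proof {C : Type u} {n : ℕ} (M : BohmTree C n) : OTm (Con5 C) n where
  obs k := (M.obs k).proof
  compat k := by
    rw [Tm.trunc, BT.obs_proof, ← M.compat k]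
    rfl

-- Encodings and derivations through infinitary constructors

namespace Sig5

variable {C : Type u} {n : ℕ}

/-- The spine `scons M₁ (… (scons Mₘ snil))`. -/
def ospine : (m : ℕ) → (Fin m → OTm (Con5 C) n) → OTm (Con5 C) n
  | 0, _ => .con .snil 0 ![]
  | m + 1, T => .con .scons 2 ![T 0, ospine m fun i => T i.succ]

/-- The proof of `prodt s` or `prods s` for the spine `s` of the terms `E`, from the proofs `D`. -/
def ospineProof (β : Bool) : (m : ℕ) → (E D : Fin m → OTm (Con5 C) n) → OTm (Con5 C) n
  | 0, _, _ => .con (nilCon β) 0 ![]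
  | m + 1, E, D => .con (consCon β) 4 ![E 0, ospine m fun i => E i.succ, D 0,
      ospineProof β m (fun i => E i.succ) fun i => D i.succ]

/-- The depthwise constructor truncates where the infinitary one shifts the depth; compatibility
identifies the two. -/
theorem con_obs {m : ℕ} (c : Con5 C) (S : Fin m → OTm (Con5 C) n) {k : ℕ}
    {S' : Fin m → Tm (Con5 C) k n} (h : ∀ i, (S i).obs k = S' i) :
    (OTm.con c m S).obs k = Enc.app c S' := by
  obtain rfl := funext h
  exact ((OTm.con c m S).compat k).symm

theorem lam_obs (b : OTm (Con5 C) (n + 1)) (k : ℕ) : (OTm.lam b).obs k = Enc.abs (b.obs k) := by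
  cases k <;> rfl

theorem v_obs (x : Fin n) (k : ℕ) : (OTm.v x : OTm (Con5 C) n).obs k = Enc.var x := by
  cases k with
  | zero => rfl
  | succ k =>
    simp only [OTm.var_obs_succ, Enc.var]
    congr 1
    exact Subsingleton.elim _ _

theorem ospine_obs (m : ℕ) (T : Fin m → OTm (Con5 C) n) (k : ℕ) :
    (ospine m T).obs k = Enc.spine m fun i => (T i).obs k := by
  induction m with
  | zero => exact con_obs _ _ fun i => i.elim0
  | succ m ih => exact con_obs _ _ (Fin.cases rfl (Fin.cases (ih _) fun i => i.elim0))

theorem ospineProof_obs (β : Bool) (m : ℕ) (E D : Fin m → OTm (Con5 C) n) (k : ℕ) :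
    (ospineProof β m E D).obs k =
      Enc.spineProof β m (fun i => (E i).obs k) fun i => (D i).obs k := by
  induction m with
  | zero => exact con_obs _ _ fun i => i.elim0
  | succ m ih =>
    exact con_obs _ _ (Fin.cases rfl (Fin.cases (ospine_obs _ _ _)
      (Fin.cases rfl (Fin.cases (ih _ _) fun i => i.elim0))))

theorem obj_obs (c : C) (k : ℕ) :
    (OTm.con (.obj c) 0 ![] : OTm (Con5 C) n).obs k = Enc.app (.obj c) ![] :=
  con_obs _ _ fun i => i.elim0

theorem enc_lam (b : BohmTree C (n + 1)) : b.lam.enc = .con .lam 1 ![.lam b.enc] := by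
  refine OTm.ext_succ fun k => ?_
  exact (con_obs _ _ (Fin.cases (lam_obs _ _) fun i => i.elim0)).symm

theorem enc_var (x : Fin n) (m : ℕ) (T : Fin m → BohmTree C n) :
    (BohmTree.var x m T).enc =
      .con .base 1 ![.con .varntm 2 ![.v x, ospine m fun i => (T i).enc]] := by
  refine OTm.ext_succ fun k => congrArg (Tm.con _ 1) ?_
  refine funext (Fin.cases (Eq.symm ?_) fun i => i.elim0)
  exact con_obs _ _ (Fin.cases (v_obs x k) (Fin.cases (ospine_obs _ _ _) fun i => i.elim0))

theorem enc_con (c : C) (m : ℕ) (T : Fin m → BohmTree C n) :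
    (BohmTree.con c m T).enc =
      .con .base 1 ![.con .constntm 2 ![.con (.obj c) 0 ![], ospine m fun i => (T i).enc]] := by
  refine OTm.ext_succ fun k => congrArg (Tm.con _ 1) ?_
  refine funext (Fin.cases (Eq.symm ?_) fun i => i.elim0)
  exact con_obs _ _ (Fin.cases (obj_obs c k) (Fin.cases (ospine_obs _ _ _) fun i => i.elim0))

theorem proof_lam (b : BohmTree C (n + 1)) :
    b.lam.proof = .con .p1 2 ![.lam b.enc, .lam b.proof] := by
  refine OTm.ext_succ fun k => ?_
  exact (con_obs _ _ (Fin.cases (lam_obs _ _) (Fin.cases (lam_obs _ _) fun i => i.elim0))).symm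

theorem proof_var (x : Fin n) (m : ℕ) (T : Fin m → BohmTree C n) :
    (BohmTree.var x m T).proof =
      .con .p2 2 ![.con .varntm 2 ![.v x, ospine m fun i => (T i).enc],
        .con .p3 3 ![ospine m fun i => (T i).enc, .v x,
          ospineProof false m (fun i => (T i).enc) fun i => (T i).proof]] := by
  refine OTm.ext_succ fun k => congrArg (Tm.con _ 2) ?_
  refine funext (Fin.cases (Eq.symm ?_) (Fin.cases (Eq.symm ?_) fun i => i.elim0))
  · exact con_obs _ _ (Fin.cases (v_obs x k) (Fin.cases (ospine_obs _ _ _) fun i => i.elim0))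
  · exact con_obs _ _ (Fin.cases (ospine_obs _ _ _) (Fin.cases (v_obs x k)
      (Fin.cases (ospineProof_obs _ _ _ _ _) fun i => i.elim0)))

theorem proof_con (c : C) (m : ℕ) (T : Fin m → BohmTree C n) :
    (BohmTree.con c m T).proof =
      .con .p2 2 ![.con .constntm 2 ![.con (.obj c) 0 ![], ospine m fun i => (T i).enc],
        .con .p4 3 ![ospine m fun i => (T i).enc, .con (.obj c) 0 ![],
          ospineProof true m (fun i => (T i).enc) fun i => (T i).proof]] := by
  refine OTm.ext_succ fun k => congrArg (Tm.con _ 2) ?_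
  refine funext (Fin.cases (Eq.symm ?_) (Fin.cases (Eq.symm ?_) fun i => i.elim0))
  · exact con_obs _ _ (Fin.cases (obj_obs c k) (Fin.cases (ospine_obs _ _ _) fun i => i.elim0))
  · exact con_obs _ _ (Fin.cases (ospine_obs _ _ _) (Fin.cases (obj_obs c k)
      (Fin.cases (ospineProof_obs _ _ _ _ _) fun i => i.elim0)))

/-! ### Existence -/

theorem checkAt_ospine {k m : ℕ} {T : Fin m → OTm (Con5 C) n}
    (h : ∀ j < k, ∀ i, CheckAt j (T i) (ofam .ctm)) : CheckAt k (ospine m T) (ofam .spine) := by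
  induction m generalizing k with
  | zero => exact checkAt_snil k
  | succ m ih =>
    exact checkAt_scons (fun j hj => h j hj 0)
      fun j hj => ih fun i hi l => h i (hi.trans hj) l.succ

/-- Strong induction on the depth covers abstractions too: the constant `lam` suspends its argument,
although the Böhm tree loses no observation there. -/
theorem checkAt_enc (k : ℕ) {n : ℕ} (M : BohmTree C n) : CheckAt k M.enc (ofam .ctm) := by
  induction k using Nat.strong_induction_on generalizing n with
  | _ k ih =>
  rcases M.exists_eq with ⟨b, rfl⟩ | ⟨x, m, T, rfl⟩ | ⟨c, m, T, rfl⟩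
  · rw [enc_lam]
    exact checkAt_lam fun j hj => checkAt_lam_vars (ih j hj b)
  · rw [enc_var]
    exact checkAt_base fun j hj => checkAt_varntm (fun i _ => checks_v x i)
      fun i hi => checkAt_ospine fun l hl a => ih l (hl.trans (hi.trans hj)) _
  · rw [enc_con]
    exact checkAt_base fun j hj => checkAt_constntm (fun i _ => checks_obj c i)
      fun i hi => checkAt_ospine fun l hl a => ih l (hl.trans (hi.trans hj)) _

theorem checks_enc (M : BohmTree C n) : Checks M.enc (ofam .ctm) := fun k => checkAt_enc k M

theorem checks_ospine {m : ℕ} {T : Fin m → OTm (Con5 C) n}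
    (h : ∀ i, Checks (T i) (ofam .ctm)) : Checks (ospine m T) (ofam .spine) :=
  fun _ => checkAt_ospine fun j _ i => h i j

theorem checkAt_ospineProof (β : Bool) {k m : ℕ} {E D : Fin m → OTm (Con5 C) n}
    (hE : ∀ i, Checks (E i) (ofam .ctm))
    (hD : ∀ j < k, ∀ i, CheckAt j (D i) (ofam1 .prodc (E i))) :
    CheckAt k (ospineProof β m E D) (ofam1 (spineFam β) (ospine m E)) := by
  induction m generalizing k with
  | zero => exact checkAt_nil (otype_nilCon β)
  | succ m ih =>
    exact checkAt_cons (otype_consCon β) (hE 0) (checks_ospine fun i => hE i.succ)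
      (fun j hj => hD j hj 0)
      fun j hj => ih (fun i => hE i.succ) fun i hi l => hD i (hi.trans hj) l.succ

theorem checkAt_proof (k : ℕ) {n : ℕ} (M : BohmTree C n) :
    CheckAt k M.proof (ofam1 .prodc M.enc) := by
  induction k using Nat.strong_induction_on generalizing n with
  | _ k ih =>
  rcases M.exists_eq with ⟨b, rfl⟩ | ⟨x, m, T, rfl⟩ | ⟨c, m, T, rfl⟩
  · rw [enc_lam, proof_lam]
    exact checkAt_p1 (checks_enc b) fun j hj => ih j hj b
  · have hS : Checks (ospine m fun i => (T i).enc) (ofam .spine) :=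
      checks_ospine fun i => checks_enc _
    rw [enc_var, proof_var]
    exact checkAt_p2 (fun j => checkAt_varntm (fun i _ => checks_v x i) fun i _ => hS i)
      fun j hj => checkAt_p3 hS (checks_v x) fun i hi =>
        checkAt_ospineProof false (fun _ => checks_enc _)
          fun l hl a => ih l (hl.trans (hi.trans hj)) _
  · have hS : Checks (ospine m fun i => (T i).enc) (ofam .spine) :=
      checks_ospine fun i => checks_enc _
    rw [enc_con, proof_con]
    exact checkAt_p2 (fun j => checkAt_constntm (fun i _ => checks_obj c i) fun i _ => hS i)
      fun j hj => checkAt_p4 hS (checks_obj c) fun i hi =>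
        checkAt_ospineProof true (fun _ => checks_enc _)
          fun l hl a => ih l (hl.trans (hi.trans hj)) _

/-! ### Uniqueness -/

/-- The counterpart of `checkAt_con` for equality: agreement of the arguments below depth `k`
suffices. -/
theorem con_obs_congr {m : ℕ} (c : Con5 C) {S T : Fin m → OTm (Con5 C) n} {k : ℕ}
    (h : ∀ j < k, ∀ i, (S i).obs j = (T i).obs j) :
    (OTm.con c m S).obs k = (OTm.con c m T).obs k := by
  cases k with
  | zero => rfl
  | succ k => exact congrArg (Tm.con c m) (funext (h k k.lt_succ_self))

theorem con_ne {c d : Con5 C} {m l : ℕ} {S : Fin m → OTm (Con5 C) n} {T : Fin l → OTm (Con5 C) n}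
    (hcd : c ≠ d) : OTm.con c m S ≠ OTm.con d l T := by
  intro h
  have := congrArg (fun M => M.obs 1) h
  simp only [OTm.con_obs_succ] at this
  injection this with _ _ h
  exact hcd h

theorem con_one_inj {c : Con5 C} {M N : OTm (Con5 C) n}
    (h : OTm.con c 1 ![M] = OTm.con c 1 ![N]) : M = N :=
  congrFun (OTm.con_injective h).2 0

theorem con_two_inj {c : Con5 C} {M N M' N' : OTm (Con5 C) n}
    (h : OTm.con c 2 ![M, M'] = OTm.con c 2 ![N, N']) : M = N ∧ M' = N' :=
  ⟨congrFun (OTm.con_injective h).2 0, congrFun (OTm.con_injective h).2 1⟩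

theorem ospineProof_unique (β : Bool) {k m : ℕ} {E D : Fin m → OTm (Con5 C) n} {d : OTm (Con5 C) n}
    (hD : ∀ j < k, ∀ i e, Checks e (ofam1 .prodc (E i)) → e.obs j = (D i).obs j)
    (h : Checks d (ofam1 (spineFam β) (ospine m E))) :
    d.obs k = (ospineProof β m E D).obs k := by
  induction m generalizing k d with
  | zero =>
    obtain ⟨rfl, -⟩ | ⟨M, S, d, e, rfl, hX, -⟩ := h.spineFam_inv
    · rfl
    · exact absurd hX (con_ne (by simp))
  | succ m ih =>
    obtain ⟨rfl, hX⟩ | ⟨M, S, d, e, rfl, hX, hd, he⟩ := h.spineFam_inv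
    · exact absurd hX (con_ne (by simp))
    · obtain ⟨rfl, rfl⟩ := con_two_inj hX
      refine con_obs_congr _ fun j hj => ?_
      refine Fin.cases rfl (Fin.cases rfl (Fin.cases ?_ (Fin.cases ?_ fun i => i.elim0)))
      · exact hD j hj 0 d hd
      · exact ih (fun i hi l => hD i (hi.trans hj) l.succ) he

/-- The constants in the index rule out all alternatives but one, and injectivity fixes the
quantified arguments outright. Only the derivations among the arguments need the induction
hypothesis, at smaller depths. -/
theorem proof_unique_obs (k : ℕ) {n : ℕ} (M : BohmTree C n) (D : OTm (Con5 C) n)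
    (h : Checks D (ofam1 .prodc M.enc)) : D.obs k = M.proof.obs k := by
  induction k using Nat.strong_induction_on generalizing n with
  | _ k ih =>
  rcases M.exists_eq with ⟨b, rfl⟩ | ⟨x, m, T, rfl⟩ | ⟨c, m, T, rfl⟩
  · rw [enc_lam] at h
    rw [proof_lam]
    obtain ⟨b', d, rfl, hX, hd⟩ | ⟨R, d, rfl, hX, -⟩ := h.prodc_inv
    · obtain rfl := OTm.lam_injective (con_one_inj hX)
      refine con_obs_congr _ fun j hj => Fin.cases rfl (Fin.cases ?_ fun i => i.elim0)
      change d.lam.obs j = _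
      rw [lam_obs, ih j hj b d hd, ← lam_obs]
      rfl
    · exact absurd hX (con_ne (by simp))
  · rw [enc_var] at h
    rw [proof_var]
    obtain ⟨b', d, rfl, hX, hd⟩ | ⟨R, d, rfl, hX, hd⟩ := h.prodc_inv
    · exact absurd hX (con_ne (by simp))
    · obtain rfl := con_one_inj hX
      obtain ⟨S, V, d, rfl, hX, hd'⟩ | ⟨S, V, d, rfl, hX, -⟩ := hd.prodn_inv
      · obtain ⟨rfl, rfl⟩ := con_two_inj hX
        refine con_obs_congr _ fun j hj => Fin.cases rfl (Fin.cases ?_ fun i => i.elim0)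
        refine con_obs_congr _ fun i hi => Fin.cases rfl (Fin.cases rfl
          (Fin.cases ?_ fun i => i.elim0))
        exact ospineProof_unique false
          (fun l hl a e he => ih l (hl.trans (hi.trans hj)) (T a) e he) hd'
      · exact absurd hX (con_ne (by simp))
  · rw [enc_con] at h
    rw [proof_con]
    obtain ⟨b', d, rfl, hX, hd⟩ | ⟨R, d, rfl, hX, hd⟩ := h.prodc_inv
    · exact absurd hX (con_ne (by simp))
    · obtain rfl := con_one_inj hX
      obtain ⟨S, V, d, rfl, hX, -⟩ | ⟨S, V, d, rfl, hX, hd'⟩ := hd.prodn_inv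
      · exact absurd hX (con_ne (by simp))
      · obtain ⟨rfl, rfl⟩ := con_two_inj hX
        refine con_obs_congr _ fun j hj => Fin.cases rfl (Fin.cases ?_ fun i => i.elim0)
        refine con_obs_congr _ fun i hi => Fin.cases rfl (Fin.cases rfl
          (Fin.cases ?_ fun i => i.elim0))
        exact ospineProof_unique true
          (fun l hl a e he => ih l (hl.trans (hi.trans hj)) (T a) e he) hd'

theorem prodc_eq (M : BohmTree C n) : M.prodc = (ofam1 .prodc M.enc).obs := by
  funext k
  cases k with
  | zero => rfl
  | succ k =>
    refine congrArg (Ty.atom _ 1) (funext fun i => ?_)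
    obtain rfl := Subsingleton.elim i 0
    rfl

theorem oCheck_prodc_iff (M : BohmTree C n) (D : OTm (Con5 C) n) :
    OCheck (sig5 C) (varsCtx C n) D M.prodc ↔ D = M.proof := by
  rw [prodc_eq]
  constructor
  · intro h
    ext k
    exact proof_unique_obs k M D h
  · rintro rfl k
    exact checkAt_proof k M

end Sig5

/-! ## Traces of the derivation of productivity -/

/-- Occurring infinitely often is insensitive to finite prefixes, so trace conditions move freely
between a trace and its tails. -/
theorem Nat.infinite_setOf_add_iff (p : ℕ → Prop) (N : ℕ) :
    {j | p (j + N)}.Infinite ↔ {j | p j}.Infinite := by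
  rw [← Nat.frequently_atTop_iff_infinite, ← Nat.frequently_atTop_iff_infinite,
    ← Filter.frequently_map (P := p) (m := (· + N)), Filter.map_add_atTop_eq_nat]

namespace OTm

variable {K : Type u} {n : ℕ} {c : K} {t : ℕ → Head K}

theorem isTrace_con_zero {S : Fin 0 → OTm K n} : ¬(con c 0 S).IsTrace t := by
  rw [isTrace_con]
  exact fun ⟨_, i, _⟩ => i.elim0

theorem isTrace_con_one {M : OTm K n} : (con c 1 ![M]).IsTrace t ↔
    t 0 = .con c ∧ M.IsTrace fun j => t (j + 1) := by
  simp [isTrace_con]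

theorem isTrace_con_two {M N : OTm K n} : (con c 2 ![M, N]).IsTrace t ↔
    t 0 = .con c ∧ ((M.IsTrace fun j => t (j + 1)) ∨ N.IsTrace fun j => t (j + 1)) := by
  simp [isTrace_con, Fin.exists_fin_succ]

theorem isTrace_con_three {M N P : OTm K n} : (con c 3 ![M, N, P]).IsTrace t ↔
    t 0 = .con c ∧ ((M.IsTrace fun j => t (j + 1)) ∨ (N.IsTrace fun j => t (j + 1)) ∨
      P.IsTrace fun j => t (j + 1)) := by
  simp [isTrace_con, Fin.exists_fin_succ]

theorem isTrace_con_four {M N P Q : OTm K n} : (con c 4 ![M, N, P, Q]).IsTrace t ↔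
    t 0 = .con c ∧ ((M.IsTrace fun j => t (j + 1)) ∨ (N.IsTrace fun j => t (j + 1)) ∨
      (P.IsTrace fun j => t (j + 1)) ∨ Q.IsTrace fun j => t (j + 1)) := by
  simp [isTrace_con, Fin.exists_fin_succ]

end OTm

namespace BohmTree

variable {C : Type u} {n : ℕ}

theorem Productive.lam_inv {b : BohmTree C (n + 1)} (h : b.lam.Productive) : b.Productive :=
  fun t ht => h t ((isTrace_lam b t).2 ht)

theorem Productive.var_inv {x : Fin n} {m : ℕ} {T : Fin m → BohmTree C n}
    (h : (var x m T).Productive) (i : Fin m) : (T i).Productive := by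
  intro t ht
  have := h (fun j => Nat.casesOn j (.var x) t) ((isTrace_var _ _ _ _).2 ⟨rfl, i, ht⟩)
  exact (Nat.infinite_setOf_add_iff _ 1).2 this

theorem Productive.con_inv {c : C} {m : ℕ} {T : Fin m → BohmTree C n}
    (h : (con c m T).Productive) (i : Fin m) : (T i).Productive := by
  intro t ht
  have := h (fun j => Nat.casesOn j (.con c) t) ((isTrace_con _ _ _ _).2 ⟨rfl, i, ht⟩)
  exact (Nat.infinite_setOf_add_iff _ 1).2 this

end BohmTree

-- Infinite traces of encodings

namespace Sig5

variable {C : Type u} {n : ℕ}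

/-- The condition on traces of valid terms. -/
def Good (t : ℕ → Head (Con5 C)) : Prop :=
  ∃ c, (sig5 C).IsCo c ∧ {j | t j = .con c}.Infinite ∧
    ∀ d, {j | t j = .con d}.Infinite → (sig5 C).conPriority d ≤ (sig5 C).conPriority c

theorem good_add_iff (t : ℕ → Head (Con5 C)) (N : ℕ) : Good (fun j => t (j + N)) ↔ Good t := by
  simp only [Good, fun c : Con5 C => Nat.infinite_setOf_add_iff (fun j => t j = .con c) N]

/-- Traces of encodings. -/
inductive EncTrace (t : ℕ → Head (Con5 C)) : Prop
  | ctm {n : ℕ} (M : BohmTree C n) (h : M.enc.IsTrace t)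
  | ntm {n m : ℕ} {c : Con5 C} (hc : c = .varntm ∨ c = .constntm) {V : OTm (Con5 C) n}
      (hV : ∀ t, ¬V.IsTrace t) (T : Fin m → BohmTree C n)
      (h : (OTm.con c 2 ![V, ospine m fun i => (T i).enc]).IsTrace t)
  | spine {n m : ℕ} (T : Fin m → BohmTree C n) (h : (ospine m fun i => (T i).enc).IsTrace t)

/-- The head argument `V` has no infinite trace, so only constants of `ctm`, `spine` and `ntm` are
met; the bound `2` is the priority of `ntm`. -/
theorem EncTrace.tail {t : ℕ → Head (Con5 C)} (h : EncTrace t) :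
    (∃ c, t 0 = .con c ∧ (sig5 C).conPriority c ≤ 2) ∧ EncTrace fun j => t (j + 1) := by
  cases h with
  | ctm M h =>
    rcases M.exists_eq with ⟨b, rfl⟩ | ⟨x, m, T, rfl⟩ | ⟨c, m, T, rfl⟩
    · rw [enc_lam, OTm.isTrace_con_one, OTm.isTrace_lam] at h
      exact ⟨⟨_, h.1, Nat.zero_le _⟩, .ctm b h.2⟩
    · rw [enc_var, OTm.isTrace_con_one] at h
      exact ⟨⟨_, h.1, Nat.zero_le _⟩, .ntm (.inl rfl) (OTm.not_isTrace_var x _) T h.2⟩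
    · rw [enc_con, OTm.isTrace_con_one] at h
      exact ⟨⟨_, h.1, Nat.zero_le _⟩, .ntm (.inr rfl) (fun _ => OTm.isTrace_con_zero) T h.2⟩
  | ntm hc hV T h =>
    rw [OTm.isTrace_con_two] at h
    obtain ⟨h₀, h | h⟩ := h
    · exact absurd h (hV _)
    · refine ⟨⟨_, h₀, ?_⟩, .spine T h⟩
      obtain rfl | rfl := hc <;> exact le_rfl
  | @spine n m T h =>
    cases m with
    | zero => exact absurd h OTm.isTrace_con_zero
    | succ m =>
      rw [ospine, OTm.isTrace_con_two] at h
      obtain ⟨h₀, h | h⟩ := h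
      · exact ⟨⟨_, h₀, Nat.le_succ 1⟩, .ctm _ h⟩
      · exact ⟨⟨_, h₀, Nat.le_succ 1⟩, .spine _ h⟩

theorem EncTrace.add {t : ℕ → Head (Con5 C)} (h : EncTrace t) (N : ℕ) :
    EncTrace fun j => t (j + N) := by
  induction N with
  | zero => exact h
  | succ N ih =>
    have := ih.tail.2
    simpa only [Nat.add_right_comm _ 1 N, Nat.add_assoc] using this

theorem exists_ntm_of_enc (M : BohmTree C n) : ∀ t, M.enc.IsTrace t →
    ∃ j, t j = .con .varntm ∨ t j = .con .constntm := by
  induction M using BohmTree.induction_lam with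
  | lam b ih =>
    intro t h
    rw [enc_lam, OTm.isTrace_con_one, OTm.isTrace_lam] at h
    obtain ⟨j, hj⟩ := ih _ h.2
    exact ⟨j + 1, hj⟩
  | var x m T =>
    intro t h
    rw [enc_var, OTm.isTrace_con_one, OTm.isTrace_con_two] at h
    exact ⟨1, .inl h.2.1⟩
  | con c m T =>
    intro t h
    rw [enc_con, OTm.isTrace_con_one, OTm.isTrace_con_two] at h
    exact ⟨1, .inr h.2.1⟩

/-- A spine is finite, so a trace in it must enter an element. The abstraction prefix there is
finite as well, and it is followed by `base` and then a constructor of `ntm`. -/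
theorem EncTrace.exists_ntm {t : ℕ → Head (Con5 C)} (h : EncTrace t) :
    ∃ j, t j = .con .varntm ∨ t j = .con .constntm := by
  cases h with
  | ctm M h => exact exists_ntm_of_enc M t h
  | ntm hc hV T h =>
    rw [OTm.isTrace_con_two] at h
    refine ⟨0, ?_⟩
    obtain rfl | rfl := hc
    · exact .inl h.1
    · exact .inr h.1
  | @spine n m T h =>
    induction m generalizing t with
    | zero => exact absurd h OTm.isTrace_con_zero
    | succ m ih =>
      rw [ospine, OTm.isTrace_con_two] at h
      obtain ⟨h₀, h | h⟩ := h
      · obtain ⟨j, hj⟩ := exists_ntm_of_enc _ _ h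
        exact ⟨j + 1, hj⟩
      · obtain ⟨j, hj⟩ := ih _ h
        exact ⟨j + 1, hj⟩

/-- One of `varntm` and `constntm` must occur infinitely often, since together they do. Both are
coinductive and of the highest priority present. -/
theorem EncTrace.good {t : ℕ → Head (Con5 C)} (h : EncTrace t) : Good t := by
  have hinf : ({j | t j = .con .varntm} ∪ {j | t j = .con .constntm}).Infinite := by
    refine Set.infinite_of_forall_exists_gt fun N => ?_
    obtain ⟨j, hj⟩ := (h.add (N + 1)).exists_ntm
    exact ⟨j + (N + 1), hj, by omega⟩
  have hle : ∀ d, {j | t j = .con d}.Infinite → (sig5 C).conPriority d ≤ 2 := fun d hd => by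
    obtain ⟨j, hj⟩ := hd.nonempty
    obtain ⟨⟨c, hc, hc'⟩, -⟩ := (h.add j).tail
    simp only [Nat.zero_add] at hc
    rw [Set.mem_ofPred_eq, hc] at hj
    cases hj
    exact hc'
  rcases Set.infinite_union.1 hinf with h | h
  · exact ⟨.varntm, trivial, h, hle⟩
  · exact ⟨.constntm, trivial, h, hle⟩

/-! ### Productive trees have valid derivations -/

/-- Traces of derivations, of productive trees. -/
inductive ProofTrace (t : ℕ → Head (Con5 C)) : Prop
  | prodc {n : ℕ} (M : BohmTree C n) (hM : M.Productive) (h : M.proof.IsTrace t)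
  | prodn {n m : ℕ} {c : Con5 C} {β : Bool} {V : OTm (Con5 C) n} (hV : ∀ t, ¬V.IsTrace t)
      (T : Fin m → BohmTree C n) (hT : ∀ i, (T i).Productive)
      (h : (OTm.con c 3 ![ospine m fun i => (T i).enc, V,
        ospineProof β m (fun i => (T i).enc) fun i => (T i).proof]).IsTrace t)
  | spine {n m : ℕ} (β : Bool) (T : Fin m → BohmTree C n) (hT : ∀ i, (T i).Productive)
      (h : (ospineProof β m (fun i => (T i).enc) fun i => (T i).proof).IsTrace t)

theorem ProofTrace.tail {t : ℕ → Head (Con5 C)} (h : ProofTrace t) :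
    (EncTrace fun j => t (j + 1)) ∨ ProofTrace fun j => t (j + 1) := by
  cases h with
  | prodc M hM h =>
    rcases M.exists_eq with ⟨b, rfl⟩ | ⟨x, m, T, rfl⟩ | ⟨c, m, T, rfl⟩
    · rw [proof_lam, OTm.isTrace_con_two, OTm.isTrace_lam, OTm.isTrace_lam] at h
      exact h.2.imp (.ctm b) (.prodc b hM.lam_inv)
    · rw [proof_var, OTm.isTrace_con_two] at h
      exact h.2.imp (.ntm (.inl rfl) (OTm.not_isTrace_var x _) T)
        (.prodn (OTm.not_isTrace_var x _) T hM.var_inv)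
    · rw [proof_con, OTm.isTrace_con_two] at h
      exact h.2.imp (.ntm (.inr rfl) (fun _ => OTm.isTrace_con_zero) T)
        (.prodn (fun _ => OTm.isTrace_con_zero) T hM.con_inv)
  | prodn hV T hT h =>
    rw [OTm.isTrace_con_three] at h
    obtain ⟨-, h | h | h⟩ := h
    · exact .inl (.spine T h)
    · exact absurd h (hV _)
    · exact .inr (.spine _ T hT h)
  | @spine n m β T hT h =>
    cases m with
    | zero => exact absurd h OTm.isTrace_con_zero
    | succ m =>
      rw [ospineProof, OTm.isTrace_con_four] at h
      obtain ⟨-, h | h | h | h⟩ := h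
      · exact .inl (.ctm _ h)
      · exact .inl (.spine _ h)
      · exact .inr (.prodc _ (hT 0) h)
      · exact .inr (.spine β _ (fun i => hT i.succ) h)

/-- The constant `p8` does not occur and no tail of the trace is a trace of an encoding. -/
def Clean (t : ℕ → Head (Con5 C)) : Prop :=
  (∀ j, t j ≠ .con .p8) ∧ ∀ N, ¬EncTrace fun j => t (j + N)

theorem Clean.tail {t : ℕ → Head (Con5 C)} (h : Clean t) : Clean fun j => t (j + 1) :=
  ⟨fun j => h.1 (j + 1), fun N => by simpa only [Nat.add_assoc] using h.2 (N + 1)⟩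

/-- Below a constant head every cons cell is a `p8`, so `β` is `false`; as the spine is finite, the
trace ends up in the derivation for one of its elements. -/
theorem Clean.spine {m : ℕ} {β : Bool} {T : Fin m → BohmTree C n} {t : ℕ → Head (Con5 C)}
    (ht : Clean t) (h : (ospineProof β m (fun i => (T i).enc) fun i => (T i).proof).IsTrace t) :
    β = false ∧ ∃ i u, (T i).proof.IsTrace u ∧ Clean u := by
  induction m generalizing t with
  | zero => exact absurd h OTm.isTrace_con_zero
  | succ m ih =>
    rw [ospineProof, OTm.isTrace_con_four] at h
    have hβ : β = false := by
      cases β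
      · rfl
      · exact absurd h.1 (ht.1 0)
    refine ⟨hβ, ?_⟩
    obtain ⟨-, h | h | h | h⟩ := h
    · exact absurd (.ctm _ h) (ht.2 1)
    · exact absurd (.spine _ h) (ht.2 1)
    · exact ⟨0, _, h, ht.tail⟩
    · obtain ⟨i, u, hu⟩ := (ih ht.tail h).2
      exact ⟨i.succ, u, hu⟩

/-- One step of a constant-free trace of the tree. Abstractions are invisible in traces and are
skipped by induction on the prefix; a constant head would force a `p8`. -/
theorem Clean.step (M : BohmTree C n) : ∀ t, M.proof.IsTrace t → Clean t →
    ∃ (x i : ℕ) (l : ℕ) (M' : BohmTree C l) (u : ℕ → Head (Con5 C)), M.HeadAt [] (.var x) ∧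
      (∀ p g, M'.HeadAt p g → M.HeadAt (i :: p) g) ∧ M'.proof.IsTrace u ∧ Clean u := by
  induction M using BohmTree.induction_lam with
  | lam b ih =>
    intro t h ht
    rw [proof_lam, OTm.isTrace_con_two, OTm.isTrace_lam, OTm.isTrace_lam] at h
    obtain ⟨-, h | h⟩ := h
    · exact absurd (.ctm _ h) (ht.2 1)
    · simpa only [BohmTree.headAt_lam] using ih _ h ht.tail
  | var x m T =>
    intro t h ht
    rw [proof_var, OTm.isTrace_con_two] at h
    obtain ⟨-, h | h⟩ := h
    · exact absurd (.ntm (.inl rfl) (OTm.not_isTrace_var x _) T h) (ht.2 1)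
    · rw [OTm.isTrace_con_three] at h
      obtain ⟨-, h | h | h⟩ := h
      · exact absurd (.spine T h) (ht.2 2)
      · exact absurd h (OTm.not_isTrace_var x _ _)
      · obtain ⟨-, i, u, hu, hu'⟩ := ht.tail.tail.spine h
        exact ⟨x, i, _, T i, u, (BohmTree.headAt_var_nil _ _ _ _).2 rfl,
          fun p g hg => (BohmTree.headAt_var_cons _ _ _ _ _ _).2 ⟨i.2, hg⟩, hu, hu'⟩
  | con c m T =>
    intro t h ht
    rw [proof_con, OTm.isTrace_con_two] at h
    obtain ⟨-, h | h⟩ := h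
    · exact absurd (.ntm (.inr rfl) (fun _ => OTm.isTrace_con_zero) T h) (ht.2 1)
    · rw [OTm.isTrace_con_three] at h
      obtain ⟨-, h | h | h⟩ := h
      · exact absurd (.spine T h) (ht.2 2)
      · exact absurd h OTm.isTrace_con_zero
      · cases (ht.tail.tail.spine h).1

/-- Iterating `Clean.step` produces an infinite trace of `M` with variable heads only. -/
theorem Clean.not_productive {M : BohmTree C n} {t : ℕ → Head (Con5 C)} (h : M.proof.IsTrace t)
    (ht : Clean t) : ¬M.Productive := by
  intro hM
  obtain ⟨u, hu, hu'⟩ := exists_trace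
    (P := fun A => ∃ (n : ℕ) (M : BohmTree C n) (t : ℕ → Head (Con5 C)),
      A = M.HeadAt ∧ M.proof.IsTrace t ∧ Clean t)
    (Q := fun h => ∃ x, h = .var x) (by
      rintro _ ⟨n, M, t, rfl, h, ht⟩
      obtain ⟨x, i, l, M', u, h₁, h₂, h₃, h₄⟩ := Clean.step M t h ht
      exact ⟨.var x, i, M'.HeadAt, h₁, h₂, ⟨x, rfl⟩, l, M', u, rfl, h₃, h₄⟩)
    M.HeadAt ⟨n, M, t, rfl, h, ht⟩
  obtain ⟨j, c, hj⟩ := (hM u hu).nonempty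
  obtain ⟨x, hx⟩ := hu' j
  rw [hx] at hj
  cases hj

theorem ProofTrace.not_clean {t : ℕ → Head (Con5 C)} (h : ProofTrace t) : ¬Clean t := by
  intro ht
  cases h with
  | prodc M hM h => exact ht.not_productive h hM
  | prodn hV T hT h =>
    rw [OTm.isTrace_con_three] at h
    obtain ⟨-, h | h | h⟩ := h
    · exact absurd (.spine T h) (ht.2 1)
    · exact absurd h (hV _)
    · obtain ⟨-, i, u, hu, hu'⟩ := ht.tail.spine h
      exact hu'.not_productive hu (hT i)
  | spine β T hT h =>
    obtain ⟨-, i, u, hu, hu'⟩ := ht.spine h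
    exact hu'.not_productive hu (hT i)

theorem conPriority_le (c : Con5 C) : (sig5 C).conPriority c ≤ (sig5 C).conPriority .p8 := by
  change Sig5.priority _ ≤ 8
  cases (Sig5.type c).target <;> simp [Sig5.priority]

theorem valid_of_productive {M : BohmTree C n} (hM : M.Productive) :
    M.proof.Valid (sig5 C) := by
  intro t ht
  by_cases hE : ∃ N, EncTrace fun j => t (j + N)
  · obtain ⟨N, hN⟩ := hE
    exact (good_add_iff t N).1 hN.good
  · by_cases hp : {j | t j = .con .p8}.Infinite
    -- The family `prods` is declared last, so no constant has a higher priority than `p8`.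
    · exact ⟨.p8, trivial, hp, fun d _ => conPriority_le d⟩
    · exfalso
      have hP : ∀ N, ProofTrace fun j => t (j + N) := fun N => by
        induction N with
        | zero => exact .prodc M hM ht
        | succ N ih =>
          have := ih.tail
          simp only [Nat.add_assoc, Nat.add_comm 1 N] at this
          exact this.resolve_left fun h => hE ⟨_, h⟩
      -- Past the last `p8` the tail is clean, yet by `hP` it still runs through derivations for
      -- productive trees.
      obtain ⟨N, hN⟩ := (Set.not_infinite.1 hp).bddAbove
      refine (hP (N + 1)).not_clean ⟨fun j hj => ?_, fun L h => hE ⟨L + (N + 1), ?_⟩⟩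
      · have := hN hj
        omega
      · simpa only [Nat.add_assoc] using h

/-! ### Trees with valid derivations are productive -/

theorem valid_con_inv {m : ℕ} {c : Con5 C} {S : Fin m → OTm (Con5 C) n}
    (h : (OTm.con c m S).Valid (sig5 C)) (i : Fin m) : (S i).Valid (sig5 C) := by
  intro t ht
  have := h (fun j => Nat.casesOn j (.con c) t) ((OTm.isTrace_con _ _ _ _).2 ⟨rfl, i, ht⟩)
  exact (good_add_iff _ 1).2 this

theorem valid_spine_inv {m : ℕ} {β : Bool} {E D : Fin m → OTm (Con5 C) n}
    (h : (ospineProof β m E D).Valid (sig5 C)) (i : Fin m) : (D i).Valid (sig5 C) := by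
  induction m with
  | zero => exact i.elim0
  | succ m ih =>
    cases i using Fin.cases with
    | zero => exact valid_con_inv h 2
    | succ i => exact ih (valid_con_inv h 3) i

/-- Validity passes to arguments because prefixes do not matter. One step in the tree corresponds to
several in the derivation: the `p1`s of the prefix, `p2`, then `p3` or `p4`, and the cells of the
spine. -/
theorem exists_valid_tail (M : BohmTree C n) : M.proof.Valid (sig5 C) → ∀ u, M.IsTrace u →
    ∃ (l : ℕ) (M' : BohmTree C l), M'.proof.Valid (sig5 C) ∧ M'.IsTrace fun j => u (j + 1) := by
  induction M using BohmTree.induction_lam with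
  | lam b ih =>
    intro h u hu
    rw [proof_lam] at h
    refine ih (fun t ht => ?_) u ((BohmTree.isTrace_lam _ _).1 hu)
    exact valid_con_inv h 1 t ((OTm.isTrace_lam _ _).2 ht)
  | var x m T =>
    intro h u hu
    rw [proof_var] at h
    obtain ⟨-, i, hi⟩ := (BohmTree.isTrace_var _ _ _ _).1 hu
    -- Argument `1` of `p2` and argument `2` of `p3` are the subderivations; the others are
    -- quantified arguments.
    exact ⟨_, T i, valid_spine_inv (valid_con_inv (valid_con_inv h 1) 2) i, hi⟩
  | con c m T =>
    intro h u hu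
    rw [proof_con] at h
    obtain ⟨-, i, hi⟩ := (BohmTree.isTrace_con _ _ _ _).1 hu
    exact ⟨_, T i, valid_spine_inv (valid_con_inv (valid_con_inv h 1) 2) i, hi⟩

theorem exists_valid_add {M : BohmTree C n} (h : M.proof.Valid (sig5 C)) {u : ℕ → Head C}
    (hu : M.IsTrace u) (N : ℕ) : ∃ (l : ℕ) (M' : BohmTree C l), M'.proof.Valid (sig5 C) ∧
      M'.IsTrace fun j => u (j + N) := by
  induction N with
  | zero => exact ⟨n, M, h, hu⟩
  | succ N ih =>
    obtain ⟨l, M', h', hu'⟩ := ih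
    obtain ⟨l', M'', h'', hu''⟩ := exists_valid_tail M' h' _ hu'
    refine ⟨l', M'', h'', ?_⟩
    simpa only [Nat.add_right_comm _ 1 N, Nat.add_assoc] using hu''

/-- The tree has a trace without constants. -/
def HasVarTrace (M : BohmTree C n) : Prop := ∃ u, M.IsTrace u ∧ ∀ j, ∃ x, u j = .var x

/-- Derivations for trees with a trace without constants. -/
inductive VarProof : {n : ℕ} → OTm (Con5 C) n → Prop
  | prodc {n : ℕ} {M : BohmTree C n} (h : HasVarTrace M) : VarProof M.proof
  | prodn {n m : ℕ} {S V : OTm (Con5 C) n} {T : Fin m → BohmTree C n} {i : Fin m}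
      (h : HasVarTrace (T i)) : VarProof (.con .p3 3 ![S, V,
        ospineProof false m (fun i => (T i).enc) fun i => (T i).proof])
  | spine {n m : ℕ} {T : Fin m → BohmTree C n} {i : Fin m} (h : HasVarTrace (T i)) :
      VarProof (ospineProof false m (fun i => (T i).enc) fun i => (T i).proof)

/-- Only `p1`, `p2`, `p3` and `p6` are used. An abstraction consumes no step of the given trace of
the tree, and a constant at its root is excluded by assumption. -/
theorem VarProof.step {D : OTm (Con5 C) n} (h : VarProof D) :
    ∃ (c : Con5 C) (i l : ℕ) (D' : OTm (Con5 C) l), D.HeadAt [] (.con c) ∧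
      (∀ p g, D'.HeadAt p g → D.HeadAt (i :: p) g) ∧ ¬(sig5 C).IsCo c ∧ VarProof D' := by
  cases h with
  | @prodc M h =>
    obtain ⟨u, hu, hu'⟩ := h
    rcases M.exists_eq with ⟨b, rfl⟩ | ⟨x, m, T, rfl⟩ | ⟨c, m, T, rfl⟩
    · rw [BohmTree.isTrace_lam] at hu
      rw [proof_lam]
      exact ⟨.p1, 1, _, b.proof, (OTm.headAt_con_nil _ _ _ _).2 rfl,
        fun p g hg => (OTm.headAt_con_cons _ _ _ _ _ _).2
          ⟨Nat.one_lt_two, (OTm.headAt_lam _ _ _).2 hg⟩, id, .prodc ⟨u, hu, hu'⟩⟩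
    · rw [BohmTree.isTrace_var] at hu
      obtain ⟨-, i, hi⟩ := hu
      rw [proof_var]
      exact ⟨.p2, 1, _, _, (OTm.headAt_con_nil _ _ _ _).2 rfl,
        fun p g hg => (OTm.headAt_con_cons _ _ _ _ _ _).2 ⟨Nat.one_lt_two, hg⟩, id,
        .prodn (i := i) ⟨_, hi, fun j => hu' (j + 1)⟩⟩
    · rw [BohmTree.isTrace_con] at hu
      obtain ⟨x, hx⟩ := hu' 0
      rw [hu.1] at hx
      cases hx
  | prodn h =>
    exact ⟨.p3, 2, _, _, (OTm.headAt_con_nil _ _ _ _).2 rfl,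
      fun p g hg => (OTm.headAt_con_cons _ _ _ _ _ _).2 ⟨Nat.lt_succ_self 2, hg⟩, id, .spine h⟩
  | @spine m T i h =>
    cases m with
    | zero => exact i.elim0
    | succ m =>
      cases i using Fin.cases with
      | zero =>
        exact ⟨.p6, 2, _, _, (OTm.headAt_con_nil _ _ _ _).2 rfl,
          fun p g hg => (OTm.headAt_con_cons _ _ _ _ _ _).2 ⟨by decide, hg⟩, id, .prodc h⟩
      | succ i =>
        exact ⟨.p6, 3, _, _, (OTm.headAt_con_nil _ _ _ _).2 rfl,
          fun p g hg => (OTm.headAt_con_cons _ _ _ _ _ _).2 ⟨by decide, hg⟩, id,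
          .spine (T := fun i => T i.succ) (i := i) h⟩

theorem VarProof.not_valid {D : OTm (Con5 C) n} (h : VarProof D) : ¬D.Valid (sig5 C) := by
  intro hD
  obtain ⟨t, ht, ht'⟩ := exists_trace
    (P := fun A => ∃ (n : ℕ) (D : OTm (Con5 C) n), A = D.HeadAt ∧ VarProof D)
    (Q := fun h => ∃ c, h = .con c ∧ ¬(sig5 C).IsCo c) (by
      rintro _ ⟨n, D, rfl, h⟩
      obtain ⟨c, i, l, D', h₁, h₂, h₃, h₄⟩ := h.step
      exact ⟨.con c, i, D'.HeadAt, h₁, h₂, ⟨c, rfl, h₃⟩, l, D', rfl, h₄⟩)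
    D.HeadAt ⟨n, D, rfl, h⟩
  obtain ⟨c, hc, hinf, -⟩ := hD t ht
  obtain ⟨j, hj⟩ := hinf.nonempty
  obtain ⟨d, hd, hd'⟩ := ht' j
  rw [Set.mem_ofPred_eq, hd] at hj
  cases hj
  exact hd' hc

/-- If constants stopped occurring along a trace, the tail after the last one would be a
constant-free trace of a subtree whose derivation is still valid, against `VarProof.not_valid`. -/
theorem productive_of_valid {M : BohmTree C n} (h : M.proof.Valid (sig5 C)) : M.Productive := by
  intro u hu
  by_contra hinf
  obtain ⟨N, hN⟩ := (Set.not_infinite.1 hinf).bddAbove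
  obtain ⟨l, M', hM', hu'⟩ := exists_valid_add h hu (N + 1)
  refine (VarProof.prodc ⟨_, hu', fun j => ?_⟩).not_valid hM'
  cases e : u (j + (N + 1)) with
  | var x => exact ⟨x, rfl⟩
  | con c =>
    have := hN ⟨c, e⟩
    omega

end Sig5

theorem mainTheorem9 {C : Type*} {n : ℕ} (M : BohmTree C n) :
    (M.Productive ↔ ∃ D, IsCanonical (sig5 C) (varsCtx C n) D M.prodc) ∧
      ∃! D, OCheck (sig5 C) (varsCtx C n) D M.prodc := by
  refine ⟨⟨fun h => ⟨M.proof, (Sig5.oCheck_prodc_iff M _).2 rfl, Sig5.valid_of_productive h⟩, ?_⟩,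
    M.proof, (Sig5.oCheck_prodc_iff M _).2 rfl, fun D hD => (Sig5.oCheck_prodc_iff M D).1 hD⟩
  rintro ⟨D, hD, hD'⟩
  rw [(Sig5.oCheck_prodc_iff M D).1 hD] at hD'
  exact Sig5.productive_of_valid hD'
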